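/- **Setting.** Let $\Gamma=\mathrm{Span}_{\mathbb Z}\{a_1,\dots,a_d\}$ be a Bravais lattice in $\mathbb R^d$, and let $\mathcal X$ be either $\mathbb R^d$ with the Lebesgue measure or a $\Gamma$-invariant discrete subset of $\mathbb R^d$ (finitely many points in each compact set) with the counting measure. Let $\mathcal H=L^2(\mathcal X)\otimes\mathbb C^N$, with (magnetic) translations $(T_\gamma\psi)(x)=M(\gamma,x)\psi(x-\gamma)$, $\gamma\in\Gamma$, for (measurable) unitaries $M(\gamma,x)$ of $\mathbb C^N$ with $M(\gamma_1+\gamma_2,x)=M(\gamma_2,x)M(\gamma_1,x-\gamma_2)$. An operator is *periodic* if it commutes with all $T_\gamma$. $X_j$ is multiplication by $x_j$, $j\in\{1,\dots,d\}$. Let $\mathcal H_{\rm f}$ be the space of locally $L^2$ functions $\varphi:\mathcal X\to\mathbb C^N$ with $T_\gamma\varphi=\varphi$ for all $\gamma\in\Gamma$, with the $L^2$ norm on a fundamental cell; let $\Gamma^*$ be the dual lattice, $\mathbb B^d$ a fundamental cell of it, $(\varrho(\gamma^*)\varphi)(y)=e^{-i\gamma^*\cdot y}\varphi(y)$ for $\gamma^*\in\Gamma^*$,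 and let $\mathcal U$ be the Bloch–Floquet–Zak transform $(\mathcal U\psi)(k,y)=e^{-ik\cdot y}\sum_{\gamma\in\Gamma}e^{ik\cdot\gamma}(T_\gamma\psi)(y)$ from $\mathcal H$ onto the locally $L^2$, $\varrho$-equivariant functions $\mathbb R^d\to\mathcal H_{\rm f}$, with inverse $(\mathcal U^{-1}\varphi)(x)=|\mathbb B^d|^{-1}\int_{\mathbb B^d}e^{ik\cdot x}\varphi(k,x)\,dk$. For $L\in 2\mathbb N+1$ let $\mathcal C_L=\{x\in\mathcal X: x=\sum_j\alpha_ja_j,\ |\alpha_j|\le L/2\}$ and $\chi_L=\chi_{\mathcal C_L}$. If $A$ is trace class on compact sets (that is, $\chi_KA\chi_K$ is trace class for every compact $K$), its trace per unit volume is $\tau(A)=\lim_{L\to\infty,\,L\in2\mathbb N+1}|\mathcal C_L|^{-1}\mathrm{Tr}(\chi_LA\chi_L)$, whenever the limit exists. **Hamiltonian.** $H_0$ is a self-adjoint periodic operator on $\mathcal H$, bounded from below, with $\mathcal UH_0\,\mathcal U^{-1}=\int^\oplus H_0(k)\,dk$, where the $H_0(k)$ are self-adjoint with a common dense domain $\mathcal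 D_{\rm f}\subset\mathcal H_{\rm f}$, $\varrho(\gamma^*)\mathcal D_{\rm f}\subset\mathcal D_{\rm f}$ for all $\gamma^*\in\Gamma^*$, and $k\mapsto H_0(k)\in\mathcal L(\mathcal D_{\rm f},\mathcal H_{\rm f})$ is smooth and $\varrho$-equivariant for the graph norm of $H_0(0)$ on $\mathcal D_{\rm f}$. Let $\mu\in\mathbb R$ lie in a spectral gap of $H_0$, and assume that $\Pi_0=\chi_{(-\infty,\mu)}(H_0)$ has fibres $\Pi_0(k)$ of finite rank. Let $\mathcal P(\mathcal H_1,\mathcal H_2)$, for $\mathcal H_1,\mathcal H_2\in\{\mathcal D_{\rm f},\mathcal H_{\rm f}\}$, be the space of periodic operators with a smooth fibration $\mathbb R^d\to\mathcal L(\mathcal H_1,\mathcal H_2)$, and $\mathcal P(\mathcal H_1)=\mathcal P(\mathcal H_1,\mathcal H_1)$. Let $\overline{[X_j,\Pi_0]}$ be the closure of the commutator restricted to the $\psi\in\mathcal H$ for which $\mathcal U\psi$ is a smooth $\mathcal H_{\rm f}$-valued function, and let $$\Pi_1=\mathcal I\big(\overline{[X_j,\Pi_0]}\big),\qquad \mathcal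 I(A)=\frac{i}{2\pi}\oint_C (H_0-z)^{-1}[A,\Pi_0](H_0-z)^{-1}\,dz,$$ where $C$ is a positively oriented circle that encloses the part of the spectrum of $H_0$ below $\mu$, and leaves outside the part above $\mu$. **Statement.** $\overline{[X_j,\Pi_0]}$ is a bounded operator defined on all of $\mathcal H$, and the following holds. 1. For every $B\in\mathcal P(\mathcal H_{\rm f})\cap\mathcal P(\mathcal D_{\rm f})$ (in particular, $B$ is bounded and periodic) both sides of $$\tau\big(i[H_0,B]\,\Pi_1\big)=\tau\big(i\,\Pi_0\big[[B,\Pi_0],[X_j,\Pi_0]\big]\big)$$ exist, and they are equal. 2. If, in addition, $[B,X_j]=0$, then $\tau(i[H_0,B]\,\Pi_1)=0$. 3. In particular, $\tau(i[H_0,S]\,\Pi_1)=0$ for every generalized spin operator $S=\mathrm{Id}_{L^2(\mathcal X)}\otimes s$ with $s$ a self-adjoint operator on $\mathbb C^N$, such that $S$ is periodic and its fibre $\mathrm{Id}\otimes s$ maps $\mathcal D_{\rm f}$ boundedly into itself. -/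

import Mathlib

open MeasureTheory Filter Set
open scoped Topology ContDiff ENNReal InnerProductSpace

namespace TorqueResponse

/-! ## Operators on a complex Hilbert space -/

section Abstract

variable {F : Type} [NormedAddCommGroup F] [InnerProductSpace ℂ F]

lemma mem_of_mem_pmul {A B : F →ₗ.[ℂ] F} {ψ : F}
    (hψ : ψ ∈ (A.domain.comap B.toFun).map B.domain.subtype) :
    ∃ h : ψ ∈ B.domain, B ⟨ψ, h⟩ ∈ A.domain := by
  obtain ⟨y, hyA, rfl⟩ := hψ
  exact ⟨y.2, hyA⟩

/-- The product `A B` of two unbounded operators on its natural domain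
`{ψ ∈ D(B) : B ψ ∈ D(A)}`. -/
noncomputable def pmul (A B : F →ₗ.[ℂ] F) : F →ₗ.[ℂ] F where
  domain := (A.domain.comap B.toFun).map B.domain.subtype
  toFun :=
    { toFun := fun ψ => A ⟨B ⟨ψ, (mem_of_mem_pmul ψ.2).1⟩, (mem_of_mem_pmul ψ.2).2⟩
      map_add' := fun x y => by
        rw [← A.map_add]
        congr 1
        exact Subtype.ext (B.map_add ⟨x, (mem_of_mem_pmul x.2).1⟩ ⟨y, (mem_of_mem_pmul y.2).1⟩)
      map_smul' := fun k x => by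
        rw [RingHom.id_apply, ← A.map_smul]
        congr 1
        exact Subtype.ext (B.map_smul k ⟨x, (mem_of_mem_pmul x.2).1⟩) }

/-- The commutator `[A, B] = A B - B A`, on the intersection of the natural domains. -/
noncomputable def comm (A B : F →ₗ.[ℂ] F) : F →ₗ.[ℂ] F := pmul A B - pmul B A

/-- A bounded operator seen as an operator with full domain. -/
def ofBdd (A : F →L[ℂ] F) : F →ₗ.[ℂ] F := (A : F →ₗ[ℂ] F).toPMap ⊤

/-- `R` is the (bounded, two-sided) inverse of `A - z`. -/
def IsResolventAt (A : F →ₗ.[ℂ] F) (z : ℂ) (R : F →L[ℂ] F) : Prop :=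
  (∀ ψ : F, ∃ h : R ψ ∈ A.domain, A ⟨R ψ, h⟩ - z • R ψ = ψ) ∧
    ∀ φ : A.domain, R (A φ - z • (φ : F)) = φ

/-- The resolvent set of an unbounded operator. -/
def resolventSet (A : F →ₗ.[ℂ] F) : Set ℂ := {z | ∃ R : F →L[ℂ] F, IsResolventAt A z R}

/-- The resolvent `(A - z)⁻¹` (with value `0` off the resolvent set). -/
noncomputable def resolvent (A : F →ₗ.[ℂ] F) (z : ℂ) : F →L[ℂ] F :=
  open Classical in if h : ∃ R : F →L[ℂ] F, IsResolventAt A z R then h.choose else 0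

/-- The spectral projection `χ_{(-∞, μ)}(A)` of a self-adjoint operator `A` bounded from below,
for a real `μ` in its resolvent set.  It is expressed through the continuous functional calculus of
the bounded self-adjoint operator `(A - μ)⁻¹`, using
`χ_{(-∞, μ)}(t) = χ_{(-∞, 0)}((t - μ)⁻¹)` for `t ≠ μ`; the function `χ_{(-∞, 0)}` is continuous on
the spectrum of `(A - μ)⁻¹`, whose negative part is bounded away from `0`. -/
noncomputable def specProj [CompleteSpace F] (A : F →ₗ.[ℂ] F) (μ : ℝ) : F →L[ℂ] F :=
  cfc (Set.indicator (Set.Iio (0 : ℝ)) (fun _ => (1 : ℝ))) (resolvent A (μ : ℂ))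

/-- The circle of centre `c` and radius `r` encloses the part of the spectrum of `A` below `μ`, and
leaves outside the part above `μ`. -/
def EnclosesBelow (A : F →ₗ.[ℂ] F) (μ : ℝ) (c : ℂ) (r : ℝ) : Prop :=
  0 < r ∧ ∀ z : ℂ, z ∉ resolventSet A →
    (z.re < μ → z ∈ Metric.ball c r) ∧ (μ < z.re → z ∉ Metric.closedBall c r)

/-- `𝓘(D) = (i / 2π) ∮ (A - z)⁻¹ [D, Π] (A - z)⁻¹ dz` along the positively oriented circle of centre
`c` and radius `r`, where `Π = χ_{(-∞, μ)}(A)`. -/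
noncomputable def invLiouvillian [CompleteSpace F] (A : F →ₗ.[ℂ] F) (μ : ℝ) (c : ℂ) (r : ℝ)
    (D : F →L[ℂ] F) : F →L[ℂ] F :=
  (Complex.I / (2 * (Real.pi : ℂ))) •
    ∮ z in C(c, r), resolvent A z * (D * specProj A μ - specProj A μ * D) * resolvent A z

/-- Trace class operators on a Hilbert space: those with a nuclear representation
`T = ∑ₙ ⟨xₙ, ·⟩ yₙ`, `∑ₙ ‖xₙ‖ ‖yₙ‖ < ∞`. -/
def IsTraceClass (T : F →L[ℂ] F) : Prop :=
  ∃ x y : ℕ → F, Summable (fun n => ‖x n‖ * ‖y n‖) ∧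
    ∀ ψ : F, HasSum (fun n => ⟪x n, ψ⟫_ℂ • y n) (T ψ)

/-- `T` is trace class with trace `t`. -/
def HasTrace (T : F →L[ℂ] F) (t : ℂ) : Prop :=
  IsTraceClass T ∧ ∀ (ι : Type) (e : HilbertBasis ι ℂ F), HasSum (fun i => ⟪e i, T (e i)⟫_ℂ) t

/-- The domain of a closed operator `h`, with its graph norm.  It is realised as the graph of `h`,
with the norm `max ‖v‖ ‖h v‖` (equivalent to `(‖v‖² + ‖h v‖²)^(1/2)`). -/
abbrev GraphDomain (h : F →ₗ.[ℂ] F) : Type := h.graph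

/-- The inclusion of the domain of `h`, with its graph norm, into the Hilbert space. -/
def graphIncl (h : F →ₗ.[ℂ] F) : GraphDomain h →L[ℂ] F :=
  (ContinuousLinearMap.fst ℂ F F).comp h.graph.subtypeL

end Abstract

/-! ## Multiplication operators -/

/-- Physical space. -/
abbrev Space (d : ℕ) : Type := EuclideanSpace ℝ (Fin d)

/-- Internal degrees of freedom. -/
abbrev Internal (N : ℕ) : Type := EuclideanSpace ℂ (Fin N)

section Multiplication

variable {d N : ℕ} (ν : Measure (Space d))

lemma memLp_mul (f : Space d → ℂ) (hf : Measurable f) (hb : ∀ x, ‖f x‖ ≤ 1)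
    (ψ : Lp (Internal N) 2 ν) : MemLp (fun x => f x • ψ x) 2 ν :=
  (Lp.memLp ψ).of_le (hf.aestronglyMeasurable.smul (Lp.aestronglyMeasurable ψ))
    (Eventually.of_forall fun x => by
      rw [norm_smul]
      exact mul_le_of_le_one_left (norm_nonneg _) (hb x))

/-- Multiplication by a measurable function bounded by `1`. -/
noncomputable def mulOp (f : Space d → ℂ) (hf : Measurable f) (hb : ∀ x, ‖f x‖ ≤ 1) :
    Lp (Internal N) 2 ν →L[ℂ] Lp (Internal N) 2 ν :=
  LinearMap.mkContinuous
    { toFun := fun ψ => (memLp_mul ν f hf hb ψ).toLp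
      map_add' := fun ψ φ => by
        rw [← MemLp.toLp_add]
        apply MemLp.toLp_congr
        filter_upwards [Lp.coeFn_add ψ φ] with x hx
        rw [hx]
        exact smul_add _ _ _
      map_smul' := fun c ψ => by
        rw [RingHom.id_apply, ← MemLp.toLp_const_smul]
        apply MemLp.toLp_congr
        filter_upwards [Lp.coeFn_smul c ψ] with x hx
        rw [hx]
        exact smul_comm (f x) c (ψ x) }
    1 (fun ψ => by
      rw [one_mul]
      apply Lp.norm_le_norm_of_ae_le
      filter_upwards [(memLp_mul ν f hf hb ψ).coeFn_toLp] with x hx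
      simp only [LinearMap.coe_mk, AddHom.coe_mk]
      rw [hx, norm_smul]
      exact mul_le_of_le_one_left (norm_nonneg _) (hb x))

/-- `χ_Ω`, multiplication by the characteristic function of a measurable set. -/
noncomputable def chi (Ω : Set (Space d)) (hΩ : MeasurableSet Ω) :
    Lp (Internal N) 2 ν →L[ℂ] Lp (Internal N) 2 ν :=
  mulOp ν (Ω.indicator fun _ => (1 : ℂ)) (measurable_const.indicator hΩ) (fun x => by
    by_cases h : x ∈ Ω <;> simp [h])

/-- Multiplication by the plane wave `y ↦ exp(i k·y)`. -/
noncomputable def planeWave (k : Space d) : Lp (Internal N) 2 ν →L[ℂ] Lp (Internal N) 2 ν :=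
  mulOp ν (fun y => Complex.exp ((⟪k, y⟫_ℝ : ℂ) * Complex.I))
    (by fun_prop) (fun y => (Complex.norm_exp_ofReal_mul_I _).le)

/-- The maximal domain `{ψ ∈ L² : x_j ψ ∈ L²}` of the position operator. -/
def positionDomain (j : Fin d) : Submodule ℂ (Lp (Internal N) 2 ν) where
  carrier := {ψ | MemLp (fun x => (x j : ℂ) • ψ x) 2 ν}
  add_mem' := fun {ψ φ} hψ hφ => by
    refine (memLp_congr_ae ?_).mp (MemLp.add hψ hφ)
    filter_upwards [Lp.coeFn_add ψ φ] with x hx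
    rw [hx]
    exact (smul_add _ _ _).symm
  zero_mem' := by
    refine (memLp_congr_ae ?_).mp (MemLp.zero (ε := Internal N) (p := 2) (μ := ν))
    filter_upwards [Lp.coeFn_zero (Internal N) 2 ν] with x hx
    rw [hx]
    exact (smul_zero _).symm
  smul_mem' := fun c ψ hψ => by
    refine (memLp_congr_ae ?_).mp (MemLp.const_smul hψ c)
    filter_upwards [Lp.coeFn_smul c ψ] with x hx
    rw [hx]
    exact smul_comm c (x j : ℂ) (ψ x)

lemma memLp_position {j : Fin d} (ψ : positionDomain (N := N) ν j) :
    MemLp (fun x => (x j : ℂ) • (ψ : Lp (Internal N) 2 ν) x) 2 ν := ψ.2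

/-- The position operator `(X_j ψ)(x) = x_j ψ(x)`, with its maximal domain. -/
noncomputable def position (j : Fin d) : Lp (Internal N) 2 ν →ₗ.[ℂ] Lp (Internal N) 2 ν where
  domain := positionDomain ν j
  toFun :=
    { toFun := fun ψ => (memLp_position ν ψ).toLp
      map_add' := fun ψ φ => by
        rw [← MemLp.toLp_add]
        apply MemLp.toLp_congr
        filter_upwards [Lp.coeFn_add (ψ : Lp (Internal N) 2 ν) φ] with x hx
        rw [Submodule.coe_add, hx]
        exact smul_add _ _ _
      map_smul' := fun c ψ => by
        rw [RingHom.id_apply, ← MemLp.toLp_const_smul]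
        apply MemLp.toLp_congr
        filter_upwards [Lp.coeFn_smul c (ψ : Lp (Internal N) 2 ν)] with x hx
        rw [Submodule.coe_smul, hx]
        exact smul_comm (x j : ℂ) c ((ψ : Lp (Internal N) 2 ν) x) }

end Multiplication

/-! ## Crystals, magnetic translations, and the Bloch-Floquet-Zak transform -/

/-- The Bravais lattice spanned over `ℤ` by a basis of `ℝ^d`. -/
abbrev bravais {d : ℕ} (a : Module.Basis (Fin d) ℝ (Space d)) : Submodule ℤ (Space d) :=
  Submodule.span ℤ (Set.range a)

/-- A `d`-dimensional crystal with `N` internal degrees of freedom: a Bravais lattice `Γ` with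
basis `a`; a `Γ`-invariant configuration space `𝒳`, which is either `ℝ^d` with the Lebesgue measure
or a discrete set (finitely many points in each compact set) with the counting measure; and
the unitary cocycle that defines the (magnetic) translations.  The measure of `𝒳` is seen as a
measure on `ℝ^d` carried by `𝒳`. -/
structure Crystal (d N : ℕ) where
  /-- the spanning vectors of the Bravais lattice -/
  a : Module.Basis (Fin d) ℝ (Space d)
  /-- the configuration space -/
  X : Set (Space d)
  /-- the measure of the configuration space -/
  ν : Measure (Space d)
  kind : (X = Set.univ ∧ ν = volume) ∨
    ((∀ K : Set (Space d), IsCompact K → (X ∩ K).Finite) ∧ ν = Measure.count.restrict X)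
  add_mem : ∀ γ : bravais a, ∀ x ∈ X, x + (γ : Space d) ∈ X
  /-- the unitaries `M(γ, x)` -/
  M : bravais a → Space d → (Internal N ≃ₗᵢ[ℂ] Internal N)
  M_meas : ∀ γ v, AEStronglyMeasurable (fun x => M γ x v) ν
  cocycle : ∀ γ₁ γ₂, ∀ x ∈ X, ∀ v, M (γ₁ + γ₂) x v = M γ₂ x (M γ₁ (x - (γ₂ : Space d)) v)

namespace Crystal

variable {d N : ℕ} (c : Crystal d N)

/-- The Bravais lattice `Γ`. -/
abbrev Γ : Submodule ℤ (Space d) := bravais c.a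

/-- The Hilbert space `𝓗 = L²(𝒳) ⊗ ℂ^N = L²(𝒳, ℂ^N)`. -/
abbrev H : Type := Lp (Internal N) 2 c.ν

lemma measurePreserving_sub (γ : c.Γ) :
    MeasurePreserving (fun x : Space d => x - (γ : Space d)) c.ν c.ν := by
  rcases c.kind with ⟨-, hν⟩ | ⟨hfin, hν⟩
  · rw [hν]
    exact measurePreserving_sub_right volume (γ : Space d)
  · have hX : MeasurableSet c.X := by
      have : c.X = ⋃ n : ℕ, c.X ∩ Metric.closedBall 0 n := by
        rw [← Set.inter_iUnion, Metric.iUnion_closedBall_nat, Set.inter_univ]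
      rw [this]
      exact MeasurableSet.iUnion fun n => (hfin _ (isCompact_closedBall _ _)).measurableSet
    have hpre : (fun x : Space d => x - (γ : Space d)) ⁻¹' c.X = c.X := by
      ext x
      constructor
      · intro hx
        have := c.add_mem γ _ hx
        simpa using this
      · intro hx
        have := c.add_mem (-γ) _ hx
        simpa [sub_eq_add_neg] using this
    have hcount : MeasurePreserving (fun x : Space d => x - (γ : Space d))
        Measure.count Measure.count := by
      refine ⟨by fun_prop, ?_⟩
      ext s hs
      rw [Measure.map_apply (by fun_prop) hs]
      have himg : (fun x : Space d => x - (γ : Space d)) ⁻¹' s = (fun x => x + (γ : Space d)) '' s := by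
        ext x
        simp [sub_eq_add_neg]
      rw [himg, Measure.count_injective_image (add_left_injective _)]
    have := hcount.restrict_preimage hX
    rw [hpre] at this
    rw [hν]
    exact this

lemma memLp_transl (γ : c.Γ) (ψ : c.H) :
    MemLp (fun x => c.M γ x (ψ (x - (γ : Space d)))) 2 c.ν := by
  have h : MemLp (fun x => ψ (x - (γ : Space d))) 2 c.ν :=
    (Lp.memLp ψ).comp_measurePreserving (c.measurePreserving_sub γ)
  refine h.of_le ?_ (Eventually.of_forall fun x => by simp)
  have hsum : (fun x => c.M γ x (ψ (x - (γ : Space d)))) =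
      fun x => ∑ i : Fin N, (ψ (x - (γ : Space d))) i • c.M γ x (EuclideanSpace.single i 1) := by
    funext x
    conv_lhs => rw [← (EuclideanSpace.basisFun (Fin N) ℂ).sum_repr (ψ (x - (γ : Space d)))]
    simp [map_sum]
  rw [hsum]
  refine Finset.aestronglyMeasurable_fun_sum _ fun i _ => ?_
  have hi : Continuous fun v : Internal N => v i := by fun_prop
  have hm : AEStronglyMeasurable (fun x => (ψ (x - (γ : Space d))) i) c.ν :=
    hi.comp_aestronglyMeasurable h.aestronglyMeasurable
  exact hm.smul (c.M_meas γ (EuclideanSpace.single i 1))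

/-- The (magnetic) translations `(T_γ ψ)(x) = M(γ, x) ψ(x - γ)`. -/
noncomputable def T (γ : c.Γ) (ψ : c.H) : c.H := (c.memLp_transl γ ψ).toLp

/-- `Γ`-periodic operators: `[A, T_γ] = 0` for all `γ ∈ Γ`. -/
def IsPeriodic (A : c.H →ₗ.[ℂ] c.H) : Prop :=
  ∀ (γ : c.Γ) (ψ : A.domain), ∃ h : c.T γ ψ ∈ A.domain, A ⟨c.T γ ψ, h⟩ = c.T γ (A ψ)

/-- The sets `{x ∈ ℝ^d : x = ∑ⱼ αⱼ aⱼ, |αⱼ| ≤ L/2}`, whose intersection with `𝒳` is the cell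
`𝒞_L`. -/
def cell (L : ℕ) : Set (Space d) := {x | ∀ j, |c.a.repr x j| ≤ (L : ℝ) / 2}

lemma measurableSet_cell (L : ℕ) : MeasurableSet (c.cell L) := by
  have : c.cell L = ⋂ j, {x | |c.a.repr x j| ≤ (L : ℝ) / 2} := by
    ext x; simp [cell]
  rw [this]
  refine MeasurableSet.iInter fun j => (IsClosed.measurableSet ?_)
  have hc : Continuous fun x => c.a.repr x j :=
    (c.a.coord j).continuous_of_finiteDimensional
  exact isClosed_le hc.abs continuous_const

/-- The unit cell with half of its faces removed, so that its `Γ`-translates are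
disjoint also when points of a discrete `𝒳` lie on the faces of `𝒞_1`. -/
def fundCell : Set (Space d) := {x | ∀ j, c.a.repr x j ∈ Set.Ico (-(1 / 2) : ℝ) (1 / 2)}

/-- The fibre Hilbert space `𝓗_f`.  A locally square integrable `φ` with `T_γ φ = φ` for all
`γ ∈ Γ` is determined by its restriction to the fundamental cell, with `‖φ‖² = ∫_cell |φ|²`; it is
identified with that restriction, an arbitrary element of `L²(cell, ℂ^N)`. -/
abbrev Hf : Type := Lp (Internal N) 2 (c.ν.restrict c.fundCell)

/-- Restriction of `ψ ∈ 𝓗` to the fundamental cell. -/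
noncomputable def restrictCell (ψ : c.H) : c.Hf := ((Lp.memLp ψ).restrict c.fundCell).toLp

/-- The dual lattice `Γ* = {k : k·γ ∈ 2πℤ for all γ ∈ Γ}`. -/
def dual : Set (Space d) := {k | ∀ γ : c.Γ, ∃ n : ℤ, ⟪k, (γ : Space d)⟫_ℝ = 2 * Real.pi * n}

/-- The fundamental cell `𝔹^d` of the dual lattice: the `k = ∑ⱼ βⱼ bⱼ`, `βⱼ ∈ [0, 1)`, for
the dual basis `bᵢ·aⱼ = 2π δᵢⱼ` of `Γ*`. -/
def brillouin : Set (Space d) := {k | ∀ j, ⟪k, c.a j⟫_ℝ ∈ Set.Ico (0 : ℝ) (2 * Real.pi)}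

/-- The representation `(ϱ(γ*) φ)(y) = exp(-i γ*·y) φ(y)` on `𝓗_f`. -/
noncomputable def rho (g : Space d) : c.Hf →L[ℂ] c.Hf :=
  planeWave (c.ν.restrict c.fundCell) (-g)

/-- `φ = U_Z ψ`, for the (magnetic) Bloch-Floquet-Zak transform
`(U_Z ψ)(k, y) = exp(-i k·y) ∑_γ exp(i k·γ) (T_γ ψ)(y)`: the function `φ` is in
`L²_ϱ(ℝ^d, 𝓗_f)` (locally square integrable and `ϱ`-equivariant), and `ψ = U_Z⁻¹ φ`, that is
`ψ(x) = |𝔹^d|⁻¹ ∫_{𝔹^d} exp(i k·x) φ(k, x) dk`.  By `T_γ φ(k, ·) = φ(k, ·)`, the latter formula at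
`x = y - γ`, with `y` in the fundamental cell, reads
`(T_γ ψ)(y) = |𝔹^d|⁻¹ ∫_{𝔹^d} exp(-i k·γ) exp(i k·y) φ(k, y) dk`.  Functions that agree almost
everywhere are representatives of the same element. -/
def IsBFZ (ψ : c.H) (φ : Space d → c.Hf) : Prop :=
  MemLp φ 2 (volume.restrict c.brillouin) ∧
  (∀ g ∈ c.dual, ∀ k, φ (k + g) = c.rho g (φ k)) ∧
  ∀ γ : c.Γ, c.restrictCell (c.T γ ψ) = (volume.real c.brillouin)⁻¹ •
    ∫ k in c.brillouin, Complex.exp (-((⟪k, (γ : Space d)⟫_ℝ : ℂ) * Complex.I)) •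
      planeWave (c.ν.restrict c.fundCell) k (φ k)

/-- `ψ ∈ U_Z⁻¹ C^∞_ϱ(ℝ^d, 𝓗_f)`. -/
def IsSmoothBF (ψ : c.H) : Prop := ∃ φ : Space d → c.Hf, ContDiff ℝ ∞ φ ∧ c.IsBFZ ψ φ

section Fibration

variable {V₁ V₂ : Type} [NormedAddCommGroup V₁] [NormedSpace ℂ V₁]
  [NormedAddCommGroup V₂] [NormedSpace ℂ V₂]

/-- `U_Z A U_Z⁻¹ = ∫^⊕ A(k) dk` on `L²_ϱ(ℝ^d, V₁)`, with fibres `A(k) : V₁ → V₂`, for normed spaces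
`V₁, V₂` embedded in `𝓗_f` by `ι₁, ι₂`: the fibres are `ϱ`-covariant, and if `U_Z ψ` is in
`L²_ϱ(ℝ^d, V₁)`, then `ψ` is in the domain of `A` and `(U_Z A ψ)(k) = A(k) (U_Z ψ)(k)`. -/
def IsFibration (A : c.H →ₗ.[ℂ] c.H) (ι₁ : V₁ →L[ℂ] c.Hf) (ι₂ : V₂ →L[ℂ] c.Hf)
    (f : Space d → (V₁ →L[ℂ] V₂)) : Prop :=
  (∀ g ∈ c.dual, ∀ k v w, ι₁ w = c.rho g (ι₁ v) → ι₂ (f (k + g) w) = c.rho g (ι₂ (f k v))) ∧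
  ∀ (ψ : c.H) (φ : Space d → V₁), MemLp φ 2 (volume.restrict c.brillouin) →
    c.IsBFZ ψ (fun k => ι₁ (φ k)) →
    ∃ h : ψ ∈ A.domain, c.IsBFZ (A ⟨ψ, h⟩) (fun k => ι₂ (f k (φ k)))

/-- The class `𝓟(V₁, V₂)` of `Γ`-periodic operators with smooth fibration
`ℝ^d → 𝓛(V₁, V₂)`. -/
def InP (A : c.H →ₗ.[ℂ] c.H) (ι₁ : V₁ →L[ℂ] c.Hf) (ι₂ : V₂ →L[ℂ] c.Hf) : Prop :=
  c.IsPeriodic A ∧ ∃ f : Space d → (V₁ →L[ℂ] V₂), ContDiff ℝ ∞ f ∧ c.IsFibration A ι₁ ι₂ f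

end Fibration

/-! ## Trace per unit volume -/

/-- `T = χ_Ω A χ_Ω` as an everywhere defined operator. -/
def IsCompression (A : c.H →ₗ.[ℂ] c.H) (Ω : Set (Space d)) (hΩ : MeasurableSet Ω)
    (T : c.H →L[ℂ] c.H) : Prop :=
  ∀ ψ : c.H, ∃ h : chi c.ν Ω hΩ ψ ∈ A.domain, T ψ = chi c.ν Ω hΩ (A ⟨chi c.ν Ω hΩ ψ, h⟩)

/-- `A` is trace class on compact sets: `χ_K A χ_K` is trace class for all compact sets `K`. -/
def TraceClassOnCompacts (A : c.H →ₗ.[ℂ] c.H) : Prop :=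
  ∀ (K : Set (Space d)) (hK : IsCompact K),
    ∃ T : c.H →L[ℂ] c.H, c.IsCompression A K hK.measurableSet T ∧ IsTraceClass T

/-- The trace per unit volume of `A` exists and is equal to `t`: the operator `A` is trace class on
compact sets, and `|𝒞_L|⁻¹ Tr(χ_L A χ_L) → t` as `L → ∞` along the odd numbers `L = 2m + 1`. -/
def HasTau (A : c.H →ₗ.[ℂ] c.H) (t : ℂ) : Prop :=
  c.TraceClassOnCompacts A ∧
  ∃ (T : ℕ → (c.H →L[ℂ] c.H)) (s : ℕ → ℂ),
    (∀ m, c.IsCompression A (c.cell (2 * m + 1)) (c.measurableSet_cell _) (T m) ∧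
      HasTrace (T m) (s m)) ∧
    Tendsto (fun m => s m / (c.ν.real (c.cell (2 * m + 1)) : ℂ)) atTop (𝓝 t)

end Crystal

/-! ## The unperturbed model -/

/-- The unperturbed Hamiltonian `H₀` of a gapped periodic system, with its Bloch-Floquet-Zak fibres
`H₀(k)` and a Fermi energy `μ`. -/
structure GappedModel {d N : ℕ} (c : Crystal d N) where
  /-- the Hamiltonian -/
  H₀ : c.H →ₗ.[ℂ] c.H
  selfAdjoint : IsSelfAdjoint H₀
  periodic : c.IsPeriodic H₀
  bddBelow : ∃ m : ℝ, ∀ ψ : H₀.domain, m * ‖(ψ : c.H)‖ ^ 2 ≤ (⟪(ψ : c.H), H₀ ψ⟫_ℂ).re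
  /-- the fibres `H₀(k)` -/
  fib : Space d → (c.Hf →ₗ.[ℂ] c.Hf)
  fib_selfAdjoint : ∀ k, IsSelfAdjoint (fib k)
  /-- the domain `𝓓_f` of `H₀(k)` does not depend on `k` -/
  fib_domain : ∀ k, (fib k).domain = (fib 0).domain
  /-- `ϱ(γ*)` maps `𝓓_f` into itself -/
  rho_mem : ∀ g ∈ c.dual, ∀ v ∈ (fib 0).domain, c.rho g v ∈ (fib 0).domain
  /-- `k ↦ H₀(k) ∈ 𝓛(𝓓_f, 𝓗_f)` is smooth (and equivariant), for the graph norm of `H₀(0)` on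
  `𝓓_f`, and is the fibration of `H₀` -/
  fib_smooth : ∃ f : Space d → (GraphDomain (fib 0) →L[ℂ] c.Hf), ContDiff ℝ ∞ f ∧
    (∀ k (v : GraphDomain (fib 0)),
      ∃ h : graphIncl (fib 0) v ∈ (fib k).domain, f k v = fib k ⟨graphIncl (fib 0) v, h⟩) ∧
    c.IsFibration H₀ (graphIncl (fib 0)) (ContinuousLinearMap.id ℂ c.Hf) f
  /-- the domain of `H₀` is that of the direct integral of its fibres, `U_Z⁻¹ L²_ϱ(ℝ^d, 𝓓_f)` -/
  mem_domain : ∀ ψ ∈ H₀.domain, ∃ φ : Space d → GraphDomain (fib 0),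
    MemLp φ 2 (volume.restrict c.brillouin) ∧ c.IsBFZ ψ (fun k => graphIncl (fib 0) (φ k))
  /-- the Fermi energy -/
  μ : ℝ
  gap : (μ : ℂ) ∈ resolventSet H₀
  /-- the Fermi projection `Π₀ = χ_{(-∞, μ)}(H₀)` has fibres of finite rank -/
  finiteRank : ∃ P : Space d → (c.Hf →L[ℂ] c.Hf),
    c.IsFibration (ofBdd (specProj H₀ μ)) (ContinuousLinearMap.id ℂ c.Hf)
      (ContinuousLinearMap.id ℂ c.Hf) P ∧
    ∀ k, FiniteDimensional ℂ (LinearMap.range (P k : c.Hf →ₗ[ℂ] c.Hf))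

namespace GappedModel

variable {d N : ℕ} {c : Crystal d N} (m : GappedModel c)

/-- The Fermi projection `Π₀`. -/
noncomputable def fermi : c.H →L[ℂ] c.H := specProj m.H₀ m.μ

/-- The inclusion of `𝓓_f` (with the graph norm of `H₀(0)`) in `𝓗_f`. -/
noncomputable def inclD : GraphDomain (m.fib 0) →L[ℂ] c.Hf := graphIncl (m.fib 0)

/-- `B ∈ 𝓟(𝓗_f) ∩ 𝓟(𝓓_f)`. -/
def InPP (B : c.H →L[ℂ] c.H) : Prop :=
  c.InP (ofBdd B) (ContinuousLinearMap.id ℂ c.Hf) (ContinuousLinearMap.id ℂ c.Hf) ∧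
    c.InP (ofBdd B) m.inclD m.inclD

/-- `D` is the closure of `[X_j, Π₀]` restricted to `U_Z⁻¹ C^∞_ϱ(ℝ^d, 𝓗_f)`, and is bounded and
everywhere defined. -/
def IsClosureOfComm (j : Fin d) (D : c.H →L[ℂ] c.H) : Prop :=
  (∀ ψ, c.IsSmoothBF ψ → ψ ∈ (comm (position c.ν j) (ofBdd m.fermi)).domain) ∧
  closure {p : c.H × c.H | c.IsSmoothBF p.1 ∧
      p ∈ (comm (position c.ν j) (ofBdd m.fermi)).graph} = {p | p.2 = D p.1}

/-- `Π₁ = 𝓘(D)`, for `D` the closure of `[X_j, Π₀]`. -/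
noncomputable def Pi1 (z₀ : ℂ) (r : ℝ) (D : c.H →L[ℂ] c.H) : c.H →L[ℂ] c.H :=
  invLiouvillian m.H₀ m.μ z₀ r D

/-- The operator `i [H₀, B] Π₁`. -/
noncomputable def torque (B P₁ : c.H →L[ℂ] c.H) : c.H →ₗ.[ℂ] c.H :=
  Complex.I • pmul (comm m.H₀ (ofBdd B)) (ofBdd P₁)

/-- The operator `i Π₀ [[B, Π₀], [X_j, Π₀]]`. -/
noncomputable def torqueResponse (j : Fin d) (B : c.H →L[ℂ] c.H) : c.H →ₗ.[ℂ] c.H :=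
  Complex.I • pmul (ofBdd m.fermi)
    (comm (comm (ofBdd B) (ofBdd m.fermi)) (comm (position c.ν j) (ofBdd m.fermi)))

/-- The hypotheses on `s` under which `S = Id ⊗ s` is a generalized spin operator: `s` is
self-adjoint, `S` is periodic, and the fibre `Id ⊗ s` is in `𝓛(𝓓_f)`. -/
def IsSpin (s : Internal N →L[ℂ] Internal N) : Prop :=
  IsSelfAdjoint s ∧ c.IsPeriodic (ofBdd (s.compLpL 2 c.ν)) ∧
  ∃ f : GraphDomain (m.fib 0) →L[ℂ] GraphDomain (m.fib 0),
    ∀ v, m.inclD (f v) = s.compLpL 2 (c.ν.restrict c.fundCell) (m.inclD v)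

end GappedModel

end TorqueResponse

set_option linter.unusedSectionVars false

namespace TorqueResponse

/-! ## Hilbert–Schmidt and trace class operators -/

section TraceClass

variable {F G K : Type} [NormedAddCommGroup F] [InnerProductSpace ℂ F] [CompleteSpace F]
  [NormedAddCommGroup G] [InnerProductSpace ℂ G] [CompleteSpace G]
  [NormedAddCommGroup K] [InnerProductSpace ℂ K] [CompleteSpace K]

/-! Write P for the Fermi projection, D for the closure of [X_j, P] and Q = Π₁ = 𝓘(D). Formally [H₀,
Q] = D, so cyclicity of τ gives τ([H₀, B] Q) = -τ(B [H₀, Q]) = -τ(B D). Since D is off-diagonal, D =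
P D + D P, this equals -τ(P D B) - τ(P B D). Expanding P [[B, P], D] with P D P = 0 gives the same
number. If B commutes with X_j, then B D = [X_j, B P] formally, and the trace of a commutator
vanishes. The work lies in making sense of each step for unbounded H₀ and X_j.

Momentum side. The Bloch-Floquet-Zak transform is an isometry, up to a constant, onto equivariant
fields over the Brillouin zone (`exists_isBFZ`, `IsBFZ.norm_sq`), under which X_j becomes i ∂_j
(`position_of_isBFZ`). A lower bound for H₀ - z passes to every fibre (`norm_inclD_le`), so the
fibres of the resolvent exist and depend continuously on momentum, and Riesz' formula
(`circleIntegral_resolvent`) carries this to the fibres P(k), which are continuously differentiable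
(`lineC1_fibFermi`, `fibered_fermi`). Hence D is the bounded operator with fibres i ∂_j P(k), and
differentiating P(k)² = P(k) makes it off-diagonal (`exists_comm_position_fermi`). The identity [H₀,
𝓘(D)] = D is `EnclosesBelow.commutator_invLiouvillian`.

Trace side. The P(k) have finite rank on a dense set of momenta. Continuity and compactness turn
this into a uniform Hilbert-Schmidt bound, so P is Hilbert-Schmidt on the fundamental cell
(`hsSq_fermi_cellEmb_lt_top`). For periodic S, the map Ω ↦ ‖S χ_Ω‖² in Hilbert-Schmidt norm is a
lattice-invariant measure, so it has a density on large boxes. Polarization then gives the trace per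
unit volume of a product of two such operators, hence of X P Y for bounded periodic X, Y, as the
trace on one cell divided by the volume of the cell. Invariance also yields ‖S‖ = ‖S*‖ on the cell
(`Periodic.hsSq_adjoint_emb`), whose polarization is the cyclicity of the cell trace
(`hasCellTrace_mul_mul`).

Conclusion. Q = P Q + Q P splits [H₀, B] Q into terms that each contain a P, and H₀ P is bounded, so
formal cyclicity becomes the algebra of bounded operators in `hasCellTrace_commutator_mul`. In the
commuting case X_j acts on the cell as a bounded operator, and the compression of B D is the
commutator of that operator with a trace class one (`cellTrace_add_eq_zero`). -/

lemma isTraceClass_of_family {ι : Type*} {x y : ι → F} {T : F →L[ℂ] F}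
    (hs : Summable fun i => ‖x i‖ * ‖y i‖)
    (hT : ∀ ψ, HasSum (fun i => ⟪x i, ψ⟫_ℂ • y i) (T ψ)) : IsTraceClass T := by
  -- Summability makes the support countable, so the family can be injected into ℕ and padded with
  -- zeros.
  set s : Set ι := Function.support fun i => ‖x i‖ * ‖y i‖ with hsdef
  have hc : Countable s := hs.countable_support
  obtain ⟨f, hf⟩ := hc.exists_injective_nat
  refine ⟨Function.extend f (fun i : s => x i) 0, Function.extend f (fun i : s => y i) 0, ?_, ?_⟩
  · have h1 : (fun n => ‖Function.extend f (fun i : s => x i) 0 n‖ *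
        ‖Function.extend f (fun i : s => y i) 0 n‖) =
        Function.extend f (fun i : s => ‖x i‖ * ‖y i‖) 0 := by
      funext n
      by_cases h : ∃ i, f i = n
      · obtain ⟨i, rfl⟩ := h
        simp [hf.extend_apply]
      · simp [Function.extend_apply' _ _ _ h]
    rw [h1]
    exact ((hasSum_extend_zero hf).2 (hs.subtype s).hasSum).summable
  · intro ψ
    have h1 : (fun n => ⟪Function.extend f (fun i : s => x i) 0 n, ψ⟫_ℂ •
        Function.extend f (fun i : s => y i) 0 n) =
        Function.extend f (fun i : s => ⟪x i, ψ⟫_ℂ • y i) 0 := by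
      funext n
      by_cases h : ∃ i, f i = n
      · obtain ⟨i, rfl⟩ := h
        simp [hf.extend_apply]
      · simp [Function.extend_apply' _ _ _ h]
    rw [h1, hasSum_extend_zero hf]
    refine (hasSum_subtype_iff_of_support_subset (f := fun i => ⟪x i, ψ⟫_ℂ • y i) ?_).2 (hT ψ)
    intro i hi
    simp only [hsdef, Function.mem_support, ne_eq, mul_eq_zero, norm_eq_zero, not_or] at hi ⊢
    constructor
    · rintro h
      simp [h] at hi
    · rintro h
      simp [h] at hi

lemma IsTraceClass.add {S T : F →L[ℂ] F} (hS : IsTraceClass S) (hT : IsTraceClass T) :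
    IsTraceClass (S + T) := by
  obtain ⟨x, y, hs, h⟩ := hS
  obtain ⟨x', y', hs', h'⟩ := hT
  refine isTraceClass_of_family (x := Sum.elim x x') (y := Sum.elim y y') ?_ fun ψ => ?_
  · exact (HasSum.sum (f := fun i => ‖Sum.elim x x' i‖ * ‖Sum.elim y y' i‖)
      hs.hasSum hs'.hasSum).summable
  · exact HasSum.sum (f := fun i => ⟪Sum.elim x x' i, ψ⟫_ℂ • Sum.elim y y' i) (h ψ) (h' ψ)

lemma IsTraceClass.smul {T : F →L[ℂ] F} (hT : IsTraceClass T) (c : ℂ) : IsTraceClass (c • T) := by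
  obtain ⟨x, y, hs, h⟩ := hT
  refine ⟨x, fun n => c • y n, ?_, fun ψ => ?_⟩
  · simpa [norm_smul, mul_left_comm] using hs.mul_left ‖c‖
  · simpa [smul_comm c] using (h ψ).const_smul c

lemma HasTrace.unique {T : F →L[ℂ] F} {s t : ℂ} (hs : HasTrace T s) (ht : HasTrace T t) : s = t := by
  obtain ⟨w, b, -⟩ := exists_hilbertBasis ℂ F
  exact (hs.2 _ b).unique (ht.2 _ b)

lemma HasTrace.add {S T : F →L[ℂ] F} {s t : ℂ} (hs : HasTrace S s) (ht : HasTrace T t) :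
    HasTrace (S + T) (s + t) :=
  ⟨hs.1.add ht.1, fun ι e => by simpa [inner_add_right] using (hs.2 ι e).add (ht.2 ι e)⟩

lemma HasTrace.smul {T : F →L[ℂ] F} {t : ℂ} (ht : HasTrace T t) (c : ℂ) :
    HasTrace (c • T) (c * t) :=
  ⟨ht.1.smul c, fun ι e => by simpa [inner_smul_right] using (ht.2 ι e).mul_left c⟩

/-- Cauchy–Schwarz combined with Bessel's inequality. It supplies the absolute convergence for the
Fubini argument in `hasTrace_of_nuclear`. -/
lemma summable_norm_inner_mul_inner {ι : Type*} (e : HilbertBasis ι ℂ F) (x y : F) :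
    (Summable fun i => ‖⟪x, e i⟫_ℂ‖ * ‖⟪e i, y⟫_ℂ‖) ∧
      ∑' i, ‖⟪x, e i⟫_ℂ‖ * ‖⟪e i, y⟫_ℂ‖ ≤ ‖x‖ * ‖y‖ := by
  have hx : Summable fun i => ‖⟪x, e i⟫_ℂ‖ ^ 2 := by
    simpa [norm_inner_symm] using e.orthonormal.inner_products_summable x
  have hy : Summable fun i => ‖⟪e i, y⟫_ℂ‖ ^ 2 := e.orthonormal.inner_products_summable y
  have hx' : ∑' i, ‖⟪x, e i⟫_ℂ‖ ^ 2 ≤ ‖x‖ ^ 2 := by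
    simpa [norm_inner_symm] using e.orthonormal.tsum_inner_products_le x
  have hy' : ∑' i, ‖⟪e i, y⟫_ℂ‖ ^ 2 ≤ ‖y‖ ^ 2 := e.orthonormal.tsum_inner_products_le y
  obtain ⟨h1, h2⟩ := Real.summable_and_inner_le_Lp_mul_Lq_tsum_of_nonneg (p := 2) (q := 2)
    Real.HolderConjugate.two_two (f := fun i => ‖⟪x, e i⟫_ℂ‖) (g := fun i => ‖⟪e i, y⟫_ℂ‖)
    (fun _ => norm_nonneg _) (fun _ => norm_nonneg _) (by simpa using hx) (by simpa using hy)
  refine ⟨h1, h2.trans ?_⟩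
  simp only [Real.rpow_two, ← Real.sqrt_eq_rpow]
  gcongr
  · exact (Real.sqrt_le_sqrt hx').trans_eq (Real.sqrt_sq (norm_nonneg _))
  · exact (Real.sqrt_le_sqrt hy').trans_eq (Real.sqrt_sq (norm_nonneg _))

/-- The double series of ⟪xₙ, eᵢ⟫ ⟪eᵢ, yₙ⟫ converges absolutely. Summing over i first gives ⟪xₙ, yₙ⟫
by Parseval, and summing over n first gives the diagonal entries of T, so the trace does not depend
on the basis. -/
lemma hasTrace_of_nuclear {x y : ℕ → F} {T : F →L[ℂ] F}
    (hs : Summable fun n => ‖x n‖ * ‖y n‖)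
    (hT : ∀ ψ, HasSum (fun n => ⟪x n, ψ⟫_ℂ • y n) (T ψ)) :
    HasTrace T (∑' n, ⟪x n, y n⟫_ℂ) := by
  refine ⟨⟨x, y, hs, hT⟩, fun ι e => ?_⟩
  set f : ℕ × ι → ℂ := fun p => ⟪x p.1, e p.2⟫_ℂ * ⟪e p.2, y p.1⟫_ℂ with hf
  have hsum : Summable f := by
    refine Summable.of_norm ?_
    rw [summable_prod_of_nonneg fun _ => norm_nonneg _]
    refine ⟨fun n => ?_, ?_⟩
    · simpa [hf] using (summable_norm_inner_mul_inner e (x n) (y n)).1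
    · refine hs.of_nonneg_of_le (fun n => tsum_nonneg fun _ => norm_nonneg _) fun n => ?_
      simpa [hf] using (summable_norm_inner_mul_inner e (x n) (y n)).2
  have h1 := hsum.hasSum.prod_fiberwise fun n => e.hasSum_inner_mul_inner (x n) (y n)
  have h2 : HasSum (fun i => ⟪e i, T (e i)⟫_ℂ) (∑' p, f p) := by
    have h3 : HasSum (f ∘ Prod.swap) (∑' p, f p) :=
      (Equiv.prodComm ι ℕ).hasSum_iff.2 hsum.hasSum
    refine h3.prod_fiberwise fun i => ?_
    have := (hT (e i)).mapL (innerSL ℂ (e i))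
    simpa [inner_smul_right] using this
  rwa [h1.tsum_eq]

/-- The trace of a commutator with a trace class operator vanishes. -/
lemma IsTraceClass.hasTrace_commutator {T : F →L[ℂ] F} (hT : IsTraceClass T) (Y : F →L[ℂ] F) :
    HasTrace (Y * T - T * Y) 0 := by
  obtain ⟨x, y, hs, h⟩ := hT
  have h1 : HasTrace (Y * T) (∑' n, ⟪x n, Y (y n)⟫_ℂ) := by
    refine hasTrace_of_nuclear ?_ fun ψ => ?_
    · refine (hs.mul_left ‖Y‖).of_nonneg_of_le (fun n => by positivity) fun n => ?_
      calc ‖x n‖ * ‖Y (y n)‖ ≤ ‖x n‖ * (‖Y‖ * ‖y n‖) := by gcongr; exact Y.le_opNorm _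
        _ = ‖Y‖ * (‖x n‖ * ‖y n‖) := by ring
    · simpa using (h ψ).mapL Y
  have h2 : HasTrace (T * Y) (∑' n, ⟪Y.adjoint (x n), y n⟫_ℂ) := by
    refine hasTrace_of_nuclear ?_ fun ψ => ?_
    · refine (hs.mul_left ‖Y.adjoint‖).of_nonneg_of_le (fun n => by positivity) fun n => ?_
      calc ‖Y.adjoint (x n)‖ * ‖y n‖ ≤ (‖Y.adjoint‖ * ‖x n‖) * ‖y n‖ := by
            gcongr; exact Y.adjoint.le_opNorm _
        _ = ‖Y.adjoint‖ * (‖x n‖ * ‖y n‖) := by ring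
    · simpa [ContinuousLinearMap.adjoint_inner_left] using h (Y ψ)
  have := h1.add (h2.smul (-1))
  simp only [ContinuousLinearMap.adjoint_inner_left, neg_mul, one_mul, add_neg_cancel,
    neg_smul, one_smul, ← sub_eq_add_neg] at this
  exact this

/-- The square of the Hilbert–Schmidt norm. -/
noncomputable def hsSq (A : F →L[ℂ] G) : ℝ≥0∞ :=
  ∑' i, ‖A ((exists_hilbertBasis ℂ F).choose_spec.choose i)‖ₑ ^ 2

lemma enorm_sq_eq_tsum {ι : Type*} (e : HilbertBasis ι ℂ F) (v : F) :
    ‖v‖ₑ ^ 2 = ∑' i, ‖⟪e i, v⟫_ℂ‖ₑ ^ 2 := by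
  have h := e.hasSum_inner_mul_inner v v
  have h2 : HasSum (fun i => ‖⟪e i, v⟫_ℂ‖ ^ 2) (‖v‖ ^ 2) := by
    rw [← Complex.hasSum_ofReal]
    convert! h using 1
    · funext i
      rw [← inner_conj_symm v (e i), Complex.conj_mul']
      push_cast; rfl
    · simp [inner_self_eq_norm_sq_to_K]
  have h3 : ∀ w : F, ‖w‖ₑ ^ 2 = ENNReal.ofReal (‖w‖ ^ 2) := fun w => by
    rw [ENNReal.ofReal_pow (norm_nonneg _), ofReal_norm]
  rw [h3, ← h2.tsum_eq, ENNReal.ofReal_tsum_of_nonneg (fun _ => by positivity) h2.summable]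
  refine tsum_congr fun i => ?_
  rw [ENNReal.ofReal_pow (norm_nonneg _), ofReal_norm]

/-- Both sides are the sum of the squared moduli of the matrix entries of A, and Tonelli exchanges
rows and columns. Independence of the basis and invariance under adjoints both follow. -/
lemma tsum_enorm_sq_adjoint {ι κ : Type*} (e : HilbertBasis ι ℂ F) (f : HilbertBasis κ ℂ G)
    (A : F →L[ℂ] G) : ∑' i, ‖A (e i)‖ₑ ^ 2 = ∑' k, ‖A.adjoint (f k)‖ₑ ^ 2 := by
  simp_rw [enorm_sq_eq_tsum f, enorm_sq_eq_tsum e (ContinuousLinearMap.adjoint A _)]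
  rw [ENNReal.tsum_comm]
  refine tsum_congr fun k => tsum_congr fun i => ?_
  rw [ContinuousLinearMap.adjoint_inner_right, ← inner_conj_symm, RCLike.enorm_conj]

lemma hsSq_eq {ι : Type*} (e : HilbertBasis ι ℂ F) (A : F →L[ℂ] G) :
    hsSq A = ∑' i, ‖A (e i)‖ₑ ^ 2 := by
  obtain ⟨w, b, -⟩ := exists_hilbertBasis ℂ G
  rw [hsSq, tsum_enorm_sq_adjoint _ b, tsum_enorm_sq_adjoint e b]

lemma hsSq_adjoint (A : F →L[ℂ] G) : hsSq A.adjoint = hsSq A := by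
  obtain ⟨w, b, -⟩ := exists_hilbertBasis ℂ G
  obtain ⟨w, b', -⟩ := exists_hilbertBasis ℂ F
  rw [hsSq_eq b, hsSq_eq b', tsum_enorm_sq_adjoint b' b]

lemma hsSq_comp_le_left (B : G →L[ℂ] K) (A : F →L[ℂ] G) : hsSq (B ∘L A) ≤ ‖B‖ₑ ^ 2 * hsSq A := by
  rw [hsSq, hsSq, ← ENNReal.tsum_mul_left]
  refine ENNReal.tsum_le_tsum fun i => ?_
  rw [← mul_pow]
  gcongr
  exact B.le_opENorm _

lemma hsSq_comp_le_right (B : G →L[ℂ] K) (A : F →L[ℂ] G) : hsSq (B ∘L A) ≤ ‖A‖ₑ ^ 2 * hsSq B := by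
  rw [← hsSq_adjoint, ContinuousLinearMap.adjoint_comp, ← hsSq_adjoint B]
  refine (hsSq_comp_le_left _ _).trans_eq ?_
  simp [← ofReal_norm]

lemma hsSq_comp_of_norm_map (B : G →L[ℂ] K) (A : F →L[ℂ] G) (hB : ∀ x, ‖B x‖ = ‖x‖) :
    hsSq (B ∘L A) = hsSq A := by
  simp_rw [hsSq, ContinuousLinearMap.comp_apply, ← ofReal_norm, hB]

lemma hsSq_smul_unit (A : F →L[ℂ] G) {c : ℂ} (hc : ‖c‖ = 1) : hsSq (c • A) = hsSq A := by
  simp [hsSq, ← ofReal_norm, norm_smul, hc]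

lemma hsSq_add_lt_top {A B : F →L[ℂ] G} (hA : hsSq A < ⊤) (hB : hsSq B < ⊤) :
    hsSq (A + B) < ⊤ := by
  have : hsSq (A + B) ≤ 2 * (hsSq A + hsSq B) := by
    rw [hsSq, hsSq, hsSq, ← ENNReal.tsum_add, ← ENNReal.tsum_mul_left]
    refine ENNReal.tsum_le_tsum fun i => ?_
    set e := (exists_hilbertBasis ℂ F).choose_spec.choose i
    have h : ‖(A + B) e‖ ^ 2 ≤ 2 * (‖A e‖ ^ 2 + ‖B e‖ ^ 2) := by
      have := norm_add_le (A e) (B e)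
      calc ‖(A + B) e‖ ^ 2 ≤ (‖A e‖ + ‖B e‖) ^ 2 := by gcongr; exact this
        _ ≤ _ := by nlinarith [sq_nonneg (‖A e‖ - ‖B e‖)]
    have h' := ENNReal.ofReal_le_ofReal h
    rwa [ENNReal.ofReal_mul (by norm_num), ENNReal.ofReal_add (by positivity) (by positivity),
      ENNReal.ofReal_pow (norm_nonneg _), ENNReal.ofReal_pow (norm_nonneg _),
      ENNReal.ofReal_pow (norm_nonneg _), ofReal_norm, ofReal_norm, ofReal_norm,
      ENNReal.ofReal_ofNat] at h'
  exact this.trans_lt (ENNReal.mul_lt_top ENNReal.ofNat_lt_top (ENNReal.add_lt_top.2 ⟨hA, hB⟩))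

lemma hsSq_smul_lt_top {A : F →L[ℂ] G} (hA : hsSq A < ⊤) (c : ℂ) : hsSq (c • A) < ⊤ := by
  have : hsSq (c • A) ≤ ‖c‖ₑ ^ 2 * hsSq A := by
    rw [hsSq, hsSq, ← ENNReal.tsum_mul_left]
    refine ENNReal.tsum_le_tsum fun i => ?_
    rw [← mul_pow]
    simp [enorm_smul]
  exact this.trans_lt (ENNReal.mul_lt_top (ENNReal.pow_lt_top enorm_lt_top) hA)

lemma hsSq_sub_lt_top {A B : F →L[ℂ] G} (hA : hsSq A < ⊤) (hB : hsSq B < ⊤) :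
    hsSq (A - B) < ⊤ := by
  have := hsSq_add_lt_top hA (hsSq_smul_lt_top hB (-1))
  rwa [neg_smul, one_smul, ← sub_eq_add_neg] at this

lemma hasSum_hsSq {ι : Type*} (e : HilbertBasis ι ℂ F) {A : F →L[ℂ] G} (hA : hsSq A < ⊤) :
    HasSum (fun i => ‖A (e i)‖ ^ 2) (hsSq A).toReal := by
  rw [hsSq_eq e] at hA ⊢
  have h : ∀ i, ‖A (e i)‖ ^ 2 = (‖A (e i)‖ₑ ^ 2).toReal := fun i => by simp
  simp_rw [h]
  rw [ENNReal.tsum_toReal_eq fun i => by simp]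
  exact (ENNReal.summable_toReal hA.ne).hasSum

/-- The Hilbert–Schmidt inner product, through the polarization identity. -/
noncomputable def hsInner (A B : F →L[ℂ] G) : ℂ :=
  (((hsSq (A + B)).toReal - (hsSq (A - B)).toReal : ℂ) +
    ((hsSq (A - Complex.I • B)).toReal - (hsSq (A + Complex.I • B)).toReal) * Complex.I) / 4

/-- The product of the adjoint of a Hilbert–Schmidt operator with a Hilbert–Schmidt operator is
trace class, and its trace is the Hilbert–Schmidt inner product. -/
lemma hasTrace_adjoint_comp {A B : F →L[ℂ] G} (hA : hsSq A < ⊤) (hB : hsSq B < ⊤) :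
    HasTrace (A.adjoint ∘L B) (hsInner A B) := by
  constructor
  · obtain ⟨w, f, -⟩ := exists_hilbertBasis ℂ G
    rw [← hsSq_adjoint] at hA hB
    have hA' := (hasSum_hsSq f hA).summable
    have hB' := (hasSum_hsSq f hB).summable
    -- Expanding B ψ in the basis f gives A* B ψ = ∑ ⟪B* f k, ψ⟫ A* f k.
    refine isTraceClass_of_family (x := fun k => B.adjoint (f k)) (y := fun k => A.adjoint (f k))
      ?_ fun ψ => ?_
    · refine (hB'.add hA').of_nonneg_of_le (fun k => by positivity) fun k => ?_
      nlinarith [sq_nonneg (‖B.adjoint (f k)‖ - ‖A.adjoint (f k)‖),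
        sq_nonneg (‖B.adjoint (f k)‖), sq_nonneg (‖A.adjoint (f k)‖)]
    · have := (f.hasSum_repr (B ψ)).mapL A.adjoint
      simpa [f.repr_apply_apply, ContinuousLinearMap.adjoint_inner_left] using this
  · intro ι e
    have hI : hsSq (Complex.I • B) < ⊤ := hsSq_smul_lt_top hB _
    have h1 := (Complex.hasSum_ofReal.2 (hasSum_hsSq e (hsSq_add_lt_top hA hB)))
    have h2 := (Complex.hasSum_ofReal.2 (hasSum_hsSq e (hsSq_sub_lt_top hA hB)))
    have h3 := (Complex.hasSum_ofReal.2 (hasSum_hsSq e (hsSq_sub_lt_top hA hI)))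
    have h4 := (Complex.hasSum_ofReal.2 (hasSum_hsSq e (hsSq_add_lt_top hA hI)))
    have h5 := ((h1.sub h2).add ((h3.sub h4).mul_right Complex.I)).div_const 4
    rw [hsInner]
    convert! h5 using 1
    funext i
    rw [ContinuousLinearMap.comp_apply, ContinuousLinearMap.adjoint_inner_right,
      inner_eq_sum_norm_sq_div_four]
    simp

end TraceClass


/-! ## Resolvents and Riesz projections -/

lemma circleIntegral_clm {E G : Type*} [NormedAddCommGroup E] [NormedSpace ℂ E] [CompleteSpace E]
    [NormedAddCommGroup G] [NormedSpace ℂ G] [CompleteSpace G] (Φ : E →L[ℂ] G) {f : ℂ → E} {c : ℂ}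
    {r : ℝ} (hf : CircleIntegrable f c r) : (∮ z in C(c, r), Φ (f z)) = Φ (∮ z in C(c, r), f z) := by
  have h := Φ.intervalIntegral_comp_comm hf.out
  simpa [circleIntegral] using h

section Resolvent

variable {F : Type} [NormedAddCommGroup F] [InnerProductSpace ℂ F]
  {A : F →ₗ.[ℂ] F}

lemma isResolventAt_resolvent {z : ℂ} (hz : z ∈ resolventSet A) :
    IsResolventAt A z (resolvent A z) := by
  have h : ∃ R : F →L[ℂ] F, IsResolventAt A z R := hz
  rw [resolvent, dif_pos h]
  exact h.choose_spec

lemma IsResolventAt.mem_domain {z : ℂ} {R : F →L[ℂ] F} (h : IsResolventAt A z R) (ψ : F) :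
    R ψ ∈ A.domain := (h.1 ψ).1

lemma IsResolventAt.apply {z : ℂ} {R : F →L[ℂ] F} (h : IsResolventAt A z R) (ψ : F) :
    A ⟨R ψ, h.mem_domain ψ⟩ = ψ + z • R ψ :=
  sub_eq_iff_eq_add.1 (h.1 ψ).2

lemma IsResolventAt.eq_of_sub_smul {z : ℂ} {R : F →L[ℂ] F} (h : IsResolventAt A z R) {u χ : F}
    (hu : u ∈ A.domain) (hχ : A ⟨u, hu⟩ - z • u = χ) : R χ = u := by
  rw [← hχ]
  exact h.2 ⟨u, hu⟩

lemma IsResolventAt.sub_eq {z w : ℂ} {R S : F →L[ℂ] F} (hR : IsResolventAt A z R)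
    (hS : IsResolventAt A w S) : R - S = (z - w) • (R * S) := by
  ext ψ
  have h := hR.2 ⟨S ψ, hS.mem_domain ψ⟩
  simp only [hS.apply, map_sub, map_add, map_smul] at h
  change R ψ - S ψ = (z - w) • R (S ψ)
  rw [sub_smul, sub_eq_sub_iff_add_eq_add]
  rw [sub_eq_iff_eq_add] at h
  rw [h, add_comm]

lemma norm_le_of_mem_resolventSet {z : ℂ} (hz : z ∈ resolventSet A) (v : A.domain) :
    ‖(v : F)‖ ≤ ‖resolvent A z‖ * ‖A v - z • (v : F)‖ := by
  conv_lhs => rw [← (isResolventAt_resolvent hz).2 v]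
  exact ContinuousLinearMap.le_opNorm _ _

/-- The resolvent identity in multiplicative form: 1 - (z - w) R_w is invertible with inverse 1 + (z
- w) R_z. Continuity of the resolvent and the spectral mapping for (A - μ)⁻¹ both rest on it. -/
lemma one_sub_mul_one_add {z w : ℂ} (hz : z ∈ resolventSet A) (hw : w ∈ resolventSet A) :
    (1 - (z - w) • resolvent A w) * (1 + (z - w) • resolvent A z) = 1 := by
  have h := (isResolventAt_resolvent hw).sub_eq (isResolventAt_resolvent hz)
  have h' : resolvent A w * resolvent A z * (1 : F →L[ℂ] F) = resolvent A w * resolvent A z :=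
    mul_one _
  rcases eq_or_ne z w with rfl | hne
  · simp
  have h2 : resolvent A w * resolvent A z =
      (w - z)⁻¹ • (resolvent A w - resolvent A z) := by
    rw [h, smul_smul, inv_mul_cancel₀ (sub_ne_zero.2 hne.symm), one_smul]
  rw [mul_add, sub_mul, sub_mul, smul_mul_smul_comm, h2, smul_smul]
  have h3 : (z - w) * (z - w) * (w - z)⁻¹ = -(z - w) := by
    rw [← neg_sub z w, inv_neg, mul_neg, mul_assoc, mul_inv_cancel₀ (sub_ne_zero.2 hne), mul_one]
  rw [h3]
  simp only [one_mul, mul_one, smul_sub, neg_smul]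
  abel

lemma one_add_mul_one_sub {z w : ℂ} (hz : z ∈ resolventSet A) (hw : w ∈ resolventSet A) :
    (1 + (z - w) • resolvent A z) * (1 - (z - w) • resolvent A w) = 1 := by
  have h := one_sub_mul_one_add hw hz
  rw [← neg_sub z w, neg_smul, sub_neg_eq_add, neg_smul, ← sub_eq_add_neg] at h
  exact h

/-- A fixed resolvent is factored out of a variable one. It can then be pulled out of contour
integrals, which shows that their values lie in the domain without integrating in the graph norm. -/
lemma resolvent_eq_mul {z w : ℂ} (hz : z ∈ resolventSet A) (hw : w ∈ resolventSet A) :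
    resolvent A z = (1 + (z - w) • resolvent A z) * resolvent A w := by
  have h := (isResolventAt_resolvent hz).sub_eq (isResolventAt_resolvent hw)
  rw [add_mul, one_mul, smul_mul_assoc, ← h]
  abel

lemma resolvent_eq_mul' {z w : ℂ} (hz : z ∈ resolventSet A) (hw : w ∈ resolventSet A) :
    resolvent A z = resolvent A w * (1 + (z - w) • resolvent A z) := by
  have h := (isResolventAt_resolvent hw).sub_eq (isResolventAt_resolvent hz)
  rw [mul_add, mul_one, mul_smul_comm, ← neg_sub w z, neg_smul, ← h]
  abel

/-- By `resolvent_eq_mul`, the resolvent is the inverse of an affine function of z times a fixed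
operator, and inversion is continuous at units. -/
lemma continuousOn_resolvent [CompleteSpace F] {w : ℂ} (hw : w ∈ resolventSet A) :
    ContinuousOn (resolvent A) (resolventSet A) := by
  have h : ∀ z ∈ resolventSet A, resolvent A z =
      Ring.inverse (1 - (z - w) • resolvent A w) * resolvent A w := fun z hz => by
    have := Ring.inverse_unit
      (Units.mk _ _ (one_sub_mul_one_add hz hw) (one_add_mul_one_sub hz hw))
    simp only [Units.val_mk, Units.inv_mk] at this
    rw [this]
    exact resolvent_eq_mul hz hw
  refine ContinuousOn.congr ?_ h
  intro z hz
  refine ContinuousAt.continuousWithinAt ?_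
  refine ContinuousAt.mul ?_ continuousAt_const
  have hu := NormedRing.inverse_continuousAt
    (Units.mk _ _ (one_sub_mul_one_add hz hw) (one_add_mul_one_sub hz hw))
  exact ContinuousAt.comp (f := fun z => 1 - (z - w) • resolvent A w) hu (by fun_prop)

end Resolvent

section SelfAdjoint

variable {F : Type} [NormedAddCommGroup F] [InnerProductSpace ℂ F] [CompleteSpace F]
  {A : F →ₗ.[ℂ] F}

lemma inner_map_eq (hA : IsSelfAdjoint A) (u v : A.domain) :
    ⟪A u, (v : F)⟫_ℂ = ⟪(u : F), A v⟫_ℂ := by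
  have h := A.adjoint_isFormalAdjoint hA.dense_domain
  rw [LinearPMap.isSelfAdjoint_def.1 hA] at h
  exact h u v

lemma im_inner_sub_smul (hA : IsSelfAdjoint A) (z : ℂ) (v : A.domain) :
    (⟪(v : F), A v - z • (v : F)⟫_ℂ).im = -z.im * ‖(v : F)‖ ^ 2 := by
  have h : (⟪(v : F), A v⟫_ℂ).im = 0 := by
    have h1 := inner_map_eq hA v v
    have h2 := inner_conj_symm (𝕜 := ℂ) (v : F) (A v)
    rw [h1] at h2
    exact Complex.conj_eq_iff_im.1 h2
  rw [inner_sub_right, inner_smul_right, Complex.sub_im, h, inner_self_eq_norm_sq_to_K]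
  simp [← Complex.ofReal_pow]

/-- The imaginary part of ⟪v, (A - z) v⟫ is -Im z ‖v‖², because ⟪v, A v⟫ is real. -/
lemma norm_le_of_im_ne_zero (hA : IsSelfAdjoint A) {z : ℂ} (hz : z.im ≠ 0) (v : A.domain) :
    ‖(v : F)‖ ≤ |z.im|⁻¹ * ‖A v - z • (v : F)‖ := by
  have h := im_inner_sub_smul hA z v
  have h1 : |z.im| * ‖(v : F)‖ ^ 2 ≤ ‖(v : F)‖ * ‖A v - z • (v : F)‖ := by
    calc |z.im| * ‖(v : F)‖ ^ 2 = |(⟪(v : F), A v - z • (v : F)⟫_ℂ).im| := by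
          rw [h, abs_mul, abs_neg, abs_of_nonneg (sq_nonneg ‖(v : F)‖)]
      _ ≤ ‖⟪(v : F), A v - z • (v : F)⟫_ℂ‖ := Complex.abs_im_le_norm _
      _ ≤ _ := norm_inner_le_norm _ _
  have hpos : 0 < |z.im| := abs_pos.2 hz
  rcases eq_or_lt_of_le (norm_nonneg (v : F)) with h0 | h0
  · rw [← h0]; positivity
  · rw [inv_mul_eq_div, le_div_iff₀ hpos]
    nlinarith

/-- A self-adjoint operator is boundedly invertible as soon as it is bounded from below. -/
lemma mem_resolventSet_of_bound (hA : IsSelfAdjoint A) {z : ℂ} {C : ℝ}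
    (h : ∀ v : A.domain, ‖(v : F)‖ ≤ C * ‖A v - z • (v : F)‖) : z ∈ resolventSet A := by
  have hclosed : IsClosed (A.graph : Set (F × F)) := hA.isClosed
  have : CompleteSpace A.graph := hclosed.completeSpace_coe
  have hgr : ∀ p : A.graph, ∃ hp : p.1.1 ∈ A.domain, A ⟨p.1.1, hp⟩ = p.1.2 := fun p => by
    obtain ⟨y, hy1, hy2⟩ := (LinearPMap.mem_graph_iff A).1 p.2
    refine ⟨hy1 ▸ y.2, ?_⟩
    rw [← hy2]
    congr 1
    exact Subtype.ext hy1.symm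
  let Φ : A.graph →L[ℂ] F := (ContinuousLinearMap.snd ℂ F F - z • ContinuousLinearMap.fst ℂ F F).comp
    A.graph.subtypeL
  have hΦ : ∀ p : A.graph, Φ p = p.1.2 - z • p.1.1 := fun p => rfl
  have hΦ' : ∀ v : A.domain, ∃ p : A.graph, p.1.1 = v ∧ Φ p = A v - z • (v : F) := fun v =>
    ⟨⟨(v, A v), A.mem_graph v⟩, rfl, rfl⟩
  have hb : ∀ p : A.graph, ‖p.1.1‖ ≤ |C| * ‖Φ p‖ := fun p => by
    obtain ⟨hp, hp2⟩ := hgr p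
    have := h ⟨p.1.1, hp⟩
    rw [hp2] at this
    rw [hΦ]
    exact this.trans (mul_le_mul_of_nonneg_right (le_abs_self C) (norm_nonneg _))
  -- On the graph, which is complete because A is closed, A - z is bounded below for the graph norm.
  -- Its range is therefore closed.
  have hanti : ∃ K, AntilipschitzWith K Φ := by
    refine ⟨(Real.toNNReal (|C| + 1 + ‖z‖ * |C|)), ?_⟩
    refine AddMonoidHomClass.antilipschitz_of_bound Φ fun p => ?_
    rw [Real.coe_toNNReal _ (by positivity)]
    have h1 := hb p
    have h2 : ‖p.1.2‖ ≤ ‖Φ p‖ + ‖z‖ * (|C| * ‖Φ p‖) := by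
      calc ‖p.1.2‖ = ‖Φ p + z • p.1.1‖ := by rw [hΦ]; simp
        _ ≤ ‖Φ p‖ + ‖z • p.1.1‖ := norm_add_le _ _
        _ ≤ _ := by rw [norm_smul]; gcongr
    have h3 : ‖p‖ = max ‖p.1.1‖ ‖p.1.2‖ := rfl
    have h4 : 0 ≤ |C| * ‖Φ p‖ := by positivity
    have h5 : 0 ≤ ‖z‖ * (|C| * ‖Φ p‖) := by positivity
    rw [h3]
    refine max_le ?_ ?_ <;> nlinarith [norm_nonneg (Φ p)]
  obtain ⟨K, hK⟩ := hanti
  have hran : IsClosed (LinearMap.range (Φ : A.graph →ₗ[ℂ] F) : Set F) :=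
    hK.isClosed_range Φ.uniformContinuous
  -- A vector y orthogonal to the range lies in the domain of A* = A and satisfies A y = conj(z) y,
  -- so an estimate on A - conj(z) forces y = 0.
  have horth : (LinearMap.range (Φ : A.graph →ₗ[ℂ] F))ᗮ = ⊥ := by
    rw [eq_bot_iff]
    intro y hy
    have h1 : ∀ v : A.domain, ⟪(starRingEnd ℂ) z • y, (v : F)⟫_ℂ = ⟪y, A v⟫_ℂ := fun v => by
      obtain ⟨p, -, hp2⟩ := hΦ' v
      have := Submodule.inner_left_of_mem_orthogonal (LinearMap.mem_range_self (Φ : A.graph →ₗ[ℂ] F) p) hy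
      rw [ContinuousLinearMap.coe_coe, hp2, inner_sub_right, inner_smul_right, sub_eq_zero] at this
      rw [this, inner_smul_left, Complex.conj_conj]
    have h2 : y ∈ A.adjoint.domain := A.mem_adjoint_domain_of_exists y ⟨_, h1⟩
    have h3 : A.adjoint ⟨y, h2⟩ = (starRingEnd ℂ) z • y :=
      A.adjoint_apply_eq hA.dense_domain ⟨y, h2⟩ h1
    have hAA : A.adjoint = A := hA
    have h4 : ∃ hy : y ∈ A.domain, A ⟨y, hy⟩ = (starRingEnd ℂ) z • y := by
      have key : ∀ B : F →ₗ.[ℂ] F, B = A → ∀ hB : y ∈ B.domain,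
          ∃ hy : y ∈ A.domain, A ⟨y, hy⟩ = B ⟨y, hB⟩ := by
        rintro B rfl hB
        exact ⟨hB, rfl⟩
      obtain ⟨hy1, hy2⟩ := key _ hAA h2
      exact ⟨hy1, hy2.trans h3⟩
    obtain ⟨hy', hy2⟩ := h4
    rw [Submodule.mem_bot, ← norm_le_zero_iff]
    -- The hypothesis concerns A - z, while y is an eigenvector for conj(z). For real z the two
    -- agree; otherwise the bound by the imaginary part applies.
    by_cases hz : z.im = 0
    · have := h ⟨y, hy'⟩
      rw [hy2, Complex.conj_eq_iff_im.2 hz] at this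
      simpa using this
    · have := norm_le_of_im_ne_zero hA (z := (starRingEnd ℂ) z) (by simpa using hz) ⟨y, hy'⟩
      rw [hy2] at this
      simpa using this
  have htop : LinearMap.range (Φ : A.graph →ₗ[ℂ] F) = ⊤ := by
    rwa [← Submodule.topologicalClosure_eq_top_iff, hran.submodule_topologicalClosure_eq] at horth
  let e : A.graph ≃L[ℂ] F := ContinuousLinearEquiv.ofBijective Φ
    (LinearMap.ker_eq_bot.2 hK.injective) htop
  refine ⟨(graphIncl A).comp (e.symm : F →L[ℂ] A.graph), fun ψ => ?_, fun φ => ?_⟩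
  · obtain ⟨hp, hp2⟩ := hgr (e.symm ψ)
    refine ⟨hp, ?_⟩
    have : Φ (e.symm ψ) = ψ := e.apply_symm_apply ψ
    rw [hΦ] at this
    conv_rhs => rw [← this]
    rw [← hp2]
    rfl
  · obtain ⟨p, hp1, hp2⟩ := hΦ' φ
    rw [← hp2]
    have : e.symm (Φ p) = p := e.symm_apply_apply p
    rw [ContinuousLinearMap.comp_apply, ContinuousLinearEquiv.coe_coe, this]
    exact hp1

lemma isSelfAdjoint_resolvent (hA : IsSelfAdjoint A) {μ : ℝ} (hμ : (μ : ℂ) ∈ resolventSet A) :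
    IsSelfAdjoint (resolvent A μ) := by
  rw [ContinuousLinearMap.isSelfAdjoint_iff_isSymmetric]
  have hR := isResolventAt_resolvent hμ
  intro x y
  simp only [ContinuousLinearMap.coe_coe]
  have h := inner_map_eq hA ⟨_, hR.mem_domain x⟩ ⟨_, hR.mem_domain y⟩
  rw [hR.apply, hR.apply, inner_add_left, inner_add_right, inner_smul_left, inner_smul_right,
    Complex.conj_ofReal] at h
  exact (add_right_cancel h).symm

/-- A closed operator composed with a bounded operator into its domain is bounded. -/
lemma exists_bounded_comp (hA : A.IsClosed) (B : F →L[ℂ] F) (hB : ∀ ψ, B ψ ∈ A.domain) :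
    ∃ M : F →L[ℂ] F, ∀ ψ, M ψ = A ⟨B ψ, hB ψ⟩ := by
  let L : F →ₗ[ℂ] F := A.toFun.comp ((B : F →ₗ[ℂ] F).codRestrict A.domain hB)
  have hL : ∀ ψ, L ψ = A ⟨B ψ, hB ψ⟩ := fun ψ => rfl
  have hc : Continuous L := by
    refine LinearMap.continuous_of_isClosed_graph L ?_
    have : (L.graph : Set (F × F)) = (fun p : F × F => (B p.1, p.2)) ⁻¹' (A.graph : Set (F × F)) := by
      ext ⟨x, y⟩
      simp only [SetLike.mem_coe, LinearMap.mem_graph_iff, mem_preimage]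
      rw [hL]
      constructor
      · rintro rfl
        exact A.mem_graph ⟨B x, hB x⟩
      · intro h
        obtain ⟨u, hu1, hu2⟩ := (LinearPMap.mem_graph_iff A).1 h
        simp only at hu1 hu2
        rw [← hu2]
        congr 1
        exact Subtype.ext hu1
    rw [this]
    exact IsClosed.preimage (by fun_prop) hA
  exact ⟨⟨L, hc⟩, hL⟩

/-! ### The spectral projection below a gap -/

variable {μ : ℝ} {c : ℂ} {r : ℝ}

/-- A spectral point on the circle could only have real part μ. Non-real points are excluded by
self-adjointness, and μ itself by the gap. -/
lemma EnclosesBelow.sphere_subset (hC : EnclosesBelow A μ c r) (hA : IsSelfAdjoint A)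
    (hμ : (μ : ℂ) ∈ resolventSet A) : Metric.sphere c r ⊆ resolventSet A := by
  intro z hz
  by_contra hn
  obtain ⟨h1, h2⟩ := hC.2 z hn
  rcases lt_trichotomy z.re μ with h | h | h
  · have := h1 h
    rw [Metric.mem_ball] at this
    rw [Metric.mem_sphere] at hz
    exact this.ne hz
  · by_cases him : z.im = 0
    · have hzμ : z = (μ : ℂ) := Complex.ext (by simpa using h) (by simpa using him)
      exact hn (hzμ ▸ hμ)
    · exact hn (mem_resolventSet_of_bound hA (norm_le_of_im_ne_zero hA him))
  · exact h2 h (Metric.sphere_subset_closedBall hz)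

/-- Spectral mapping for u = (t - μ)⁻¹: if t = μ + u⁻¹ were in the resolvent set, 1 - u⁻¹ (A - μ)⁻¹
would be invertible, hence so would u - (A - μ)⁻¹. -/
lemma notMem_resolventSet_of_mem_spectrum (hμ : (μ : ℂ) ∈ resolventSet A) {u : ℂ}
    (hu : u ∈ spectrum ℂ (resolvent A μ)) (hu0 : u ≠ 0) : (μ : ℂ) + u⁻¹ ∉ resolventSet A := by
  intro hz
  apply hu
  have h1 := one_sub_mul_one_add hz hμ
  have h2 := one_add_mul_one_sub hz hμ
  have h3 : IsUnit (1 - ((μ : ℂ) + u⁻¹ - μ) • resolvent A μ) := ⟨⟨_, _, h1, h2⟩, rfl⟩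
  have h4 := h3.smul (Units.mk0 u hu0)
  rw [Units.smul_mk0, smul_sub, smul_smul, add_sub_cancel_left, mul_inv_cancel₀ hu0, one_smul] at h4
  rwa [spectrum.mem_resolventSet_iff, Algebra.algebraMap_eq_smul_one]

lemma im_eq_zero_of_mem_spectrum {R : F →L[ℂ] F} (hR : IsSelfAdjoint R) {u : ℂ}
    (hu : u ∈ spectrum ℂ R) : u.im = 0 := by
  rw [hR.mem_spectrum_eq_re hu]
  simp

/-- The negative part of the spectrum of `(A - μ)⁻¹` is bounded away from zero. -/
lemma EnclosesBelow.exists_gap (hC : EnclosesBelow A μ c r) (hA : IsSelfAdjoint A)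
    (hμ : (μ : ℂ) ∈ resolventSet A) :
    ∃ ε > 0, ∀ u ∈ spectrum ℂ (resolvent A μ), u.re < 0 → u.re ≤ -ε := by
  have hRsa := isSelfAdjoint_resolvent hA hμ
  -- A negative u corresponds to the spectral point μ + u⁻¹ inside the circle, so |u⁻¹| < ‖c - μ‖ +
  -- r.
  refine ⟨(‖c - μ‖ + r)⁻¹, inv_pos.2 (by have := hC.1; positivity), fun u hu hneg => ?_⟩
  have hu' : u = (u.re : ℂ) := Complex.ext (by simp) (by simp [im_eq_zero_of_mem_spectrum hRsa hu])
  have hu0 : u ≠ 0 := by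
    rintro rfl
    simp at hneg
  have h1 := (hC.2 _ (notMem_resolventSet_of_mem_spectrum hμ hu hu0)).1 (by
    rw [hu', ← Complex.ofReal_inv, ← Complex.ofReal_add, Complex.ofReal_re]
    have := inv_lt_zero.2 hneg
    linarith)
  rw [Metric.mem_ball, dist_eq_norm] at h1
  have h2 : ‖u⁻¹‖ < ‖c - μ‖ + r := by
    calc ‖u⁻¹‖ = ‖((μ : ℂ) + u⁻¹ - c) + (c - μ)‖ := by ring_nf
      _ ≤ _ := norm_add_le _ _
      _ < _ := by linarith
  rw [norm_inv] at h2
  have h3 : ‖u‖ = -u.re := by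
    rw [hu', Complex.norm_real, Complex.ofReal_re, Real.norm_of_nonpos hneg.le]
  have h4 := inv_strictAnti₀ (inv_pos.2 (norm_pos_iff.2 hu0)) h2
  rw [inv_inv, h3] at h4
  linarith

lemma EnclosesBelow.continuousOn_indicator (hC : EnclosesBelow A μ c r) (hA : IsSelfAdjoint A)
    (hμ : (μ : ℂ) ∈ resolventSet A) :
    ContinuousOn (Set.indicator (Set.Iio (0 : ℝ)) (fun _ => (1 : ℝ)))
      (spectrum ℝ (resolvent A μ)) := by
  obtain ⟨ε, hε, h⟩ := hC.exists_gap hA hμ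
  have hRsa := isSelfAdjoint_resolvent hA hμ
  have h' : ∀ x ∈ spectrum ℝ (resolvent A μ), x < 0 → x ≤ -ε := fun x hx hx0 => by
    have := h (x : ℂ) (by simpa using! spectrum.algebraMap_mem ℂ hx) (by simpa using hx0)
    simpa using this
  -- A piecewise linear cutoff, equal to 1 below -ε and to 0 on [0, ∞). It agrees with the indicator
  -- on the spectrum.
  have hg : Continuous fun x : ℝ => max 0 (min 1 (-x / ε)) := by fun_prop
  refine hg.continuousOn.congr fun x hx => ?_
  by_cases hx0 : x < 0
  · have h1 : 1 ≤ -x / ε := by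
      rw [le_div_iff₀ hε]
      linarith [h' x hx hx0]
    simp [hx0, min_eq_left h1]
  · have h1 : -x / ε ≤ 0 := div_nonpos_of_nonpos_of_nonneg (by linarith) hε.le
    simp only [mem_Iio, hx0, not_false_eq_true, indicator_of_notMem]
    rw [max_eq_left]
    exact (min_le_right _ _).trans h1

lemma isSelfAdjoint_specProj (A : F →ₗ.[ℂ] F) (μ : ℝ) : IsSelfAdjoint (specProj A μ) :=
  cfc_predicate _ _

lemma EnclosesBelow.specProj_mul_self (hC : EnclosesBelow A μ c r) (hA : IsSelfAdjoint A)
    (hμ : (μ : ℂ) ∈ resolventSet A) : specProj A μ * specProj A μ = specProj A μ := by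
  have hcont := hC.continuousOn_indicator hA hμ
  rw [specProj, ← cfc_mul _ _ _ hcont hcont]
  refine cfc_congr fun x _ => ?_
  by_cases hx : x < 0 <;> simp [hx]

lemma commute_specProj {S : F →L[ℂ] F} (hS : Commute (resolvent A μ) S) :
    Commute (specProj A μ) S := hS.cfc_real _

lemma one_sub_mul_ne_zero (hμ : (μ : ℂ) ∈ resolventSet A) {z u : ℂ}
    (hz : z ∈ resolventSet A) (hu : u ∈ spectrum ℂ (resolvent A μ)) : 1 - (z - μ) * u ≠ 0 := by
  intro h
  have hu0 : u ≠ 0 := by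
    rintro rfl
    simp at h
  refine notMem_resolventSet_of_mem_spectrum hμ hu hu0 ?_
  convert hz using 1
  field_simp
  linear_combination h

/-- If u = (t - μ)⁻¹ then (t - z)⁻¹ = u / (1 - (z - μ) u). All resolvents and the spectral
projection thus live in the functional calculus of the single bounded operator (A - μ)⁻¹. -/
lemma cfc_resolvent (hA : IsSelfAdjoint A) (hμ : (μ : ℂ) ∈ resolventSet A) {z : ℂ}
    (hz : z ∈ resolventSet A) :
    cfc (fun u : ℂ => u / (1 - (z - μ) * u)) (resolvent A μ) = resolvent A z := by
  have hn : IsStarNormal (resolvent A μ) := (isSelfAdjoint_resolvent hA hμ).isStarNormal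
  have h0 := fun u (hu : u ∈ spectrum ℂ (resolvent A μ)) => one_sub_mul_ne_zero hμ hz hu
  have hc1 : ContinuousOn (fun u : ℂ => u / (1 - (z - μ) * u)) (spectrum ℂ (resolvent A μ)) :=
    ContinuousOn.div (by fun_prop) (by fun_prop) h0
  have h1 : cfc (fun u : ℂ => 1 - (z - μ) * u) (resolvent A μ) = 1 - (z - μ) • resolvent A μ := by
    rw [cfc_sub _ _ _ (by fun_prop) (by fun_prop), cfc_const_one ℂ (resolvent A μ),
      cfc_const_mul _ _ _ (by fun_prop), cfc_id' ℂ (resolvent A μ)]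
  have h2 : cfc (fun u : ℂ => u / (1 - (z - μ) * u)) (resolvent A μ) *
      (1 - (z - μ) • resolvent A μ) = resolvent A μ := by
    rw [← h1, ← cfc_mul _ _ _ hc1 (by fun_prop)]
    conv_rhs => rw [← cfc_id' ℂ (resolvent A μ)]
    exact cfc_congr fun u hu => div_mul_cancel₀ _ (h0 u hu)
  calc _ = cfc (fun u : ℂ => u / (1 - (z - μ) * u)) (resolvent A μ) *
      ((1 - (z - μ) • resolvent A μ) * (1 + (z - μ) • resolvent A z)) := by
        rw [one_sub_mul_one_add hz hμ, mul_one]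
    _ = resolvent A μ * (1 + (z - μ) • resolvent A z) := by rw [← mul_assoc, h2]
    _ = _ := (resolvent_eq_mul' hz hμ).symm

/-- For u ≠ 0 the integrand is -(z - t)⁻¹ with t = μ + u⁻¹ a spectral point, which lies inside the
circle exactly when u < 0; Cauchy's formula does the rest. At u = 0 both sides vanish. -/
lemma circleIntegral_resolvent_symbol (hC : EnclosesBelow A μ c r) (hA : IsSelfAdjoint A)
    (hμ : (μ : ℂ) ∈ resolventSet A) {u : ℂ} (hu : u ∈ spectrum ℂ (resolvent A μ)) :
    (∮ z in C(c, r), u / (1 - (z - μ) * u)) =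
      -(2 * Real.pi * Complex.I) * ((Set.indicator (Set.Iio (0 : ℝ)) (fun _ => (1 : ℝ)) u.re : ℝ) : ℂ) := by
  have hRsa := isSelfAdjoint_resolvent hA hμ
  by_cases hu0 : u = 0
  · simp [hu0, circleIntegral]
  have hu' : u = (u.re : ℂ) := Complex.ext (by simp) (by simp [im_eq_zero_of_mem_spectrum hRsa hu])
  set t : ℂ := μ + u⁻¹ with ht
  have htn := notMem_resolventSet_of_mem_spectrum hμ hu hu0
  have htre : t.re = μ + (u.re)⁻¹ := by
    rw [ht, hu', ← Complex.ofReal_inv, ← Complex.ofReal_add, Complex.ofReal_re, Complex.ofReal_re]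
  have h1 : ∀ z : ℂ, u / (1 - (z - μ) * u) = -(z - t)⁻¹ := fun z => by
    have : 1 - (z - μ) * u = -((z - t) * u) := by
      rw [ht]
      field_simp
      ring
    rw [this]
    rcases eq_or_ne (z - t) 0 with h | h
    · simp [h]
    · field_simp
  simp_rw [h1]
  have h2 : (∮ z in C(c, r), -(z - t)⁻¹) = -∮ z in C(c, r), (z - t)⁻¹ := by
    have := circleIntegral.integral_smul (-1 : ℂ) (fun z => (z - t)⁻¹) c r
    simpa using this
  rw [h2]
  have hre0 : u.re ≠ 0 := fun h => hu0 (by rw [hu', h, Complex.ofReal_zero])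
  rcases lt_or_gt_of_ne hre0 with h | h
  · have hb := (hC.2 t htn).1 (by rw [htre]; linarith [inv_lt_zero.2 h])
    rw [circleIntegral.integral_sub_inv_of_mem_ball hb]
    simp [h]
  · have hb := (hC.2 t htn).2 (by rw [htre]; linarith [inv_pos.2 h])
    rw [Complex.circleIntegral_eq_zero_of_differentiable_on_off_countable hC.1.le countable_empty]
    · simp [h.le]
    · refine ContinuousOn.inv₀ (by fun_prop) fun z hz h0 => hb ?_
      rwa [← sub_eq_zero.1 h0]
    · intro z hz
      refine DifferentiableAt.inv (by fun_prop) fun h0 => hb ?_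
      rw [← sub_eq_zero.1 h0]
      exact Metric.ball_subset_closedBall hz.1

/-- Riesz' formula for the spectral projection. -/
lemma circleIntegral_resolvent (hC : EnclosesBelow A μ c r) (hA : IsSelfAdjoint A)
    (hμ : (μ : ℂ) ∈ resolventSet A) :
    (∮ z in C(c, r), resolvent A z) = -(2 * Real.pi * Complex.I) • specProj A μ := by
  have hRsa := isSelfAdjoint_resolvent hA hμ
  have hn : IsStarNormal (resolvent A μ) := hRsa.isStarNormal
  have hsph : ∀ θ, circleMap c r θ ∈ resolventSet A := fun θ =>
    hC.sphere_subset hA hμ (circleMap_mem_sphere c hC.1.le θ)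
  set f : ℝ → ℂ → ℂ := fun θ u => deriv (circleMap c r) θ * (u / (1 - (circleMap c r θ - μ) * u))
    with hf
  have hcm := continuous_circleMap c r
  have hdc : Continuous (deriv (circleMap c r)) := by
    have := continuous_circleMap 0 r
    simp only [funext (deriv_circleMap c r)]
    fun_prop
  have hfc : ContinuousOn (Function.uncurry f) (univ ×ˢ spectrum ℂ (resolvent A μ)) := by
    refine ContinuousOn.mul (by fun_prop) (ContinuousOn.div (by fun_prop) (by fun_prop) ?_)
    rintro ⟨θ, u⟩ ⟨-, hu⟩
    exact one_sub_mul_ne_zero hμ (hsph θ) hu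
  obtain ⟨C, hCb⟩ := ((isCompact_Icc (a := (0 : ℝ)) (b := 2 * Real.pi)).prod
    (spectrum.isCompact (𝕜 := ℂ) (resolvent A μ))).exists_bound_of_continuousOn
    (hfc.mono (prod_mono_left (subset_univ _)))
  -- The functional calculus commutes with the integral over the angle, so Riesz' formula reduces to
  -- the scalar contour integral of the symbol.
  have hint := cfc_setIntegral (μ := volume) (s := Ioc 0 (2 * Real.pi)) measurableSet_Ioc f
    (fun _ => C) (resolvent A μ) (hfc.mono (prod_mono_left (subset_univ _)))
    (by
      refine (ae_restrict_mem measurableSet_Ioc).mono fun θ hθ u hu => ?_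
      exact hCb (θ, u) ⟨Ioc_subset_Icc_self hθ, hu⟩)
    (hasFiniteIntegral_const _)
  have h1 : ∀ θ, cfc (f θ) (resolvent A μ) =
      deriv (circleMap c r) θ • resolvent A (circleMap c r θ) := fun θ => by
    rw [hf, cfc_const_mul _ _ _ ?_, cfc_resolvent hA hμ (hsph θ)]
    exact ContinuousOn.div (by fun_prop) (by fun_prop)
      fun u hu => one_sub_mul_ne_zero hμ (hsph θ) hu
  simp_rw [h1] at hint
  rw [circleIntegral, intervalIntegral.integral_of_le (by positivity), ← hint, specProj,
    cfc_real_eq_complex _ hRsa]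
  have hcont : ContinuousOn (fun x : ℂ =>
      ((Set.indicator (Set.Iio (0 : ℝ)) (fun _ => (1 : ℝ)) x.re : ℝ) : ℂ))
      (spectrum ℂ (resolvent A μ)) := by
    refine Complex.continuous_ofReal.comp_continuousOn ((hC.continuousOn_indicator hA hμ).comp
      Complex.continuous_re.continuousOn fun x hx => ?_)
    have := hRsa.mem_spectrum_eq_re hx
    rw [this] at hx
    exact (spectrum.algebraMap_mem_iff ℂ).1 hx
  rw [← cfc_const_mul _ _ _ hcont]
  refine cfc_congr fun u hu => ?_
  rw [← circleIntegral_resolvent_symbol hC hA hμ hu, circleIntegral,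
    intervalIntegral.integral_of_le (by positivity)]
  rfl

/-! ### The inverse Liouvillian -/

lemma commute_resolvent_resolvent {z w : ℂ} (hz : z ∈ resolventSet A) (hw : w ∈ resolventSet A) :
    Commute (resolvent A z) (resolvent A w) := by
  rcases eq_or_ne z w with rfl | hne
  · exact Commute.refl _
  have h1 := (isResolventAt_resolvent hz).sub_eq (isResolventAt_resolvent hw)
  have h2 := (isResolventAt_resolvent hw).sub_eq (isResolventAt_resolvent hz)
  have h3 : (z - w) • (resolvent A z * resolvent A w) =
      (z - w) • (resolvent A w * resolvent A z) := by
    rw [← h1, ← neg_sub w z, neg_smul, ← h2, neg_sub]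
  have h4 := congrArg (fun X => (z - w)⁻¹ • X) h3
  simp only [smul_smul, inv_mul_cancel₀ (sub_ne_zero.2 hne), one_smul] at h4
  exact h4

lemma commute_specProj_resolvent (hμ : (μ : ℂ) ∈ resolventSet A) {z : ℂ} (hz : z ∈ resolventSet A) :
    Commute (specProj A μ) (resolvent A z) :=
  commute_specProj (commute_resolvent_resolvent hμ hz)

/-- Multiplying D = P D + D P by P on both sides gives P D P = 2 P D P. -/
lemma mul_mul_eq_zero_of_offDiagonal {S : Type*} [Ring S] {P D : S} (hPP : P * P = P)
    (hD : D = P * D + D * P) : P * D * P = 0 := by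
  have h := congrArg (fun X => P * X * P) hD
  simp only [mul_add, add_mul] at h
  rw [← mul_assoc P P D, hPP, mul_assoc P (D * P) P, mul_assoc D P P, hPP, ← mul_assoc] at h
  exact left_eq_add.1 h

section Liouville

variable (hC : EnclosesBelow A μ c r) (hA : IsSelfAdjoint A) (hμ : (μ : ℂ) ∈ resolventSet A)
include hC hA hμ

lemma EnclosesBelow.continuousOn_sphere : ContinuousOn (resolvent A) (Metric.sphere c r) :=
  (continuousOn_resolvent hμ).mono (hC.sphere_subset hA hμ)

lemma EnclosesBelow.circleIntegrable_sandwich (X : F →L[ℂ] F) :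
    CircleIntegrable (fun z => resolvent A z * X * resolvent A z) c r := by
  have h := hC.continuousOn_sphere hA hμ
  exact ContinuousOn.circleIntegrable hC.1.le ((h.mul continuousOn_const).mul h)

lemma EnclosesBelow.mul_circleIntegral_sandwich (L X : F →L[ℂ] F)
    (hL : ∀ z ∈ resolventSet A, Commute L (resolvent A z)) :
    (∮ z in C(c, r), resolvent A z * (L * X) * resolvent A z) =
      L * ∮ z in C(c, r), resolvent A z * X * resolvent A z := by
  have h := circleIntegral_clm (ContinuousLinearMap.mul ℂ (F →L[ℂ] F) L)
    (hC.circleIntegrable_sandwich hA hμ X)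
  simp only [ContinuousLinearMap.mul_apply'] at h
  rw [← h]
  refine circleIntegral.integral_congr hC.1.le fun z hz => ?_
  have hz' := hL z (hC.sphere_subset hA hμ hz)
  simp only [← mul_assoc]
  rw [hz'.eq]

lemma EnclosesBelow.circleIntegral_sandwich_mul (L X : F →L[ℂ] F)
    (hL : ∀ z ∈ resolventSet A, Commute L (resolvent A z)) :
    (∮ z in C(c, r), resolvent A z * (X * L) * resolvent A z) =
      (∮ z in C(c, r), resolvent A z * X * resolvent A z) * L := by
  have h := circleIntegral_clm ((ContinuousLinearMap.mul ℂ (F →L[ℂ] F)).flip L)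
    (hC.circleIntegrable_sandwich hA hμ X)
  simp only [ContinuousLinearMap.mul_apply', ContinuousLinearMap.flip_apply] at h
  rw [← h]
  refine circleIntegral.integral_congr hC.1.le fun z hz => ?_
  have hz' := hL z (hC.sphere_subset hA hμ hz)
  simp only [mul_assoc]
  rw [hz'.eq]

lemma EnclosesBelow.commute_invLiouvillian {D S : F →L[ℂ] F} (hSD : Commute S D)
    (hS : ∀ z ∈ resolventSet A, Commute S (resolvent A z)) :
    Commute S (invLiouvillian A μ c r D) := by
  have hSP : Commute S (specProj A μ) := (commute_specProj (hS _ hμ).symm).symm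
  have hK : Commute S (D * specProj A μ - specProj A μ * D) :=
    (hSD.mul_right hSP).sub_right (hSP.mul_right hSD)
  refine Commute.smul_right ?_ _
  rw [commute_iff_eq, ← hC.mul_circleIntegral_sandwich hA hμ _ _ hS, hK.eq,
    hC.circleIntegral_sandwich_mul hA hμ _ _ hS]

/-- The commutator [D, P] is again off-diagonal, and P commutes with every resolvent, so it passes
through the contour integral on either side. -/
lemma EnclosesBelow.invLiouvillian_eq_add {D : F →L[ℂ] F}
    (hD : D = specProj A μ * D + D * specProj A μ) :
    invLiouvillian A μ c r D =
      specProj A μ * invLiouvillian A μ c r D + invLiouvillian A μ c r D * specProj A μ := by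
  set P := specProj A μ with hP
  have hPP : P * P = P := hC.specProj_mul_self hA hμ
  have hPR : ∀ z ∈ resolventSet A, Commute P (resolvent A z) := fun z hz =>
    commute_specProj_resolvent hμ hz
  have hPDP : P * D * P = 0 := mul_mul_eq_zero_of_offDiagonal hPP hD
  have hK : D * P - P * D = P * (D * P - P * D) + (D * P - P * D) * P := by
    rw [mul_sub, sub_mul, ← mul_assoc, ← mul_assoc, hPP, mul_assoc D P P, hPP, hPDP]
    abel
  simp only [invLiouvillian]
  rw [mul_smul_comm, smul_mul_assoc, ← smul_add, ← hC.mul_circleIntegral_sandwich hA hμ _ _ hPR,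
    ← hC.circleIntegral_sandwich_mul hA hμ _ _ hPR,
    ← circleIntegral.integral_add (hC.circleIntegrable_sandwich hA hμ _)
      (hC.circleIntegrable_sandwich hA hμ _)]
  congr 2
  funext z
  rw [← add_mul, ← mul_add, ← hK]

/-- `[A, 𝓘(D)] = D` for off-diagonal `D`. -/
lemma EnclosesBelow.commutator_invLiouvillian {D : F →L[ℂ] F}
    (hD : D = specProj A μ * D + D * specProj A μ) :
    ∃ h : ∀ ψ, invLiouvillian A μ c r D ψ ∈ A.domain,
      ∀ φ : A.domain, A ⟨_, h φ⟩ - invLiouvillian A μ c r D (A φ) = D φ := by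
  set P := specProj A μ with hP
  have hPP : P * P = P := hC.specProj_mul_self hA hμ
  set K := D * P - P * D with hKdef
  set R := resolvent A μ with hR
  have hRμ := isResolventAt_resolvent hμ
  have hc := hC.continuousOn_sphere hA hμ
  have hsph := hC.sphere_subset hA hμ
  set κ : ℂ := Complex.I / (2 * (Real.pi : ℂ)) with hκ
  -- Factoring R = (A - μ)⁻¹ out of the left or right resolvent gives 𝓘(D) = R (κ Y) = (κ Z) R. So κ
  -- Y and κ Z are the bounded versions of (A - μ) 𝓘(D) and 𝓘(D) (A - μ).
  set Y : F →L[ℂ] F :=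
    ∮ z in C(c, r), (1 + (z - μ) • resolvent A z) * K * resolvent A z with hY
  set Z : F →L[ℂ] F :=
    ∮ z in C(c, r), resolvent A z * K * (1 + (z - μ) • resolvent A z) with hZ
  have hYi : CircleIntegrable (fun z => (1 + (z - μ) • resolvent A z) * K * resolvent A z) c r :=
    ContinuousOn.circleIntegrable hC.1.le (by fun_prop)
  have hZi : CircleIntegrable (fun z => resolvent A z * K * (1 + (z - μ) • resolvent A z)) c r :=
    ContinuousOn.circleIntegrable hC.1.le (by fun_prop)
  have hRi : CircleIntegrable (fun z => resolvent A z) c r :=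
    ContinuousOn.circleIntegrable hC.1.le hc
  have hInvY : invLiouvillian A μ c r D = R * (κ • Y) := by
    rw [mul_smul_comm]
    refine congrArg (κ • ·) ?_
    have h := circleIntegral_clm (ContinuousLinearMap.mul ℂ (F →L[ℂ] F) R) hYi
    simp only [ContinuousLinearMap.mul_apply'] at h
    rw [hY, ← h]
    refine circleIntegral.integral_congr hC.1.le fun z hz => ?_
    simp only [← mul_assoc]
    rw [← resolvent_eq_mul' (hsph hz) hμ]
  have hInvZ : invLiouvillian A μ c r D = (κ • Z) * R := by
    rw [smul_mul_assoc]
    refine congrArg (κ • ·) ?_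
    have h := circleIntegral_clm ((ContinuousLinearMap.mul ℂ (F →L[ℂ] F)).flip R) hZi
    simp only [ContinuousLinearMap.mul_apply', ContinuousLinearMap.flip_apply] at h
    rw [hZ, ← h]
    refine circleIntegral.integral_congr hC.1.le fun z hz => ?_
    simp only [mul_assoc]
    rw [← resolvent_eq_mul (hsph hz) hμ]
  have hYZ : κ • Y - κ • Z = D := by
    have h1 := circleIntegral_clm (ContinuousLinearMap.mul ℂ (F →L[ℂ] F) K) hRi
    have h2 := circleIntegral_clm ((ContinuousLinearMap.mul ℂ (F →L[ℂ] F)).flip K) hRi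
    simp only [ContinuousLinearMap.mul_apply', ContinuousLinearMap.flip_apply] at h1 h2
    have hKi : CircleIntegrable (fun z => K * resolvent A z) c r :=
      ContinuousOn.circleIntegrable hC.1.le (by fun_prop)
    have hKi' : CircleIntegrable (fun z => resolvent A z * K) c r :=
      ContinuousOn.circleIntegrable hC.1.le (by fun_prop)
    -- The terms with two resolvents around K cancel, leaving the commutator of K with the contour
    -- integral of the resolvent.
    have h3 : Y - Z = K * (∮ z in C(c, r), resolvent A z) - (∮ z in C(c, r), resolvent A z) * K := by
      rw [hY, hZ, ← circleIntegral.integral_sub hYi hZi, ← h1, ← h2,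
        ← circleIntegral.integral_sub hKi hKi']
      refine circleIntegral.integral_congr hC.1.le fun z hz => ?_
      simp only [add_mul, mul_add, one_mul, mul_one, smul_mul_assoc, mul_smul_comm, mul_assoc]
      abel
    have hκ' : κ * -(2 * Real.pi * Complex.I) = 1 := by
      rw [hκ]
      have : (Real.pi : ℂ) ≠ 0 := by exact_mod_cast Real.pi_ne_zero
      field_simp
      simp
    -- The factor κ is normalized so that Riesz' formula leaves K P - P K = [[D, P], P], which
    -- equals P D + D P - 2 P D P = D.
    rw [← smul_sub, h3, circleIntegral_resolvent hC hA hμ, mul_smul_comm, smul_mul_assoc, ← smul_sub,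
      smul_smul, hκ', one_smul, ← hP, hKdef, sub_mul, mul_sub, ← mul_assoc, ← mul_assoc, hPP,
      mul_assoc D P P, hPP, mul_mul_eq_zero_of_offDiagonal hPP hD]
    conv_rhs => rw [hD]
    abel
  have hdom : ∀ ψ, invLiouvillian A μ c r D ψ ∈ A.domain := fun ψ => by
    rw [hInvY]
    exact hRμ.mem_domain _
  refine ⟨hdom, fun φ => ?_⟩
  have h1 : A ⟨_, hdom φ⟩ = (κ • Y) φ + (μ : ℂ) • invLiouvillian A μ c r D φ := by
    have : (⟨_, hdom φ⟩ : A.domain) = ⟨R ((κ • Y) φ), hRμ.mem_domain _⟩ := by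
      apply Subtype.ext
      change _ = (R * (κ • Y)) (φ : F)
      rw [← hInvY]
    rw [this, hRμ.apply]
    congr 2
    rw [hInvY]
    rfl
  have h2 : invLiouvillian A μ c r D (A φ) =
      (κ • Z) φ + (μ : ℂ) • invLiouvillian A μ c r D φ := by
    have h3 := hRμ.2 φ
    have h4 : invLiouvillian A μ c r D (A φ - (μ : ℂ) • (φ : F)) = (κ • Z) φ := by
      conv_rhs => rw [← h3]
      rw [hInvZ]
      rfl
    rw [map_sub, map_smul, sub_eq_iff_eq_add] at h4
    exact h4
  rw [h1, h2, add_sub_add_right_eq_sub, ← hYZ]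
  rfl

end Liouville

end SelfAdjoint


/-! ## Multiplication operators and their algebra -/

section Multiplication

variable {d N : ℕ} (ν : Measure (Space d))

lemma coeFn_mulOp (f : Space d → ℂ) (hf : Measurable f) (hb : ∀ x, ‖f x‖ ≤ 1)
    (ψ : Lp (Internal N) 2 ν) : mulOp ν f hf hb ψ =ᵐ[ν] fun x => f x • ψ x :=
  (memLp_mul ν f hf hb ψ).coeFn_toLp

lemma coeFn_chi {Ω : Set (Space d)} (hΩ : MeasurableSet Ω) (ψ : Lp (Internal N) 2 ν) :
    chi ν Ω hΩ ψ =ᵐ[ν] Ω.indicator ψ := by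
  filter_upwards [coeFn_mulOp ν _ _ _ ψ] with x hx
  rw [chi, hx]
  by_cases h : x ∈ Ω <;> simp [h]

lemma isSelfAdjoint_chi {Ω : Set (Space d)} (hΩ : MeasurableSet Ω) :
    IsSelfAdjoint (chi (N := N) ν Ω hΩ) := by
  rw [ContinuousLinearMap.isSelfAdjoint_iff_isSymmetric]
  intro ψ φ
  simp only [ContinuousLinearMap.coe_coe, L2.inner_def]
  refine integral_congr_ae ?_
  filter_upwards [coeFn_chi ν hΩ ψ, coeFn_chi ν hΩ φ] with x h1 h2
  rw [h1, h2]
  by_cases h : x ∈ Ω <;> simp [h]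

end Multiplication

namespace Crystal

variable {d N : ℕ} (c : Crystal d N)

/-! ## The lattice and its fundamental cell -/

lemma measurableSet_X : MeasurableSet c.X := by
  rcases c.kind with ⟨hX, -⟩ | ⟨hfin, -⟩
  · rw [hX]
    exact MeasurableSet.univ
  · have : c.X = ⋃ n : ℕ, c.X ∩ Metric.closedBall 0 n := by
      rw [← Set.inter_iUnion, Metric.iUnion_closedBall_nat, Set.inter_univ]
    rw [this]
    exact MeasurableSet.iUnion fun n => (hfin _ (isCompact_closedBall _ _)).measurableSet

lemma ae_mem_X : ∀ᵐ x ∂c.ν, x ∈ c.X := by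
  rcases c.kind with ⟨hX, -⟩ | ⟨-, hν⟩
  · exact Eventually.of_forall fun x => by rw [hX]; trivial
  · rw [hν]
    exact ae_restrict_mem c.measurableSet_X

lemma measure_lt_top_of_isBounded {s : Set (Space d)} (hs : Bornology.IsBounded s) :
    c.ν s < ⊤ := by
  obtain ⟨K, hK⟩ := hs.subset_closedBall 0
  refine (measure_mono hK).trans_lt ?_
  rcases c.kind with ⟨-, hν⟩ | ⟨hfin, hν⟩
  · rw [hν]
    exact (isCompact_closedBall _ _).measure_lt_top
  · rw [hν, Measure.restrict_apply Metric.isClosed_closedBall.measurableSet, inter_comm,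
      Measure.count_apply_lt_top]
    exact hfin _ (isCompact_closedBall _ _)

instance : IsLocallyFiniteMeasure c.ν :=
  ⟨fun x => ⟨Metric.ball x 1, Metric.ball_mem_nhds x one_pos,
    c.measure_lt_top_of_isBounded Metric.isBounded_ball⟩⟩

instance : Countable c.Γ := by
  have : Countable (Submodule.span ℤ (Set.range c.a)) :=
    (c.a.restrictScalars ℤ).equivFun.toEquiv.countable_iff.2 inferInstance
  exact this

/-- Lattice points by their integer coordinates. -/
noncomputable def lattice : (Fin d → ℤ) ≃ₗ[ℤ] c.Γ := (c.a.restrictScalars ℤ).equivFun.symm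

lemma coe_lattice (n : Fin d → ℤ) : (c.lattice n : Space d) = ∑ j, n j • c.a j := by
  rw [lattice, Module.Basis.equivFun_symm_apply, Submodule.coe_sum]
  refine Finset.sum_congr rfl fun j _ => ?_
  rw [Submodule.coe_smul, Module.Basis.restrictScalars_apply]

lemma repr_lattice (n : Fin d → ℤ) (j : Fin d) : c.a.repr (c.lattice n) j = n j := by
  have h : (c.lattice n : Space d) = ∑ j, (n j : ℝ) • c.a j := by
    rw [coe_lattice]
    exact Finset.sum_congr rfl fun j _ => (Int.cast_smul_eq_zsmul ℝ _ _).symm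
  rw [h, c.a.repr_sum_self]

lemma exists_lattice (γ : c.Γ) : ∃ n, c.lattice n = γ := c.lattice.surjective γ

/-- The lattice translate of the fundamental cell in which a point lies. -/
noncomputable def cellIndex (x : Space d) : c.Γ :=
  c.lattice fun j => ⌊c.a.repr x j + 1 / 2⌋

/-- The cell is half-open, [-1/2, 1/2) in each coordinate, so rounding by the floor of α + 1/2
selects a unique translate, including for points on the faces. -/
lemma sub_lattice_mem_fundCell_iff (x : Space d) (n : Fin d → ℤ) :
    x - (c.lattice n : Space d) ∈ c.fundCell ↔ ∀ j, n j = ⌊c.a.repr x j + 1 / 2⌋ := by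
  simp only [fundCell, mem_ofPred_eq, map_sub, Finsupp.sub_apply, repr_lattice]
  refine forall_congr' fun j => ?_
  rw [eq_comm, Int.floor_eq_iff, mem_Ico]
  constructor <;> rintro ⟨h1, h2⟩ <;> constructor <;> linarith

lemma sub_mem_fundCell_iff (x : Space d) (γ : c.Γ) :
    x - (γ : Space d) ∈ c.fundCell ↔ γ = c.cellIndex x := by
  obtain ⟨n, rfl⟩ := c.exists_lattice γ
  rw [sub_lattice_mem_fundCell_iff, cellIndex, c.lattice.injective.eq_iff, funext_iff]

lemma measurableSet_fundCell : MeasurableSet c.fundCell := by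
  have : c.fundCell = ⋂ j, {x | c.a.repr x j ∈ Set.Ico (-(1 / 2) : ℝ) (1 / 2)} := by
    ext x; simp [fundCell]
  rw [this]
  refine MeasurableSet.iInter fun j => ?_
  have hc : Continuous fun x => c.a.repr x j := (c.a.coord j).continuous_of_finiteDimensional
  exact measurableSet_Ico.preimage hc.measurable

lemma isBounded_cell (L : ℕ) : Bornology.IsBounded (c.cell L) := by
  rw [isBounded_iff_forall_norm_le]
  refine ⟨∑ j, (L : ℝ) / 2 * ‖c.a j‖, fun x hx => ?_⟩
  conv_lhs => rw [← c.a.sum_repr x]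
  refine (norm_sum_le _ _).trans (Finset.sum_le_sum fun j _ => ?_)
  rw [norm_smul]
  gcongr
  exact hx j

lemma fundCell_subset_cell : c.fundCell ⊆ c.cell 1 := fun x hx j => by
  have := hx j
  rw [mem_Ico] at this
  rw [abs_le]
  constructor <;> push_cast <;> linarith [this.1, this.2]

lemma isBounded_fundCell : Bornology.IsBounded c.fundCell :=
  (c.isBounded_cell 1).subset c.fundCell_subset_cell

lemma ae_sub {p : Space d → Prop} (h : ∀ᵐ x ∂c.ν, p x) (γ : c.Γ) :
    ∀ᵐ x ∂c.ν, p (x - (γ : Space d)) :=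
  (c.measurePreserving_sub γ).quasiMeasurePreserving.ae h

/-- A property holds almost everywhere if it does so on all translates of the fundamental cell. -/
lemma ae_of_forall_cell {p : Space d → Prop}
    (h : ∀ γ : c.Γ, ∀ᵐ y ∂c.ν.restrict c.fundCell, p (y - (γ : Space d))) : ∀ᵐ x ∂c.ν, p x := by
  have h1 : ∀ γ : c.Γ, ∀ᵐ x ∂c.ν, x + (γ : Space d) ∈ c.fundCell → p x := fun γ => by
    have h2 := (ae_restrict_iff' c.measurableSet_fundCell).1 (h γ)
    filter_upwards [c.ae_sub h2 (-γ)] with x hx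
    simpa using hx
  rw [← ae_all_iff] at h1
  filter_upwards [h1] with x hx
  refine hx (-c.cellIndex x) ?_
  have := (c.sub_mem_fundCell_iff x (c.cellIndex x)).2 rfl
  simpa [sub_eq_add_neg] using this

/-! ## Magnetic translations -/

lemma coeFn_T (γ : c.Γ) (ψ : c.H) :
    c.T γ ψ =ᵐ[c.ν] fun x => c.M γ x (ψ (x - (γ : Space d))) :=
  (c.memLp_transl γ ψ).coeFn_toLp

lemma T_add (γ : c.Γ) (ψ φ : c.H) : c.T γ (ψ + φ) = c.T γ ψ + c.T γ φ := by
  refine Lp.ext ?_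
  filter_upwards [c.coeFn_T γ (ψ + φ), c.coeFn_T γ ψ, c.coeFn_T γ φ,
    Lp.coeFn_add (c.T γ ψ) (c.T γ φ), c.ae_sub (Lp.coeFn_add ψ φ) γ] with x h1 h2 h3 h4 h5
  rw [h1, h4, Pi.add_apply, h2, h3, h5, Pi.add_apply, map_add]

lemma T_smul (γ : c.Γ) (a : ℂ) (ψ : c.H) : c.T γ (a • ψ) = a • c.T γ ψ := by
  refine Lp.ext ?_
  filter_upwards [c.coeFn_T γ (a • ψ), c.coeFn_T γ ψ, Lp.coeFn_smul a (c.T γ ψ),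
    c.ae_sub (Lp.coeFn_smul a ψ) γ] with x h1 h2 h3 h4
  rw [h1, h3, Pi.smul_apply, h2, h4, Pi.smul_apply, map_smul]

lemma norm_T (γ : c.Γ) (ψ : c.H) : ‖c.T γ ψ‖ = ‖ψ‖ := by
  rw [Lp.norm_def, Lp.norm_def, eLpNorm_congr_norm_ae (g := fun x => ψ (x - (γ : Space d)))]
  · exact congrArg ENNReal.toReal (eLpNorm_comp_measurePreserving
      (Lp.aestronglyMeasurable ψ) (c.measurePreserving_sub γ))
  · filter_upwards [c.coeFn_T γ ψ] with x hx
    rw [hx, LinearIsometryEquiv.norm_map]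

lemma T_T (γ₁ γ₂ : c.Γ) (ψ : c.H) : c.T γ₂ (c.T γ₁ ψ) = c.T (γ₁ + γ₂) ψ := by
  refine Lp.ext ?_
  filter_upwards [c.coeFn_T γ₂ (c.T γ₁ ψ), c.ae_sub (c.coeFn_T γ₁ ψ) γ₂, c.coeFn_T (γ₁ + γ₂) ψ,
    c.ae_mem_X] with x h1 h2 h3 hx
  have h4 : x - (γ₂ : Space d) - (γ₁ : Space d) = x - ((γ₁ + γ₂ : c.Γ) : Space d) := by
    rw [Submodule.coe_add, sub_sub, add_comm]
  rw [h1, h2, h3, c.cocycle γ₁ γ₂ x hx, h4]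

lemma M_zero {x : Space d} (hx : x ∈ c.X) (v : Internal N) : c.M 0 x v = v := by
  have h := c.cocycle 0 0 x hx v
  simp only [add_zero, Submodule.coe_zero, sub_zero] at h
  exact ((c.M 0 x).injective h).symm

lemma T_zero (ψ : c.H) : c.T 0 ψ = ψ := by
  refine Lp.ext ?_
  filter_upwards [c.coeFn_T 0 ψ, c.ae_mem_X] with x h1 hx
  rw [h1, c.M_zero hx]
  simp

/-- The translations as bounded operators. -/
noncomputable def TL (γ : c.Γ) : c.H →L[ℂ] c.H :=
  LinearIsometry.toContinuousLinearMap
    { toFun := c.T γ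
      map_add' := c.T_add γ
      map_smul' := c.T_smul γ
      norm_map' := c.norm_T γ }

@[simp] lemma TL_apply (γ : c.Γ) (ψ : c.H) : c.TL γ ψ = c.T γ ψ := rfl

lemma inner_T_T (γ : c.Γ) (ψ φ : c.H) : ⟪c.T γ ψ, c.T γ φ⟫_ℂ = ⟪ψ, φ⟫_ℂ :=
  LinearIsometry.inner_map_map
    ({ toFun := c.T γ
       map_add' := c.T_add γ
       map_smul' := c.T_smul γ
       norm_map' := c.norm_T γ } : c.H →ₗᵢ[ℂ] c.H) ψ φ

lemma adjoint_TL (γ : c.Γ) : (c.TL γ).adjoint = c.TL (-γ) := by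
  symm
  rw [ContinuousLinearMap.eq_adjoint_iff]
  intro ψ φ
  rw [TL_apply, TL_apply, ← c.inner_T_T γ, c.T_T, neg_add_cancel, c.T_zero]

lemma T_chi (γ : c.Γ) {Ω Ω' : Set (Space d)} (hΩ : MeasurableSet Ω) (hΩ' : MeasurableSet Ω')
    (h : ∀ x, x ∈ Ω' ↔ x - (γ : Space d) ∈ Ω) : c.TL γ * chi c.ν Ω hΩ = chi c.ν Ω' hΩ' * c.TL γ := by
  ext1 ψ
  refine Lp.ext ?_
  simp only [mul_apply_eq_comp, TL_apply]
  filter_upwards [c.coeFn_T γ (chi c.ν Ω hΩ ψ), coeFn_chi c.ν hΩ' (c.T γ ψ), c.coeFn_T γ ψ,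
    c.ae_sub (coeFn_chi c.ν hΩ ψ) γ] with x h1 h2 h3 h4
  rw [h1, h2, h4]
  by_cases hx : x ∈ Ω'
  · rw [indicator_of_mem hx, indicator_of_mem ((h x).1 hx), h3]
  · rw [indicator_of_notMem hx, indicator_of_notMem (fun h' => hx ((h x).2 h')), map_zero]

/-! ## Decomposition into cells -/

lemma coeFn_restrictCell (ψ : c.H) : c.restrictCell ψ =ᵐ[c.ν.restrict c.fundCell] ψ :=
  MemLp.coeFn_toLp _

lemma memLp_indicator (v : c.Hf) : MemLp (c.fundCell.indicator v) 2 c.ν :=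
  (memLp_indicator_iff_restrict c.measurableSet_fundCell).2 (Lp.memLp v)

/-- Extension by zero from the fundamental cell. -/
noncomputable def zeroExtension (v : c.Hf) : c.H := (c.memLp_indicator v).toLp

lemma coeFn_zeroExtension (v : c.Hf) : c.zeroExtension v =ᵐ[c.ν] c.fundCell.indicator v :=
  (c.memLp_indicator v).coeFn_toLp

lemma zeroExtension_add (v w : c.Hf) :
    c.zeroExtension (v + w) = c.zeroExtension v + c.zeroExtension w := by
  refine Lp.ext ?_
  filter_upwards [(ae_restrict_iff' c.measurableSet_fundCell).1 (Lp.coeFn_add v w),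
    c.coeFn_zeroExtension (v + w), c.coeFn_zeroExtension v, c.coeFn_zeroExtension w,
    Lp.coeFn_add (c.zeroExtension v) (c.zeroExtension w)] with x hx h1 h2 h3 h4
  rw [h1, h4, Pi.add_apply, h2, h3]
  by_cases h : x ∈ c.fundCell
  · simp only [indicator_of_mem h]
    exact hx h
  · simp [h]

lemma zeroExtension_smul (a : ℂ) (v : c.Hf) :
    c.zeroExtension (a • v) = a • c.zeroExtension v := by
  refine Lp.ext ?_
  filter_upwards [(ae_restrict_iff' c.measurableSet_fundCell).1 (Lp.coeFn_smul a v),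
    c.coeFn_zeroExtension (a • v), c.coeFn_zeroExtension v,
    Lp.coeFn_smul a (c.zeroExtension v)] with x hx h1 h2 h3
  rw [h1, h3, Pi.smul_apply, h2]
  by_cases h : x ∈ c.fundCell
  · simp only [indicator_of_mem h]
    exact hx h
  · simp [h]

lemma norm_zeroExtension (v : c.Hf) : ‖c.zeroExtension v‖ = ‖v‖ := by
  rw [zeroExtension, Lp.norm_toLp, eLpNorm_indicator_eq_eLpNorm_restrict c.measurableSet_fundCell,
    Lp.norm_def]

/-- Extension by zero from the fundamental cell, as an isometry. -/
noncomputable def extend : c.Hf →ₗᵢ[ℂ] c.H where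
  toFun := c.zeroExtension
  map_add' := c.zeroExtension_add
  map_smul' := c.zeroExtension_smul
  norm_map' := c.norm_zeroExtension

lemma coeFn_extend (v : c.Hf) : c.extend v =ᵐ[c.ν] c.fundCell.indicator v :=
  c.coeFn_zeroExtension v

lemma inner_extend (v : c.Hf) (ψ : c.H) : ⟪c.extend v, ψ⟫_ℂ = ⟪v, c.restrictCell ψ⟫_ℂ := by
  rw [L2.inner_def, L2.inner_def, ← integral_indicator c.measurableSet_fundCell]
  refine integral_congr_ae ?_
  filter_upwards [c.coeFn_extend v, (ae_restrict_iff' c.measurableSet_fundCell).1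
    (c.coeFn_restrictCell ψ)] with x h1 h2
  rw [h1]
  by_cases h : x ∈ c.fundCell
  · simp [h, h2 h]
  · simp [h]

/-- The embedding of `𝓗_f` as the functions supported in the cell `-γ + F`. -/
noncomputable def cellEmb (γ : c.Γ) : c.Hf →ₗᵢ[ℂ] c.H :=
  ({ toFun := c.T (-γ)
     map_add' := c.T_add (-γ)
     map_smul' := c.T_smul (-γ)
     norm_map' := c.norm_T (-γ) } : c.H →ₗᵢ[ℂ] c.H).comp c.extend

lemma cellEmb_apply (γ : c.Γ) (v : c.Hf) : c.cellEmb γ v = c.T (-γ) (c.extend v) := rfl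

/-- The component of a vector in the cell `-γ + F`. -/
noncomputable def cellCoeff (γ : c.Γ) : c.H →L[ℂ] c.Hf :=
  (c.cellEmb γ).toContinuousLinearMap.adjoint

/-- The sign in `cellEmb` is chosen so that the component of ψ in a cell is the restriction of T_γ
ψ, the quantity that enters `IsBFZ`. The cocycle M is thereby absorbed into the translations. -/
lemma cellCoeff_apply (γ : c.Γ) (ψ : c.H) : c.cellCoeff γ ψ = c.restrictCell (c.T γ ψ) := by
  refine ext_inner_left ℂ fun v => ?_
  rw [cellCoeff, ContinuousLinearMap.adjoint_inner_right, LinearIsometry.coe_toContinuousLinearMap,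
    cellEmb_apply, ← inner_extend, ← c.inner_T_T γ, c.T_T, neg_add_cancel, c.T_zero]

lemma coeFn_cellCoeff (γ : c.Γ) (ψ : c.H) :
    c.cellCoeff γ ψ =ᵐ[c.ν.restrict c.fundCell] fun y => c.M γ y (ψ (y - (γ : Space d))) := by
  rw [cellCoeff_apply]
  exact (c.coeFn_restrictCell _).trans (ae_restrict_of_ae (c.coeFn_T γ ψ))

lemma cellCoeff_cellEmb_self (γ : c.Γ) (v : c.Hf) : c.cellCoeff γ (c.cellEmb γ v) = v := by
  refine ext_inner_left ℂ fun w => ?_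
  rw [cellCoeff, ContinuousLinearMap.adjoint_inner_right, LinearIsometry.coe_toContinuousLinearMap,
    LinearIsometry.inner_map_map]

lemma cellCoeff_cellEmb_of_ne {γ γ' : c.Γ} (h : γ ≠ γ') (v : c.Hf) :
    c.cellCoeff γ (c.cellEmb γ' v) = 0 := by
  rw [cellCoeff_apply, cellEmb_apply, c.T_T]
  refine Lp.ext ?_
  have h1 := ae_restrict_of_ae (s := c.fundCell) (c.coeFn_T (-γ' + γ) (c.extend v))
  have h2 := ae_restrict_of_ae (s := c.fundCell) (c.ae_sub (c.coeFn_extend v) (-γ' + γ))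
  filter_upwards [c.coeFn_restrictCell (c.T (-γ' + γ) (c.extend v)), h1, h2,
    Lp.coeFn_zero (Internal N) 2 (c.ν.restrict c.fundCell),
    ae_restrict_mem c.measurableSet_fundCell] with x h3 h4 h5 h6 hx
  rw [h3, h4, h5, h6, indicator_of_notMem, map_zero, Pi.zero_apply]
  rw [sub_mem_fundCell_iff]
  have h0 : (0 : c.Γ) = c.cellIndex x := (c.sub_mem_fundCell_iff x 0).1 (by simpa using hx)
  rw [← h0]
  intro h7
  exact h (by rwa [neg_add_eq_zero, eq_comm] at h7)

lemma ext_cellCoeff {ψ φ : c.H} (h : ∀ γ, c.cellCoeff γ ψ = c.cellCoeff γ φ) : ψ = φ := by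
  refine Lp.ext (c.ae_of_forall_cell fun γ => ?_)
  filter_upwards [c.coeFn_cellCoeff γ ψ, c.coeFn_cellCoeff γ φ] with y h1 h2
  rw [h γ, h2] at h1
  exact ((c.M γ y).injective h1).symm

/-- Distinct translates of the cell are disjoint, which gives orthogonality. A vector orthogonal to
all summands has zero component in every cell, hence vanishes. -/
lemma isHilbertSum_cellEmb : IsHilbertSum ℂ (fun _ : c.Γ => c.Hf) c.cellEmb := by
  refine IsHilbertSum.mk ?_ ?_
  · intro γ γ' h v w
    have := c.cellCoeff_cellEmb_of_ne h w
    rw [← LinearIsometry.coe_toContinuousLinearMap, ← ContinuousLinearMap.adjoint_inner_right,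
      ← cellCoeff, this, inner_zero_right]
  · rw [top_le_iff, Submodule.topologicalClosure_eq_top_iff, eq_bot_iff]
    intro ψ hψ
    rw [Submodule.mem_bot]
    refine c.ext_cellCoeff fun γ => ?_
    rw [map_zero]
    refine ext_inner_left ℂ fun v => ?_
    rw [inner_zero_right, cellCoeff, ContinuousLinearMap.adjoint_inner_right]
    exact hψ _ (Submodule.mem_iSup_of_mem γ ⟨v, rfl⟩)

lemma linearIsometryEquiv_apply (ψ : c.H) (γ : c.Γ) :
    c.isHilbertSum_cellEmb.linearIsometryEquiv ψ γ = c.cellCoeff γ ψ := by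
  have h := (c.isHilbertSum_cellEmb.hasSum_linearIsometryEquiv_symm
    (c.isHilbertSum_cellEmb.linearIsometryEquiv ψ)).mapL (c.cellCoeff γ)
  rw [LinearIsometryEquiv.symm_apply_apply] at h
  have h2 := hasSum_single (f := fun γ' => c.cellCoeff γ
    (c.cellEmb γ' (c.isHilbertSum_cellEmb.linearIsometryEquiv ψ γ'))) γ
    fun γ' hγ' => c.cellCoeff_cellEmb_of_ne hγ'.symm _
  rw [cellCoeff_cellEmb_self] at h2
  exact h2.unique h

lemma hasSum_cellEmb (ψ : c.H) : HasSum (fun γ => c.cellEmb γ (c.cellCoeff γ ψ)) ψ := by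
  have h := c.isHilbertSum_cellEmb.hasSum_linearIsometryEquiv_symm
    (c.isHilbertSum_cellEmb.linearIsometryEquiv ψ)
  simpa only [linearIsometryEquiv_apply, LinearIsometryEquiv.symm_apply_apply] using h

lemma hasSum_norm_cellCoeff_sq (ψ : c.H) :
    HasSum (fun γ => ‖c.cellCoeff γ ψ‖ ^ 2) (‖ψ‖ ^ 2) := by
  have h := lp.hasSum_norm (p := 2) (by norm_num) (c.isHilbertSum_cellEmb.linearIsometryEquiv ψ)
  simpa [linearIsometryEquiv_apply] using h

lemma exists_cellCoeff_eq {s : c.Γ → c.Hf} (hs : Summable fun γ => ‖s γ‖ ^ 2) :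
    ∃ ψ : c.H, ∀ γ, c.cellCoeff γ ψ = s γ := by
  have hm : Memℓp s 2 := memℓp_gen (by simpa using hs)
  refine ⟨c.isHilbertSum_cellEmb.linearIsometryEquiv.symm ⟨s, hm⟩, fun γ => ?_⟩
  rw [← linearIsometryEquiv_apply, LinearIsometryEquiv.apply_symm_apply]

end Crystal


/-! ## Plane waves -/

section BoundedMultiplication

variable {d N : ℕ} (ν : Measure (Space d))

lemma memLp_bddMul (f : Space d → ℂ) (hf : Measurable f) (C : ℝ) (hb : ∀ᵐ x ∂ν, ‖f x‖ ≤ C)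
    (ψ : Lp (Internal N) 2 ν) : MemLp (fun x => f x • ψ x) 2 ν := by
  refine (Lp.memLp ψ).of_le_mul (c := C)
    (hf.aestronglyMeasurable.smul (Lp.aestronglyMeasurable ψ)) ?_
  filter_upwards [hb] with x hx
  rw [norm_smul]
  gcongr

/-- Multiplication by an essentially bounded measurable function. -/
noncomputable def bddMul (f : Space d → ℂ) (hf : Measurable f) (C : ℝ) (hC : 0 ≤ C)
    (hb : ∀ᵐ x ∂ν, ‖f x‖ ≤ C) : Lp (Internal N) 2 ν →L[ℂ] Lp (Internal N) 2 ν :=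
  LinearMap.mkContinuous
    { toFun := fun ψ => (memLp_bddMul ν f hf C hb ψ).toLp
      map_add' := fun ψ φ => by
        rw [← MemLp.toLp_add]
        apply MemLp.toLp_congr
        filter_upwards [Lp.coeFn_add ψ φ] with x hx
        rw [hx]
        exact smul_add _ _ _
      map_smul' := fun c ψ => by
        rw [RingHom.id_apply, ← MemLp.toLp_const_smul]
        apply MemLp.toLp_congr
        filter_upwards [Lp.coeFn_smul c ψ] with x hx
        rw [hx]
        exact smul_comm (f x) c (ψ x) }
    C (fun ψ => by
      refine Lp.norm_le_mul_norm_of_ae_le_mul ?_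
      filter_upwards [(memLp_bddMul ν f hf C hb ψ).coeFn_toLp, hb] with x hx hx'
      simp only [LinearMap.coe_mk, AddHom.coe_mk]
      rw [hx, norm_smul]
      gcongr)

lemma coeFn_bddMul (f : Space d → ℂ) (hf : Measurable f) (C : ℝ) (hC : 0 ≤ C)
    (hb : ∀ᵐ x ∂ν, ‖f x‖ ≤ C) (ψ : Lp (Internal N) 2 ν) :
    bddMul ν f hf C hC hb ψ =ᵐ[ν] fun x => f x • ψ x :=
  (memLp_bddMul ν f hf C hb ψ).coeFn_toLp

lemma coeFn_planeWave (k : Space d) (ψ : Lp (Internal N) 2 ν) :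
    planeWave ν k ψ =ᵐ[ν] fun y => Complex.exp ((⟪k, y⟫_ℝ : ℂ) * Complex.I) • ψ y :=
  coeFn_mulOp ν _ _ _ ψ

lemma norm_planeWave_apply (k : Space d) (ψ : Lp (Internal N) 2 ν) : ‖planeWave ν k ψ‖ = ‖ψ‖ := by
  rw [Lp.norm_def, Lp.norm_def]
  congr 1
  refine eLpNorm_congr_norm_ae ?_
  filter_upwards [coeFn_planeWave ν k ψ] with x hx
  rw [hx, norm_smul, Complex.norm_exp_ofReal_mul_I, one_mul]

lemma planeWave_add (k l : Space d) :
    planeWave (N := N) ν (k + l) = planeWave ν k * planeWave ν l := by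
  ext1 ψ
  refine Lp.ext ?_
  rw [mul_apply_eq_comp]
  filter_upwards [coeFn_planeWave ν (k + l) ψ, coeFn_planeWave ν k (planeWave ν l ψ),
    coeFn_planeWave ν l ψ] with x h1 h2 h3
  rw [h1, h2, h3, smul_smul, ← Complex.exp_add, inner_add_left]
  push_cast
  rw [add_mul]

lemma planeWave_zero : planeWave (N := N) ν 0 = 1 := by
  ext1 ψ
  refine Lp.ext ?_
  filter_upwards [coeFn_planeWave ν 0 ψ] with x h1
  rw [h1]
  simp

variable {ν} {ρ : ℝ} (hρ : 0 ≤ ρ) (hb : ∀ᵐ x ∂ν, ‖x‖ ≤ ρ)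

/-- The position operators, on a bounded region. -/
noncomputable def bddPosition (j : Fin d) : Lp (Internal N) 2 ν →L[ℂ] Lp (Internal N) 2 ν :=
  bddMul ν (fun x => (x j : ℂ)) (by fun_prop) ρ hρ (by
    filter_upwards [hb] with x hx
    rw [Complex.norm_real]
    exact (PiLp.norm_apply_le x j).trans hx)

lemma coeFn_bddPosition (j : Fin d) (ψ : Lp (Internal N) 2 ν) :
    bddPosition hρ hb j ψ =ᵐ[ν] fun x => (x j : ℂ) • ψ x :=
  coeFn_bddMul ν _ _ _ _ _ ψ

/-- The generator `k ↦ i k·y` of the plane waves. -/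
noncomputable def waveGen : Space d →L[ℝ] (Lp (Internal N) 2 ν →L[ℂ] Lp (Internal N) 2 ν) :=
  ∑ j, (EuclideanSpace.proj (𝕜 := ℝ) j : Space d →L[ℝ] ℝ).smulRight
    (Complex.I • bddPosition (N := N) hρ hb j)

lemma waveGen_single (j : Fin d) : waveGen (N := N) hρ hb (EuclideanSpace.single j 1) =
    Complex.I • bddPosition hρ hb j := by
  rw [waveGen, sum_apply, Finset.sum_eq_single j]
  · simp
  · intro i _ hi
    simp [hi]
  · simp

lemma coeFn_waveGen (k : Space d) (ψ : Lp (Internal N) 2 ν) :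
    waveGen hρ hb k ψ =ᵐ[ν] fun y => ((⟪k, y⟫_ℝ : ℂ) * Complex.I) • ψ y := by
  have h0 : waveGen hρ hb k ψ = ∑ j, ((k j : ℂ) * Complex.I) • bddPosition hρ hb j ψ := by
    simp only [waveGen, sum_apply, ContinuousLinearMap.smulRight_apply]
    refine Finset.sum_congr rfl fun j _ => ?_
    rw [smul_apply, smul_apply, mul_smul]
    exact RCLike.real_smul_eq_coe_smul (K := ℂ) _ _
  rw [h0]
  have h1 : ∀ᵐ y ∂ν, ∀ j, bddPosition hρ hb j ψ y = (y j : ℂ) • ψ y :=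
    ae_all_iff.2 fun j => coeFn_bddPosition hρ hb j ψ
  have h2 : ∀ᵐ y ∂ν, ∀ j, (((k j : ℂ) * Complex.I) • bddPosition hρ hb j ψ :
      Lp (Internal N) 2 ν) y = ((k j : ℂ) * Complex.I) • bddPosition hρ hb j ψ y :=
    ae_all_iff.2 fun j => Lp.coeFn_smul _ _
  filter_upwards [Lp.coeFn_finsetSum Finset.univ
    fun j => ((k j : ℂ) * Complex.I) • bddPosition hρ hb j ψ, h1, h2] with y h3 h4 h5
  rw [h3, Finset.sum_apply]
  simp_rw [h5, h4, smul_smul]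
  rw [← Finset.sum_smul]
  congr 1
  rw [PiLp.inner_apply]
  push_cast
  rw [Finset.sum_mul]
  refine Finset.sum_congr rfl fun j _ => ?_
  simp
  ring

include hρ hb in
-- Second order Taylor bound for exp(i k·y), uniform in y because the region is bounded.
-- Differentiability thus holds in operator norm and not only strongly.
lemma norm_planeWave_sub_le (k : Space d) (hk : ‖k‖ * ρ ≤ 1) :
    ‖planeWave (N := N) ν k - 1 - waveGen hρ hb k‖ ≤ (‖k‖ * ρ) ^ 2 := by
  refine ContinuousLinearMap.opNorm_le_bound _ (by positivity) fun ψ => ?_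
  refine Lp.norm_le_mul_norm_of_ae_le_mul ?_
  simp only [sub_apply, one_apply_eq_self]
  filter_upwards [Lp.coeFn_sub (planeWave ν k ψ - ψ) (waveGen hρ hb k ψ),
    Lp.coeFn_sub (planeWave ν k ψ) ψ, coeFn_planeWave ν k ψ, coeFn_waveGen hρ hb k ψ, hb]
    with y h1 h2 h3 h4 h5
  have h6 : ‖((⟪k, y⟫_ℝ : ℂ) * Complex.I)‖ ≤ ‖k‖ * ρ := by
    rw [norm_mul, Complex.norm_I, mul_one, Complex.norm_real]
    exact (norm_inner_le_norm _ _).trans (by gcongr)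
  rw [h1, Pi.sub_apply, h2, Pi.sub_apply, h3, h4]
  have h7 : Complex.exp ((⟪k, y⟫_ℝ : ℂ) * Complex.I) • ψ y - ψ y - ((⟪k, y⟫_ℝ : ℂ) * Complex.I) • ψ y =
      (Complex.exp ((⟪k, y⟫_ℝ : ℂ) * Complex.I) - 1 - (⟪k, y⟫_ℝ : ℂ) * Complex.I) • ψ y := by
    rw [sub_smul, sub_smul, one_smul]
  rw [h7, norm_smul]
  gcongr
  refine (Complex.norm_exp_sub_one_sub_id_le (h6.trans hk)).trans ?_
  gcongr

/-- At k = 0 this is the Taylor bound. The group law of plane waves transports it to every other k.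
-/
lemma hasFDerivAt_planeWave (k : Space d) :
    HasFDerivAt (planeWave (N := N) ν)
      (((ContinuousLinearMap.mul ℝ (Lp (Internal N) 2 ν →L[ℂ] Lp (Internal N) 2 ν))
        (planeWave ν k)).comp (waveGen hρ hb)) k := by
  have h0 : HasFDerivAt (planeWave (N := N) ν) (waveGen hρ hb) 0 := by
    rw [hasFDerivAt_iff_isLittleO_nhds_zero]
    have : (fun h : Space d => planeWave (N := N) ν (0 + h) - planeWave ν 0 - waveGen hρ hb h)
        =O[𝓝 0] fun h => ‖h‖ ^ 2 := by
      refine Asymptotics.IsBigO.of_bound (ρ ^ 2) ?_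
      have hev : ∀ᶠ h : Space d in 𝓝 0, ‖h‖ * ρ < 1 := by
        have : Tendsto (fun h : Space d => ‖h‖ * ρ) (𝓝 0) (𝓝 (‖(0 : Space d)‖ * ρ)) :=
          Continuous.tendsto (by fun_prop) _
        rw [norm_zero, zero_mul] at this
        exact this.eventually_lt_const one_pos
      filter_upwards [hev] with h hh
      rw [zero_add, planeWave_zero, norm_pow, norm_norm, ← mul_pow, mul_comm ρ]
      exact norm_planeWave_sub_le hρ hb h hh.le
    exact this.trans_isLittleO (Asymptotics.isLittleO_norm_pow_id one_lt_two)
  have h1 : planeWave (N := N) ν = fun l => planeWave ν k * planeWave ν (l - k) := by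
    funext l
    rw [← planeWave_add, add_sub_cancel]
  rw [← sub_self k] at h0
  have h2 := ((ContinuousLinearMap.mul ℝ (Lp (Internal N) 2 ν →L[ℂ] Lp (Internal N) 2 ν))
    (planeWave ν k)).hasFDerivAt.comp k (HasFDerivAt.comp (f := fun l : Space d => l - k) k h0 ((hasFDerivAt_id k).sub_const k))
  rw [h1]
  convert! h2 using 1
  simp [planeWave_zero]

include hρ hb in
-- Bootstrapping: the derivative is the plane wave itself multiplied by the fixed generator, so each
-- order of smoothness yields the next.
lemma contDiff_planeWave : ContDiff ℝ ∞ (planeWave (N := N) ν) := by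
  rw [contDiff_infty]
  intro n
  induction n with
  | zero =>
    rw [Nat.cast_zero, contDiff_zero]
    exact continuous_iff_continuousAt.2 fun k => (hasFDerivAt_planeWave hρ hb k).continuousAt
  | succ n ih =>
    rw [Nat.cast_succ, contDiff_succ_iff_fderiv]
    refine ⟨fun k => (hasFDerivAt_planeWave hρ hb k).differentiableAt, by simp, ?_⟩
    have : fderiv ℝ (planeWave (N := N) ν) = fun k =>
        (((ContinuousLinearMap.mul ℝ (Lp (Internal N) 2 ν →L[ℂ] Lp (Internal N) 2 ν))
        (planeWave ν k)).comp (waveGen hρ hb)) :=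
      funext fun k => (hasFDerivAt_planeWave hρ hb k).fderiv
    rw [this]
    fun_prop

end BoundedMultiplication


namespace Crystal

variable {d N : ℕ} (c : Crystal d N)

/-! ## The dual lattice and the Brillouin zone -/

/-- The coordinates `k·aⱼ / 2π` in momentum space. -/
noncomputable def dualCoord : Space d ≃ₗ[ℝ] (Fin d → ℝ) :=
  LinearEquiv.ofBijective
    (LinearMap.pi fun j => (2 * Real.pi)⁻¹ • (innerₛₗ ℝ (c.a j) : Space d →ₗ[ℝ] ℝ)) (by
    have hinj : Function.Injective
        (LinearMap.pi fun j => (2 * Real.pi)⁻¹ • (innerₛₗ ℝ (c.a j) : Space d →ₗ[ℝ] ℝ)) := by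
      rw [← LinearMap.ker_eq_bot, LinearMap.ker_eq_bot']
      intro k hk
      refine ext_inner_left ℝ fun v => ?_
      rw [inner_zero_right, ← c.a.sum_repr v, sum_inner]
      refine Finset.sum_eq_zero fun j _ => ?_
      rw [inner_smul_left]
      have := congrFun hk j
      simp only [LinearMap.pi_apply, LinearMap.smul_apply, innerₛₗ_apply_apply, Pi.zero_apply,
        smul_eq_mul, mul_eq_zero, inv_eq_zero, Real.pi_ne_zero, OfNat.ofNat_ne_zero, or_self,
        false_or] at this
      rw [this, mul_zero]
    exact ⟨hinj, (LinearMap.injective_iff_surjective_of_finrank_eq_finrank (by simp)).1 hinj⟩)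

lemma dualCoord_apply (k : Space d) (j : Fin d) :
    c.dualCoord k j = (2 * Real.pi)⁻¹ * ⟪k, c.a j⟫_ℝ := by
  rw [real_inner_comm]
  rfl

lemma inner_eq_dualCoord (k : Space d) (n : Fin d → ℤ) :
    ⟪k, (c.lattice n : Space d)⟫_ℝ = 2 * Real.pi * ∑ j, (n j : ℝ) * c.dualCoord k j := by
  rw [coe_lattice, inner_sum, Finset.mul_sum]
  refine Finset.sum_congr rfl fun j _ => ?_
  rw [dualCoord_apply, ← Int.cast_smul_eq_zsmul ℝ, inner_smul_right]
  have := Real.pi_ne_zero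
  field_simp

/-- The dual basis. -/
noncomputable def dualBasis : Module.Basis (Fin d) ℝ (Space d) := Module.Basis.ofEquivFun c.dualCoord

lemma dualBasis_repr (k : Space d) (j : Fin d) : c.dualBasis.repr k j = c.dualCoord k j := rfl

lemma brillouin_eq : c.brillouin = ZSpan.fundamentalDomain c.dualBasis := by
  ext k
  rw [ZSpan.mem_fundamentalDomain]
  refine forall_congr' fun j => ?_
  have hpi := Real.two_pi_pos
  rw [dualBasis_repr, dualCoord_apply, mem_Ico, mem_Ico, inv_mul_eq_div, le_div_iff₀ hpi,
    div_lt_iff₀ hpi, zero_mul, one_mul]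

lemma mem_dual_iff (g : Space d) : g ∈ c.dual ↔ ∀ j, ∃ n : ℤ, c.dualCoord g j = n := by
  have hpi := Real.two_pi_pos.ne'
  constructor
  · intro h j
    obtain ⟨n, hn⟩ := h (c.lattice (Pi.single j 1))
    refine ⟨n, ?_⟩
    rw [inner_eq_dualCoord] at hn
    rw [← mul_left_cancel₀ hpi hn, Finset.sum_eq_single j]
    · simp
    · intro i _ hi
      simp [hi]
    · simp
  · intro h γ
    choose n hn using h
    obtain ⟨m, rfl⟩ := c.exists_lattice γ
    refine ⟨∑ j, m j * n j, ?_⟩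
    rw [inner_eq_dualCoord]
    simp [hn]

lemma mem_dual_iff_mem_span (g : Space d) :
    g ∈ c.dual ↔ g ∈ Submodule.span ℤ (Set.range c.dualBasis) := by
  rw [Module.Basis.mem_span_iff_repr_mem ℤ c.dualBasis g, mem_dual_iff]
  refine forall_congr' fun j => ?_
  simp [dualBasis_repr, eq_comm]

lemma neg_mem_dual {g : Space d} (hg : g ∈ c.dual) : -g ∈ c.dual := by
  rw [mem_dual_iff_mem_span] at hg ⊢
  exact neg_mem hg

lemma zero_mem_dual : (0 : Space d) ∈ c.dual := by
  rw [mem_dual_iff_mem_span]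
  exact zero_mem _

lemma add_mem_dual {g h : Space d} (hg : g ∈ c.dual) (hh : h ∈ c.dual) : g + h ∈ c.dual := by
  rw [mem_dual_iff_mem_span] at hg hh ⊢
  exact Submodule.add_mem _ hg hh

lemma measurableSet_brillouin : MeasurableSet c.brillouin := by
  rw [brillouin_eq]
  exact ZSpan.fundamentalDomain_measurableSet _

lemma isBounded_brillouin : Bornology.IsBounded c.brillouin := by
  rw [brillouin_eq]
  exact ZSpan.fundamentalDomain_isBounded _

lemma isCompact_closure_brillouin : IsCompact (closure c.brillouin) :=
  c.isBounded_brillouin.isCompact_closure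

lemma volume_brillouin_ne_zero : volume c.brillouin ≠ 0 := by
  rw [brillouin_eq]
  exact ZSpan.measure_fundamentalDomain_ne_zero _

lemma volume_brillouin_ne_top : volume c.brillouin ≠ ⊤ :=
  c.isBounded_brillouin.measure_lt_top.ne

instance : IsFiniteMeasure (volume.restrict c.brillouin) :=
  ⟨by rw [Measure.restrict_apply_univ]; exact c.volume_brillouin_ne_top.lt_top⟩

lemma volume_real_brillouin_pos : 0 < volume.real c.brillouin :=
  ENNReal.toReal_pos c.volume_brillouin_ne_zero c.volume_brillouin_ne_top

/-- The vector of the dual lattice that brings a point to the Brillouin zone. -/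
noncomputable def dualFloor (k : Space d) : Space d := ZSpan.floor c.dualBasis k

lemma dualFloor_mem (k : Space d) : c.dualFloor k ∈ c.dual := by
  rw [mem_dual_iff_mem_span]
  exact Submodule.coe_mem _

lemma sub_dualFloor_mem (k : Space d) : k - c.dualFloor k ∈ c.brillouin := by
  rw [brillouin_eq]
  exact ZSpan.fract_mem_fundamentalDomain _ k

lemma eq_dualFloor_of_sub_mem {g k : Space d} (hg : g ∈ c.dual) (h : k - g ∈ c.brillouin) :
    g = c.dualFloor k := by
  rw [brillouin_eq, ← ZSpan.fract_eq_self, sub_eq_add_neg,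
    ZSpan.fract_add_ZSpan _ _ ((c.mem_dual_iff_mem_span _).1 (c.neg_mem_dual hg)),
    ZSpan.fract_apply] at h
  have : k - c.dualFloor k = k + -g := h
  rw [← sub_eq_add_neg, sub_right_inj] at this
  exact this.symm

lemma dualFloor_of_mem {k : Space d} (hk : k ∈ c.brillouin) : c.dualFloor k = 0 :=
  (c.eq_dualFloor_of_sub_mem c.zero_mem_dual (by simpa using hk)).symm

lemma dualFloor_add {g : Space d} (hg : g ∈ c.dual) (k : Space d) :
    c.dualFloor (k + g) = c.dualFloor k + g := by
  refine (c.eq_dualFloor_of_sub_mem (c.add_mem_dual (c.dualFloor_mem k) hg) ?_).symm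
  rw [add_sub_add_right_eq_sub]
  exact c.sub_dualFloor_mem k

lemma countable_dual : c.dual.Countable := by
  have : c.dual = (Submodule.span ℤ (Set.range c.dualBasis) : Set (Space d)) := by
    ext g
    exact c.mem_dual_iff_mem_span g
  rw [this]
  have : Countable (Submodule.span ℤ (Set.range c.dualBasis)) :=
    (c.dualBasis.restrictScalars ℤ).equivFun.toEquiv.countable_iff.2 inferInstance
  exact Set.to_countable _

/-- A property holds almost everywhere if it does so on all translates of the Brillouin zone. -/
lemma ae_of_forall_brillouin {p : Space d → Prop}
    (h : ∀ g ∈ c.dual, ∀ᵐ k ∂volume.restrict c.brillouin, p (k + g)) : ∀ᵐ k, p k := by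
  have h1 : ∀ g ∈ c.dual, ∀ᵐ k, k - g ∈ c.brillouin → p k := fun g hg => by
    have h2 := (ae_restrict_iff' c.measurableSet_brillouin).1 (h g hg)
    have h3 := (measurePreserving_sub_right volume g).quasiMeasurePreserving.ae h2
    filter_upwards [h3] with k hk
    simpa using hk
  rw [← ae_ball_iff c.countable_dual] at h1
  filter_upwards [h1] with k hk
  exact hk _ (c.dualFloor_mem k) (c.sub_dualFloor_mem k)

lemma isAddFundamentalDomain_brillouin (t : Space d) :
    IsAddFundamentalDomain (Submodule.span ℤ (Set.range c.dualBasis))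
      ((fun k => k - t) ⁻¹' c.brillouin) volume := by
  refine IsAddFundamentalDomain.mk'
    (c.measurableSet_brillouin.preimage (by fun_prop)).nullMeasurableSet fun k => ?_
  refine ⟨⟨-c.dualFloor (k - t), (c.mem_dual_iff_mem_span _).1
    (c.neg_mem_dual (c.dualFloor_mem _))⟩, ?_, ?_⟩
  · change (-c.dualFloor (k - t) + k) - t ∈ c.brillouin
    convert c.sub_dualFloor_mem (k - t) using 1
    abel
  · rintro ⟨g, hg⟩ hgk
    rw [← mem_dual_iff_mem_span] at hg
    change g + k - t ∈ c.brillouin at hgk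
    refine Subtype.ext ?_
    change g = -c.dualFloor (k - t)
    rw [← c.eq_dualFloor_of_sub_mem (g := -g) (c.neg_mem_dual hg), neg_neg]
    convert hgk using 1
    abel

/-- A translate of the Brillouin zone is another fundamental domain of the dual lattice. This
invariance gives both the orthogonality of characters and integration by parts without boundary
terms. -/
lemma integral_brillouin_add {E : Type*} [NormedAddCommGroup E] [NormedSpace ℝ E] {f : Space d → E}
    (hf : ∀ g ∈ c.dual, ∀ k, f (k + g) = f k) (t : Space d) :
    ∫ k in c.brillouin, f (k + t) = ∫ k in c.brillouin, f k := by
  have : VAddInvariantMeasure (Submodule.span ℤ (Set.range c.dualBasis)) (Space d) volume :=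
    inferInstanceAs <|
      VAddInvariantMeasure (Submodule.span ℤ (Set.range c.dualBasis)).toAddSubgroup (Space d) volume
  have h1 := IsAddFundamentalDomain.setIntegral_eq (c.isAddFundamentalDomain_brillouin t)
    (c.isAddFundamentalDomain_brillouin 0) (f := f) (by
      rintro ⟨g, hg⟩ k
      change f (g + k) = f k
      rw [add_comm]
      exact hf g ((c.mem_dual_iff_mem_span _).2 hg) k)
  have h2 := (measurePreserving_add_right volume t).setIntegral_preimage_emb
    (measurableEmbedding_addRight t) f ((fun k => k - t) ⁻¹' c.brillouin)
  have h3 : (fun k => k + t) ⁻¹' ((fun k => k - t) ⁻¹' c.brillouin) = c.brillouin := by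
    ext k
    simp
  rw [h3, h1] at h2
  simpa using h2

/-! ## Fourier series on the Brillouin zone -/

section Fourier

attribute [local instance] instMeasureSpaceUnitAddCircle

/-- The normalization `|𝔹^d|⁻¹`. -/
noncomputable def bzNorm : ℝ := (volume.real c.brillouin)⁻¹

lemma bzNorm_pos : 0 < c.bzNorm := inv_pos.2 c.volume_real_brillouin_pos

/-- A parametrization of the Brillouin zone by the torus. -/
noncomputable def torusParam (θ : UnitAddTorus (Fin d)) : Space d :=
  c.dualCoord.symm (UnitAddTorus.measurableEquivPiIoc (fun _ : Fin d => (0 : ℝ)) θ).1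

lemma coe_dualCoord_torusParam (θ : UnitAddTorus (Fin d)) :
    (fun i => ((c.dualCoord (c.torusParam θ) i : ℝ) : UnitAddCircle)) = θ := by
  rw [torusParam, LinearEquiv.apply_symm_apply]
  exact (UnitAddTorus.measurableEquivPiIoc (fun _ : Fin d => (0 : ℝ))).symm_apply_apply θ

lemma measurableEmbedding_torusParam : MeasurableEmbedding c.torusParam :=
  (c.dualCoord.symm.toContinuousLinearEquiv.toHomeomorph.measurableEmbedding.comp
    (MeasurableEmbedding.subtype_coe
      (MeasurableSet.univ_pi' (fun _ => measurableSet_Ioc)))).comp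
    (UnitAddTorus.measurableEquivPiIoc (fun _ : Fin d => (0 : ℝ))).measurableEmbedding

/-- This transports Fourier analysis on the standard torus to the Brillouin zone with its normalized
measure. The linear coordinates rescale Lebesgue measure by a constant, and the two half-open boxes
differ by a null set. -/
lemma measurePreserving_torusParam : MeasurePreserving c.torusParam volume
    (ENNReal.ofReal c.bzNorm • volume.restrict c.brillouin) := by
  set Θ := c.dualCoord.toContinuousLinearEquiv with hΘ
  set box : Set (Fin d → ℝ) := {x | ∀ i, x i ∈ Ioc (0 : ℝ) (0 + 1)} with hbox
  have hboxm : MeasurableSet box := MeasurableSet.univ_pi' (fun _ => measurableSet_Ioc)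
  have hQm : MeasurableSet (univ.pi fun _ : Fin d => Ico (0 : ℝ) 1) :=
    MeasurableSet.univ_pi fun _ => measurableSet_Ico
  have hs : MeasurePreserving
      (fun θ => (UnitAddTorus.measurableEquivPiIoc (fun _ : Fin d => (0 : ℝ)) θ).1)
      volume (volume.restrict box) := by
    have h1 := UnitAddTorus.measurePreserving_equivPiIoc (fun _ : Fin d => (0 : ℝ))
    have h2 : MeasurePreserving (Subtype.val : {x : Fin d → ℝ // x ∈ box} → (Fin d → ℝ))
        (Measure.comap Subtype.val volume) (volume.restrict box) :=
      ⟨measurable_subtype_coe, map_comap_subtype_coe hboxm volume⟩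
    exact h2.comp h1
  have hae : box =ᵐ[volume] univ.pi fun _ : Fin d => Ico (0 : ℝ) 1 := by
    have h1 : box = univ.pi fun _ : Fin d => Ioc (0 : ℝ) 1 := by
      ext x; simp [hbox]
    rw [h1]
    exact (Measure.univ_pi_Ioc_ae_eq_Icc (μ := fun _ => volume)).trans
      (Measure.univ_pi_Ico_ae_eq_Icc (μ := fun _ => volume)).symm
  have hpre : Θ ⁻¹' (univ.pi fun _ : Fin d => Ico (0 : ℝ) 1) = c.brillouin := by
    rw [brillouin_eq]
    ext k
    simp only [mem_preimage, mem_univ_pi, ZSpan.mem_fundamentalDomain, dualBasis_repr]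
    rfl
  have : (Measure.map Θ (volume : Measure (Space d))).IsAddHaarMeasure := Θ.isAddHaarMeasure_map _
  set κ := (Measure.map Θ (volume : Measure (Space d))).addHaarScalarFactor volume with hκ
  have hmap : Measure.map Θ (volume : Measure (Space d)) = κ • volume :=
    Measure.isAddLeftInvariant_eq_smul _ _
  -- Evaluating on the unit cube identifies the scaling constant with the volume of the zone, so no
  -- Jacobian determinant is computed.
  have hvol : volume c.brillouin = κ := by
    have h1 : Measure.map Θ (volume : Measure (Space d)) (univ.pi fun _ : Fin d => Ico (0 : ℝ) 1)
        = volume c.brillouin := by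
      rw [Measure.map_apply Θ.continuous.measurable hQm, hpre]
    rw [← h1, hmap]
    simp [Real.volume_pi_Ico]
  have hΘm : Measure.map Θ (volume.restrict c.brillouin) = volume c.brillouin • volume.restrict box := by
    rw [← hpre, ← Measure.restrict_map Θ.continuous.measurable hQm, hmap, hpre, hvol,
      Measure.restrict_congr_set hae, Measure.restrict_smul]
    rfl
  have hinv : Measure.map Θ.symm (volume.restrict box) =
      ENNReal.ofReal c.bzNorm • volume.restrict c.brillouin := by
    have h1 : ENNReal.ofReal c.bzNorm * volume c.brillouin = 1 := by
      rw [bzNorm, ENNReal.ofReal_inv_of_pos c.volume_real_brillouin_pos, Measure.real,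
        ENNReal.ofReal_toReal c.volume_brillouin_ne_top,
        ENNReal.inv_mul_cancel c.volume_brillouin_ne_zero c.volume_brillouin_ne_top]
    have h2 : volume.restrict box = Measure.map Θ
        (ENNReal.ofReal c.bzNorm • volume.restrict c.brillouin) := by
      rw [Measure.map_smul, hΘm, smul_smul, h1, one_smul]
    rw [h2, Measure.map_map Θ.symm.continuous.measurable Θ.continuous.measurable]
    have h3 : (Θ.symm : (Fin d → ℝ) → Space d) ∘ Θ = id := by
      funext k
      simp
    rw [h3, Measure.map_id]
  exact (⟨Θ.symm.continuous.measurable, hinv⟩ : MeasurePreserving Θ.symm _ _).comp hs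

lemma mFourier_torusParam (n : Fin d → ℤ) (θ : UnitAddTorus (Fin d)) :
    UnitAddTorus.mFourier (-n) θ =
      Complex.exp (-((⟪c.torusParam θ, (c.lattice n : Space d)⟫_ℝ : ℂ) * Complex.I)) := by
  conv_lhs => rw [← c.coe_dualCoord_torusParam θ]
  rw [UnitAddTorus.mFourier, ContinuousMap.coe_mk, inner_eq_dualCoord]
  simp_rw [fourier_coe_apply]
  rw [← Complex.exp_sum]
  congr 1
  push_cast
  rw [Finset.mul_sum, Finset.sum_mul, ← Finset.sum_neg_distrib]
  refine Finset.sum_congr rfl fun j _ => ?_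
  simp only [Pi.neg_apply, Int.cast_neg, div_one]
  ring

/-- Parseval's identity on the Brillouin zone. -/
lemma hasSum_sq_fourier {g : Space d → ℂ} (hg : MemLp g 2 (volume.restrict c.brillouin)) :
    HasSum (fun γ : c.Γ => ‖(c.bzNorm : ℂ) *
      ∫ k in c.brillouin, Complex.exp (-((⟪k, (γ : Space d)⟫_ℝ : ℂ) * Complex.I)) * g k‖ ^ 2)
      (c.bzNorm * ∫ k in c.brillouin, ‖g k‖ ^ 2) := by
  have hmp := c.measurePreserving_torusParam
  have hme := c.measurableEmbedding_torusParam
  have hG : MemLp (g ∘ c.torusParam) 2 volume :=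
    (hg.smul_measure ENNReal.ofReal_ne_top).comp_measurePreserving hmp
  have h := UnitAddTorus.hasSum_sq_mFourierCoeff hG.toLp
  have hκ : (ENNReal.ofReal c.bzNorm).toReal = c.bzNorm := ENNReal.toReal_ofReal c.bzNorm_pos.le
  have h1 : ∫ t, ‖hG.toLp _ t‖ ^ 2 = c.bzNorm * ∫ k in c.brillouin, ‖g k‖ ^ 2 := by
    have h2 : ∫ t, ‖hG.toLp _ t‖ ^ 2 = ∫ t, ‖g (c.torusParam t)‖ ^ 2 := by
      refine integral_congr_ae ?_
      filter_upwards [hG.coeFn_toLp] with t ht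
      rw [ht, Function.comp_apply]
    rw [h2, hmp.integral_comp hme fun k => ‖g k‖ ^ 2, integral_smul_measure, hκ, smul_eq_mul]
  rw [h1] at h
  rw [← c.lattice.toEquiv.hasSum_iff]
  refine Eq.mp (congrArg (fun f => HasSum f _) (funext fun n => ?_)) h
  refine congrArg (fun t : ℂ => ‖t‖ ^ 2) ?_
  have h3 : UnitAddTorus.mFourierCoeff (hG.toLp _) n =
      ∫ t, Complex.exp (-((⟪c.torusParam t, (c.lattice n : Space d)⟫_ℝ : ℂ) * Complex.I)) *
        g (c.torusParam t) := by
    rw [UnitAddTorus.mFourierCoeff]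
    refine integral_congr_ae ?_
    filter_upwards [hG.coeFn_toLp] with t ht
    rw [ht, mFourier_torusParam, Function.comp_apply, smul_eq_mul]
  rw [h3, hmp.integral_comp hme fun k =>
    Complex.exp (-((⟪k, (c.lattice n : Space d)⟫_ℝ : ℂ) * Complex.I)) * g k,
    integral_smul_measure, hκ, Complex.real_smul]
  rfl

end Fourier

end Crystal


/-- Orthonormal vectors are at distance √2 > 1, so balls of radius 1/2 around them are disjoint.
Countability is what allows sums over a basis to be exchanged with integrals over momenta. -/
lemma _root_.HilbertBasis.countable {F ι : Type*} [NormedAddCommGroup F] [InnerProductSpace ℂ F]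
    [SecondCountableTopology F] (e : HilbertBasis ι ℂ F) : Countable ι := by
  have hd : Pairwise (Function.onFun Disjoint fun i : ι => Metric.ball (e i) (1 / 2)) := by
    intro i j hij
    refine Metric.ball_disjoint_ball ?_
    have h1 : ‖e i - e j‖ ^ 2 = 2 := by
      rw [@norm_sub_sq ℂ, e.orthonormal.1 i, e.orthonormal.1 j, e.orthonormal.2 hij]
      norm_num
    rw [dist_eq_norm]
    nlinarith [norm_nonneg (e i - e j)]
  rw [← countable_univ_iff]
  refine Set.PairwiseDisjoint.countable_of_isOpen (s := fun i => Metric.ball (e i) (1 / 2))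
    (fun i _ j _ h => hd h) (fun i _ => Metric.isOpen_ball)
    (fun i _ => ⟨e i, Metric.mem_ball_self (by norm_num)⟩)

namespace Crystal

variable {d N : ℕ} (c : Crystal d N)

instance : Fact ((2 : ℝ≥0∞) ≠ ⊤) := ⟨ENNReal.ofNat_ne_top⟩

instance : SecondCountableTopology c.Hf := Lp.SecondCountableTopology

/-! ## Fourier coefficients of vector valued functions -/

/-- The character `k ↦ exp(-i k·γ)` of the Brillouin zone. -/
noncomputable def char (γ : c.Γ) (k : Space d) : ℂ :=
  Complex.exp (-((⟪k, (γ : Space d)⟫_ℝ : ℂ) * Complex.I))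

lemma norm_char (γ : c.Γ) (k : Space d) : ‖c.char γ k‖ = 1 := by
  rw [char, ← neg_mul, ← Complex.ofReal_neg, Complex.norm_exp_ofReal_mul_I]

lemma contDiff_char (γ : c.Γ) : ContDiff ℝ ∞ (c.char γ) := by
  refine Complex.contDiff_exp.comp (ContDiff.neg (ContDiff.mul ?_ contDiff_const))
  exact Complex.ofRealCLM.contDiff.comp (contDiff_id.inner ℝ contDiff_const)

lemma continuous_char (γ : c.Γ) : Continuous (c.char γ) := (c.contDiff_char γ).continuous

lemma char_add (γ γ' : c.Γ) (k : Space d) : c.char (γ + γ') k = c.char γ k * c.char γ' k := by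
  rw [char, char, char, ← Complex.exp_add, Submodule.coe_add, inner_add_right]
  congr 1
  push_cast
  ring

lemma char_add_right (γ : c.Γ) (k l : Space d) : c.char γ (k + l) = c.char γ k * c.char γ l := by
  rw [char, char, char, ← Complex.exp_add, inner_add_left]
  congr 1
  push_cast
  ring

lemma char_zero (k : Space d) : c.char 0 k = 1 := by
  simp [char]

lemma char_of_mem_dual (γ : c.Γ) {g : Space d} (hg : g ∈ c.dual) : c.char γ g = 1 := by
  obtain ⟨n, hn⟩ := hg γ
  rw [char, hn, Complex.exp_eq_one_iff]
  exact ⟨-n, by push_cast; ring⟩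

lemma char_add_mem_dual (γ : c.Γ) {g : Space d} (hg : g ∈ c.dual) (k : Space d) :
    c.char γ (k + g) = c.char γ k := by
  rw [char_add_right, char_of_mem_dual c γ hg, mul_one]

/-- For γ ≠ 0, translating by the momentum π γ / ‖γ‖² multiplies the character by -1 without
changing the integral, which must therefore vanish. -/
lemma integral_char (γ : c.Γ) :
    (c.bzNorm : ℂ) * ∫ k in c.brillouin, c.char γ k = if γ = 0 then 1 else 0 := by
  split_ifs with h
  · subst h
    simp only [char_zero, integral_const, Measure.real, Measure.restrict_apply_univ]
    rw [bzNorm, ← Measure.real, Complex.real_smul, mul_one, ← Complex.ofReal_mul,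
      inv_mul_cancel₀ c.volume_real_brillouin_pos.ne', Complex.ofReal_one]
  · have h0 : (γ : Space d) ≠ 0 := by simpa using h
    have h1 : ‖(γ : Space d)‖ ^ 2 ≠ 0 := by simpa using h0
    have h2 := integral_brillouin_add c (f := c.char γ) (fun g hg k => c.char_add_mem_dual γ hg k)
      ((Real.pi / ‖(γ : Space d)‖ ^ 2) • (γ : Space d))
    have h3 : c.char γ ((Real.pi / ‖(γ : Space d)‖ ^ 2) • (γ : Space d)) = -1 := by
      rw [char, inner_smul_left, real_inner_self_eq_norm_sq, RCLike.conj_to_real,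
        div_mul_cancel₀ _ h1, Complex.exp_neg, Complex.exp_pi_mul_I]
      norm_num
    simp only [char_add_right, h3, mul_neg, mul_one, integral_neg] at h2
    rw [show ∫ k in c.brillouin, c.char γ k = 0 from by linear_combination (-1 / 2 : ℂ) * h2,
      mul_zero]

/-- The Fourier coefficients of a periodic function. -/
noncomputable def fourierCoeff (γ : c.Γ) (u : Space d → c.Hf) : c.Hf :=
  c.bzNorm • ∫ k in c.brillouin, c.char γ k • u k

variable {c}

lemma memLp_char_smul (γ : c.Γ) {u : Space d → c.Hf} {p : ℝ≥0∞}
    (hu : MemLp u p (volume.restrict c.brillouin)) :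
    MemLp (fun k => c.char γ k • u k) p (volume.restrict c.brillouin) := by
  refine hu.of_le ((c.continuous_char γ).aestronglyMeasurable.smul hu.aestronglyMeasurable) ?_
  filter_upwards with k
  rw [norm_smul, norm_char, one_mul]

lemma integrable_char_smul (γ : c.Γ) {u : Space d → c.Hf}
    (hu : MemLp u 2 (volume.restrict c.brillouin)) :
    Integrable (fun k => c.char γ k • u k) (volume.restrict c.brillouin) :=
  (memLp_char_smul γ hu).integrable (by norm_num)

lemma fourierCoeff_add (γ : c.Γ) {u v : Space d → c.Hf}
    (hu : MemLp u 2 (volume.restrict c.brillouin)) (hv : MemLp v 2 (volume.restrict c.brillouin)) :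
    c.fourierCoeff γ (fun k => u k + v k) = c.fourierCoeff γ u + c.fourierCoeff γ v := by
  simp only [fourierCoeff, smul_add]
  rw [integral_add (integrable_char_smul γ hu) (integrable_char_smul γ hv), smul_add]

lemma fourierCoeff_smul (γ : c.Γ) (a : ℂ) (u : Space d → c.Hf) :
    c.fourierCoeff γ (fun k => a • u k) = a • c.fourierCoeff γ u := by
  simp only [fourierCoeff]
  simp only [smul_comm _ a]
  rw [integral_smul, smul_comm]

lemma fourierCoeff_clm (γ : c.Γ) (A : c.Hf →L[ℂ] c.Hf) {u : Space d → c.Hf}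
    (hu : MemLp u 2 (volume.restrict c.brillouin)) :
    c.fourierCoeff γ (fun k => A (u k)) = A (c.fourierCoeff γ u) := by
  simp only [fourierCoeff]
  simp only [← map_smul A]
  rw [ContinuousLinearMap.integral_comp_comm A (integrable_char_smul γ hu), map_real_smul]
  exact A.continuous

/-- Parseval's identity for vector valued functions on the Brillouin zone. -/
lemma tsum_enorm_fourierCoeff_sq {u : Space d → c.Hf}
    (hu : MemLp u 2 (volume.restrict c.brillouin)) :
    ∑' γ, ‖c.fourierCoeff γ u‖ₑ ^ 2 =
      ENNReal.ofReal c.bzNorm * ∫⁻ k in c.brillouin, ‖u k‖ₑ ^ 2 := by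
  obtain ⟨w, e, -⟩ := exists_hilbertBasis ℂ c.Hf
  have := e.countable
  -- Scalar Parseval is applied to each coordinate in a basis of the fibre; Tonelli then reassembles
  -- the norms on both sides.
  have h1 : ∀ i : w, ∑' γ, ‖⟪e i, c.fourierCoeff γ u⟫_ℂ‖ₑ ^ 2 =
      ENNReal.ofReal c.bzNorm * ∫⁻ k in c.brillouin, ‖⟪e i, u k⟫_ℂ‖ₑ ^ 2 := fun i => by
    have hm : MemLp (fun k => ⟪e i, u k⟫_ℂ) 2 (volume.restrict c.brillouin) := hu.const_inner _
    have h2 := c.hasSum_sq_fourier hm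
    have h3 : ∀ γ : c.Γ, ⟪e i, c.fourierCoeff γ u⟫_ℂ = (c.bzNorm : ℂ) *
        ∫ k in c.brillouin, Complex.exp (-((⟪k, (γ : Space d)⟫_ℝ : ℂ) * Complex.I)) *
          ⟪e i, u k⟫_ℂ := fun γ => by
      rw [fourierCoeff, RCLike.real_smul_eq_coe_smul (K := ℂ), inner_smul_right,
        ← integral_inner (integrable_char_smul γ hu)]
      simp only [inner_smul_right]
      rfl
    simp only [← h3] at h2
    have h4 := h2.tsum_eq
    have h5 : ∀ z : ℂ, ‖z‖ₑ ^ 2 = ENNReal.ofReal (‖z‖ ^ 2) := fun z => by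
      rw [ENNReal.ofReal_pow (norm_nonneg _), ofReal_norm]
    simp only [h5]
    rw [← ENNReal.ofReal_tsum_of_nonneg (fun _ => by positivity) h2.summable, h4,
      ENNReal.ofReal_mul c.bzNorm_pos.le, ofReal_integral_eq_lintegral_ofReal
        hm.integrable_norm_pow' (Eventually.of_forall fun _ => by positivity)]
  simp only [enorm_sq_eq_tsum e]
  rw [ENNReal.tsum_comm]
  simp only [h1]
  rw [ENNReal.tsum_mul_left, lintegral_tsum]
  intro i
  exact ((hu.const_inner (e i)).aestronglyMeasurable.enorm.pow_const 2)

lemma lintegral_enorm_sq {u : Space d → c.Hf} (hu : MemLp u 2 (volume.restrict c.brillouin)) :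
    ∫⁻ k in c.brillouin, ‖u k‖ₑ ^ 2 = ENNReal.ofReal (∫ k in c.brillouin, ‖u k‖ ^ 2) := by
  rw [ofReal_integral_eq_lintegral_ofReal hu.integrable_norm_pow'
    (Eventually.of_forall fun _ => by positivity)]
  refine lintegral_congr fun k => ?_
  rw [ENNReal.ofReal_pow (norm_nonneg _), ofReal_norm]

lemma hasSum_norm_fourierCoeff_sq {u : Space d → c.Hf}
    (hu : MemLp u 2 (volume.restrict c.brillouin)) :
    HasSum (fun γ => ‖c.fourierCoeff γ u‖ ^ 2) (c.bzNorm * ∫ k in c.brillouin, ‖u k‖ ^ 2) := by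
  have h := tsum_enorm_fourierCoeff_sq hu
  rw [lintegral_enorm_sq hu, ← ENNReal.ofReal_mul c.bzNorm_pos.le] at h
  have h1 : ∀ γ, ‖c.fourierCoeff γ u‖ₑ ^ 2 = ENNReal.ofReal (‖c.fourierCoeff γ u‖ ^ 2) := fun γ => by
    rw [ENNReal.ofReal_pow (norm_nonneg _), ofReal_norm]
  simp only [h1] at h
  have h2 : Summable fun γ => ‖c.fourierCoeff γ u‖ ^ 2 := by
    have h3 := ENNReal.summable_toReal (h.trans_ne ENNReal.ofReal_ne_top)
    simpa only [ENNReal.toReal_ofReal (sq_nonneg _)] using h3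
  rw [h2.hasSum_iff]
  rw [← ENNReal.ofReal_tsum_of_nonneg (fun _ => by positivity) h2] at h
  exact (ENNReal.ofReal_eq_ofReal_iff (tsum_nonneg fun _ => by positivity)
    (mul_nonneg c.bzNorm_pos.le (integral_nonneg fun _ => by positivity))).1 h

/-- The vector with given Fourier series. -/
noncomputable def ofFourier {u : Space d → c.Hf} (hu : MemLp u 2 (volume.restrict c.brillouin)) :
    c.H := (c.exists_cellCoeff_eq (hasSum_norm_fourierCoeff_sq hu).summable).choose

lemma cellCoeff_ofFourier {u : Space d → c.Hf} (hu : MemLp u 2 (volume.restrict c.brillouin))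
    (γ : c.Γ) : c.cellCoeff γ (ofFourier hu) = c.fourierCoeff γ u :=
  (c.exists_cellCoeff_eq (hasSum_norm_fourierCoeff_sq hu).summable).choose_spec γ

lemma norm_sq_of_cellCoeff {u : Space d → c.Hf} (hu : MemLp u 2 (volume.restrict c.brillouin))
    {ψ : c.H} (h : ∀ γ, c.cellCoeff γ ψ = c.fourierCoeff γ u) :
    ‖ψ‖ ^ 2 = c.bzNorm * ∫ k in c.brillouin, ‖u k‖ ^ 2 := by
  have h1 := c.hasSum_norm_cellCoeff_sq ψ
  simp only [h] at h1
  exact h1.unique (hasSum_norm_fourierCoeff_sq hu)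

lemma integral_norm_sq_toLp {u : Lp c.Hf 2 (volume.restrict c.brillouin)} :
    ∫ k in c.brillouin, ‖u k‖ ^ 2 = ‖u‖ ^ 2 := by
  have := L2.inner_def (𝕜 := ℂ) u u
  rw [inner_self_eq_norm_sq_to_K] at this
  simp only [inner_self_eq_norm_sq_to_K] at this
  apply Complex.ofReal_injective
  rw [← integral_complex_ofReal]
  simpa using this.symm

/-- The inverse Fourier transform. -/
noncomputable def fourierInv : Lp c.Hf 2 (volume.restrict c.brillouin) →ₗ[ℂ] c.H where
  toFun u := ofFourier (Lp.memLp u)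
  map_add' u v := c.ext_cellCoeff fun γ => by
    rw [map_add, cellCoeff_ofFourier, cellCoeff_ofFourier, cellCoeff_ofFourier,
      ← fourierCoeff_add γ (Lp.memLp u) (Lp.memLp v)]
    refine congrArg (c.bzNorm • ·) (integral_congr_ae ?_)
    filter_upwards [Lp.coeFn_add u v] with k hk
    rw [hk, Pi.add_apply]
  map_smul' a u := c.ext_cellCoeff fun γ => by
    rw [RingHom.id_apply, map_smul, cellCoeff_ofFourier, cellCoeff_ofFourier, ← fourierCoeff_smul]
    refine congrArg (c.bzNorm • ·) (integral_congr_ae ?_)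
    filter_upwards [Lp.coeFn_smul a u] with k hk
    rw [hk, Pi.smul_apply]

lemma norm_fourierInv (u : Lp c.Hf 2 (volume.restrict c.brillouin)) :
    ‖fourierInv u‖ = √c.bzNorm * ‖u‖ := by
  have h : ‖fourierInv u‖ ^ 2 = (√c.bzNorm * ‖u‖) ^ 2 := by
    rw [mul_pow, Real.sq_sqrt c.bzNorm_pos.le, ← integral_norm_sq_toLp]
    exact norm_sq_of_cellCoeff (Lp.memLp u) (cellCoeff_ofFourier (Lp.memLp u))
  exact (sq_eq_sq₀ (norm_nonneg _) (by positivity)).1 h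

lemma memLp_mode (γ : c.Γ) (v : c.Hf) :
    MemLp (fun k => c.char (-γ) k • v) 2 (volume.restrict c.brillouin) :=
  memLp_char_smul (-γ) (memLp_const v)

lemma fourierCoeff_mode (γ γ' : c.Γ) (v : c.Hf) :
    c.fourierCoeff γ' (fun k => c.char (-γ) k • v) = c.cellCoeff γ' (c.cellEmb γ v) := by
  simp only [fourierCoeff, smul_smul, ← char_add]
  rw [integral_smul_const, RCLike.real_smul_eq_coe_smul (K := ℂ), smul_smul]
  refine (congrArg (· • v) (c.integral_char (γ' + -γ))).trans ?_
  split_ifs with h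
  · rw [one_smul, ← sub_eq_zero.1 ((sub_eq_add_neg γ' γ).trans h), cellCoeff_cellEmb_self]
  · rw [zero_smul, cellCoeff_cellEmb_of_ne]
    rintro rfl
    exact h (add_neg_cancel _)

/-- `fourierInv` is a multiple of an isometry on a complete space, so its range is closed. The range
contains the single modes, whose images are the vectors supported in one cell, and finite sums of
these are dense. -/
lemma surjective_fourierInv : Function.Surjective (fourierInv (c := c)) := by
  have hcl : IsClosed (LinearMap.range (fourierInv (c := c)) : Set c.H) := by
    have hA : AntilipschitzWith (Real.toNNReal (√c.bzNorm)⁻¹) (fourierInv (c := c)) := by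
      refine AddMonoidHomClass.antilipschitz_of_bound _ fun u => ?_
      have := Real.sqrt_pos.2 c.bzNorm_pos
      rw [norm_fourierInv, Real.coe_toNNReal _ (by positivity), inv_mul_cancel_left₀ this.ne']
    have hU : UniformContinuous (fourierInv (c := c)) :=
      (AddMonoidHomClass.lipschitz_of_bound _ (√c.bzNorm) fun u =>
        (norm_fourierInv u).le).uniformContinuous
    exact hA.isClosed_range hU
  intro ψ
  refine hcl.mem_of_tendsto (c.hasSum_cellEmb ψ) (Eventually.of_forall fun s => ?_)
  refine Submodule.sum_mem _ fun γ _ => ⟨(memLp_mode γ (c.cellCoeff γ ψ)).toLp, ?_⟩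
  refine c.ext_cellCoeff fun γ' => ?_
  refine (cellCoeff_ofFourier (Lp.memLp _) γ').trans ?_
  rw [← fourierCoeff_mode]
  refine congrArg (c.bzNorm • ·) (integral_congr_ae ?_)
  filter_upwards [(memLp_mode γ (c.cellCoeff γ ψ)).coeFn_toLp] with k hk
  rw [hk]

end Crystal


namespace Crystal

variable {d N : ℕ} {c : Crystal d N}

/-! ## The Bloch-Floquet-Zak transform -/

variable (c) in
lemma exists_bound_fundCell : ∃ ρ : ℝ, 0 ≤ ρ ∧ ∀ᵐ x ∂(c.ν.restrict c.fundCell), ‖x‖ ≤ ρ := by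
  obtain ⟨ρ, hρ⟩ := c.isBounded_fundCell.exists_norm_le
  refine ⟨max ρ 0, le_max_right _ _, ?_⟩
  filter_upwards [ae_restrict_mem c.measurableSet_fundCell] with x hx
  exact (hρ x hx).trans (le_max_left _ _)

variable (c) in
/-- The plane waves on the fundamental cell. -/
noncomputable def wave (k : Space d) : c.Hf →L[ℂ] c.Hf := planeWave (c.ν.restrict c.fundCell) k

variable (c) in
lemma contDiff_wave : ContDiff ℝ ∞ c.wave := by
  obtain ⟨ρ, hρ, hb⟩ := c.exists_bound_fundCell
  exact contDiff_planeWave hρ hb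

variable (c) in
lemma continuous_wave : Continuous c.wave := c.contDiff_wave.continuous

lemma norm_wave_apply (k : Space d) (v : c.Hf) : ‖c.wave k v‖ = ‖v‖ := norm_planeWave_apply _ k v

lemma wave_add (k l : Space d) : c.wave (k + l) = c.wave k * c.wave l := planeWave_add _ k l

lemma wave_add_apply (k l : Space d) (v : c.Hf) : c.wave (k + l) v = c.wave k (c.wave l v) := by
  rw [wave_add]; rfl

lemma wave_zero : c.wave 0 = 1 := planeWave_zero _

lemma wave_neg_apply (k : Space d) (v : c.Hf) : c.wave (-k) (c.wave k v) = v := by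
  rw [← wave_add_apply, neg_add_cancel, wave_zero]; rfl

lemma wave_apply_neg (k : Space d) (v : c.Hf) : c.wave k (c.wave (-k) v) = v := by
  rw [← wave_add_apply, add_neg_cancel, wave_zero]; rfl

lemma rho_eq (g : Space d) : c.rho g = c.wave (-g) := rfl

lemma aestronglyMeasurable_clm_apply {V₁ V₂ : Type*} [NormedAddCommGroup V₁] [NormedSpace ℂ V₁]
    [NormedAddCommGroup V₂] [NormedSpace ℂ V₂] {μ : Measure (Space d)}
    {A : Space d → V₁ →L[ℂ] V₂} (hA : Continuous A) {φ : Space d → V₁}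
    (hφ : AEStronglyMeasurable φ μ) : AEStronglyMeasurable (fun k => A k (φ k)) μ := by
  obtain ⟨φ', h1, h2⟩ := hφ
  refine ⟨fun k => A k (φ' k), ?_, ?_⟩
  · have hc : Continuous fun p : (V₁ →L[ℂ] V₂) × V₁ => p.1 p.2 := by fun_prop
    exact hc.comp_stronglyMeasurable (hA.stronglyMeasurable.prodMk h1)
  · filter_upwards [h2] with k hk
    rw [hk]

lemma memLp_clm_apply {V₁ V₂ : Type*} [NormedAddCommGroup V₁] [NormedSpace ℂ V₁]
    [NormedAddCommGroup V₂] [NormedSpace ℂ V₂]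
    {A : Space d → V₁ →L[ℂ] V₂} (hA : Continuous A) {φ : Space d → V₁}
    (hφ : MemLp φ 2 (volume.restrict c.brillouin)) :
    MemLp (fun k => A k (φ k)) 2 (volume.restrict c.brillouin) := by
  obtain ⟨C, hC⟩ := (c.isCompact_closure_brillouin).exists_bound_of_continuousOn hA.continuousOn
  refine hφ.of_le_mul (c := C) (aestronglyMeasurable_clm_apply hA hφ.aestronglyMeasurable) ?_
  filter_upwards [ae_restrict_mem c.measurableSet_brillouin] with k hk
  exact (A k).le_of_opNorm_le (hC k (subset_closure hk)) _

lemma memLp_of_continuous {V : Type*} [NormedAddCommGroup V]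
    {φ : Space d → V} (hφ : Continuous φ) : MemLp φ 2 (volume.restrict c.brillouin) := by
  obtain ⟨C, hC⟩ := (c.isCompact_closure_brillouin).exists_bound_of_continuousOn hφ.continuousOn
  refine MemLp.of_bound hφ.aestronglyMeasurable C ?_
  filter_upwards [ae_restrict_mem c.measurableSet_brillouin] with k hk
  exact hC k (subset_closure hk)

lemma memLp_wave {φ : Space d → c.Hf} (hφ : MemLp φ 2 (volume.restrict c.brillouin)) :
    MemLp (fun k => c.wave k (φ k)) 2 (volume.restrict c.brillouin) :=
  memLp_clm_apply c.continuous_wave hφ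

/-- Multiplication by the plane wave turns an equivariant field into a periodic one, and the
transform says that the cell components of ψ are the Fourier coefficients of that periodic field.
Plancherel and uniqueness become statements on Fourier series. -/
lemma isBFZ_iff {ψ : c.H} {φ : Space d → c.Hf} : c.IsBFZ ψ φ ↔
    MemLp φ 2 (volume.restrict c.brillouin) ∧
    (∀ g ∈ c.dual, ∀ k, φ (k + g) = c.rho g (φ k)) ∧
    ∀ γ, c.cellCoeff γ ψ = c.fourierCoeff γ fun k => c.wave k (φ k) := by
  simp only [cellCoeff_apply]
  rfl

namespace IsBFZ

variable {ψ ψ' : c.H} {φ φ' : Space d → c.Hf}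

lemma memLp (h : c.IsBFZ ψ φ) : MemLp φ 2 (volume.restrict c.brillouin) := h.1

lemma equiv (h : c.IsBFZ ψ φ) {g : Space d} (hg : g ∈ c.dual) (k : Space d) :
    φ (k + g) = c.rho g (φ k) := h.2.1 g hg k

lemma cellCoeff (h : c.IsBFZ ψ φ) (γ : c.Γ) :
    c.cellCoeff γ ψ = c.fourierCoeff γ fun k => c.wave k (φ k) := (isBFZ_iff.1 h).2.2 γ

lemma add (h : c.IsBFZ ψ φ) (h' : c.IsBFZ ψ' φ') : c.IsBFZ (ψ + ψ') (fun k => φ k + φ' k) := by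
  refine isBFZ_iff.2 ⟨h.memLp.add h'.memLp, fun g hg k => ?_, fun γ => ?_⟩
  · rw [h.equiv hg, h'.equiv hg, map_add]
  · rw [map_add, h.cellCoeff, h'.cellCoeff, ← fourierCoeff_add γ (memLp_wave h.memLp)
      (memLp_wave h'.memLp)]
    simp only [map_add]

lemma smul (h : c.IsBFZ ψ φ) (a : ℂ) : c.IsBFZ (a • ψ) (fun k => a • φ k) := by
  refine isBFZ_iff.2 ⟨h.memLp.const_smul a, fun g hg k => ?_, fun γ => ?_⟩
  · rw [h.equiv hg, map_smul]
  · rw [map_smul, h.cellCoeff, ← fourierCoeff_smul γ]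
    simp only [map_smul]

lemma sub (h : c.IsBFZ ψ φ) (h' : c.IsBFZ ψ' φ') : c.IsBFZ (ψ - ψ') (fun k => φ k - φ' k) := by
  have := h.add (h'.smul (-1))
  simpa only [neg_one_smul, ← sub_eq_add_neg] using this

lemma norm_sq (h : c.IsBFZ ψ φ) : ‖ψ‖ ^ 2 = c.bzNorm * ∫ k in c.brillouin, ‖φ k‖ ^ 2 := by
  rw [norm_sq_of_cellCoeff (memLp_wave h.memLp) h.cellCoeff]
  simp only [norm_wave_apply]

lemma enorm_sq (h : c.IsBFZ ψ φ) :
    ‖ψ‖ₑ ^ 2 = ENNReal.ofReal c.bzNorm * ∫⁻ k in c.brillouin, ‖φ k‖ₑ ^ 2 := by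
  rw [lintegral_enorm_sq h.memLp, ← ENNReal.ofReal_mul c.bzNorm_pos.le, ← h.norm_sq,
    ENNReal.ofReal_pow (norm_nonneg _), ofReal_norm]

lemma zero : c.IsBFZ 0 (fun _ => 0) :=
  isBFZ_iff.2 ⟨MemLp.zero, fun g _ k => by rw [map_zero], fun γ => by simp [fourierCoeff]⟩

lemma congr_ae (h : c.IsBFZ ψ φ) (h1 : φ =ᵐ[volume.restrict c.brillouin] φ')
    (h2 : ∀ g ∈ c.dual, ∀ k, φ' (k + g) = c.rho g (φ' k)) : c.IsBFZ ψ φ' := by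
  refine isBFZ_iff.2 ⟨(memLp_congr_ae h1).1 h.memLp, h2, fun γ => ?_⟩
  rw [h.cellCoeff]
  refine congrArg (c.bzNorm • ·) (integral_congr_ae ?_)
  filter_upwards [h1] with k hk
  rw [hk]

/-- The difference of the two fields is a transform of 0, so Plancherel makes its norm vanish. -/
lemma ae_eq (h : c.IsBFZ ψ φ) (h' : c.IsBFZ ψ φ') : φ =ᵐ[volume.restrict c.brillouin] φ' := by
  have h1 := (h.sub h').norm_sq
  have hm := (h.sub h').memLp
  rw [sub_self, norm_zero, eq_comm, zero_pow two_ne_zero, mul_eq_zero,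
    or_iff_right c.bzNorm_pos.ne', integral_eq_zero_iff_of_nonneg (fun _ => by positivity)
    hm.integrable_norm_pow'] at h1
  filter_upwards [h1] with k hk
  simpa [sub_eq_zero] using hk

lemma ae_eq' (h : c.IsBFZ ψ φ) (h' : c.IsBFZ ψ φ') : ∀ᵐ k, φ k = φ' k := by
  refine c.ae_of_forall_brillouin fun g hg => ?_
  filter_upwards [h.ae_eq h'] with k hk
  rw [h.equiv hg, h'.equiv hg, hk]

lemma unique (h : c.IsBFZ ψ φ) (h' : c.IsBFZ ψ' φ') (h1 : φ =ᵐ[volume.restrict c.brillouin] φ') :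
    ψ = ψ' := by
  refine c.ext_cellCoeff fun γ => ?_
  rw [h'.cellCoeff, (h.congr_ae h1 h'.2.1).cellCoeff]

lemma T (h : c.IsBFZ ψ φ) (γ : c.Γ) : c.IsBFZ (c.T γ ψ) (fun k => c.char γ k • φ k) := by
  refine isBFZ_iff.2 ⟨memLp_char_smul γ h.memLp, fun g hg k => ?_, fun γ' => ?_⟩
  · rw [h.equiv hg, char_add_mem_dual c γ hg, map_smul]
  · have h1 : c.cellCoeff γ' (c.T γ ψ) = c.cellCoeff (γ + γ') ψ := by
      rw [cellCoeff_apply, cellCoeff_apply, c.T_T]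
    rw [h1, h.cellCoeff]
    simp only [fourierCoeff, char_add, map_smul, smul_smul, mul_comm]

end IsBFZ

lemma exists_of_memLp {φ : Space d → c.Hf} (hφ : MemLp φ 2 (volume.restrict c.brillouin))
    (h : ∀ g ∈ c.dual, ∀ k, φ (k + g) = c.rho g (φ k)) : ∃ ψ, c.IsBFZ ψ φ :=
  ⟨ofFourier (memLp_wave hφ), isBFZ_iff.2 ⟨hφ, h, cellCoeff_ofFourier _⟩⟩

variable (c) in
/-- The equivariant extension of a function on the Brillouin zone. -/
noncomputable def equivExt (φ : Space d → c.Hf) (k : Space d) : c.Hf :=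
  c.rho (c.dualFloor k) (φ (k - c.dualFloor k))

lemma equivExt_add (φ : Space d → c.Hf) {g : Space d} (hg : g ∈ c.dual) (k : Space d) :
    c.equivExt φ (k + g) = c.rho g (c.equivExt φ k) := by
  rw [equivExt, equivExt, dualFloor_add c hg, add_sub_add_right_eq_sub, rho_eq, rho_eq, rho_eq,
    ← wave_add_apply, neg_add_rev]

lemma equivExt_of_mem (φ : Space d → c.Hf) {k : Space d} (hk : k ∈ c.brillouin) :
    c.equivExt φ k = φ k := by
  rw [equivExt, dualFloor_of_mem c hk, rho_eq, neg_zero, wave_zero, sub_zero]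
  rfl

lemma equivExt_ae_eq (φ : Space d → c.Hf) :
    c.equivExt φ =ᵐ[volume.restrict c.brillouin] φ := by
  filter_upwards [ae_restrict_mem c.measurableSet_brillouin] with k hk
  exact equivExt_of_mem φ hk

lemma exists_equivExt {φ : Space d → c.Hf} (hφ : MemLp φ 2 (volume.restrict c.brillouin)) :
    ∃ ψ, c.IsBFZ ψ (c.equivExt φ) :=
  exists_of_memLp ((memLp_congr_ae (equivExt_ae_eq φ)).2 hφ) fun _ hg k => equivExt_add φ hg k

/-- Fourier inversion gives a field on the zone. Since `IsBFZ` asks for equivariance at every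
momentum, the plane wave is removed on the zone and the result is extended by equivariance. -/
lemma exists_isBFZ (ψ : c.H) : ∃ φ, c.IsBFZ ψ φ := by
  obtain ⟨u, rfl⟩ := surjective_fourierInv ψ
  have hu : MemLp (fun k => c.wave (-k) (u k)) 2 (volume.restrict c.brillouin) :=
    memLp_clm_apply (c.continuous_wave.comp continuous_neg) (Lp.memLp u)
  obtain ⟨ψ', h⟩ := exists_equivExt hu
  have : fourierInv u = ψ' := by
    refine c.ext_cellCoeff fun γ => (cellCoeff_ofFourier (Lp.memLp u) γ).trans ?_
    rw [h.cellCoeff]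
    refine congrArg (c.bzNorm • ·) (integral_congr_ae ?_)
    filter_upwards [equivExt_ae_eq fun k => c.wave (-k) (u k)] with k hk
    rw [hk, wave_apply_neg]
  exact ⟨_, this ▸ h⟩

/-- These are the basic test vectors: their transforms are explicit and smooth, and their span is
dense. -/
lemma isBFZ_cellEmb (γ : c.Γ) (v : c.Hf) :
    c.IsBFZ (c.cellEmb γ v) (fun k => c.char (-γ) k • c.wave (-k) v) := by
  have hW : Continuous fun k => c.wave (-k) v :=
    (c.continuous_wave.comp continuous_neg).clm_apply continuous_const
  refine isBFZ_iff.2 ⟨memLp_char_smul _ (memLp_of_continuous hW), fun g hg k => ?_, fun γ' => ?_⟩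
  · rw [char_add_mem_dual c _ hg, map_smul, neg_add_rev, wave_add_apply, rho_eq]
  · simp only [map_smul, wave_apply_neg]
    exact (fourierCoeff_mode γ γ' v).symm

lemma isSmoothBF_cellEmb (γ : c.Γ) (v : c.Hf) : c.IsSmoothBF (c.cellEmb γ v) :=
  ⟨fun k => c.char (-γ) k • c.wave (-k) v, by
    have h1 : ContDiff ℝ ∞ fun k => c.wave (-k) := c.contDiff_wave.comp contDiff_neg
    have h2 : ContDiff ℝ ∞ fun A : c.Hf →L[ℂ] c.Hf => A v :=
      ((ContinuousLinearMap.apply ℂ c.Hf v).restrictScalars ℝ).contDiff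
    exact (c.contDiff_char (-γ)).smul (h2.comp h1), isBFZ_cellEmb γ v⟩

lemma IsSmoothBF.add {ψ ψ' : c.H} (h : c.IsSmoothBF ψ) (h' : c.IsSmoothBF ψ') :
    c.IsSmoothBF (ψ + ψ') := by
  obtain ⟨φ, h1, h2⟩ := h
  obtain ⟨φ', h1', h2'⟩ := h'
  exact ⟨_, h1.add h1', h2.add h2'⟩

lemma isSmoothBF_zero : c.IsSmoothBF 0 := ⟨_, contDiff_const, IsBFZ.zero⟩

lemma isSmoothBF_sum (s : Finset c.Γ) (v : c.Γ → c.Hf) :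
    c.IsSmoothBF (∑ γ ∈ s, c.cellEmb γ (v γ)) := by
  classical
  induction s using Finset.induction_on with
  | empty => simpa using isSmoothBF_zero
  | insert γ s hγ ih =>
    rw [Finset.sum_insert hγ]
    exact (isSmoothBF_cellEmb γ _).add ih

lemma dense_isSmoothBF : Dense {ψ : c.H | c.IsSmoothBF ψ} := fun ψ =>
  mem_closure_of_tendsto (c.hasSum_cellEmb ψ) (Eventually.of_forall fun s => isSmoothBF_sum s _)

lemma isSmoothBF_of_finite {ψ : c.H} (h : {γ | c.cellCoeff γ ψ ≠ 0}.Finite) : c.IsSmoothBF ψ := by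
  have h1 := c.hasSum_cellEmb ψ
  have h2 := hasSum_sum_of_ne_finset_zero (L := .unconditional _) (f := fun γ => c.cellEmb γ (c.cellCoeff γ ψ))
    (s := h.toFinset) fun γ hγ => by
      have : c.cellCoeff γ ψ = 0 := by simpa using hγ
      rw [this, map_zero]
  rw [h1.unique h2]
  exact isSmoothBF_sum _ _

/-- A bounded region meets finitely many cells, so the transform is a finite sum of smooth modes.
Compressions to bounded sets therefore only see vectors on which the commutators with X_j are
defined. -/
lemma isSmoothBF_chi {Ω : Set (Space d)} (hΩ : MeasurableSet Ω) (hb : Bornology.IsBounded Ω)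
    (ψ : c.H) : c.IsSmoothBF (chi c.ν Ω hΩ ψ) := by
  refine isSmoothBF_of_finite ?_
  obtain ⟨ρ, hρ⟩ := c.isBounded_fundCell.exists_norm_le
  obtain ⟨R, hR⟩ := hb.exists_norm_le
  have hfin : {γ : c.Γ | ‖(γ : Space d)‖ ≤ ρ + R}.Finite := by
    have h1 := Metric.finite_isBounded_inter_isClosed (K := Metric.closedBall (0 : Space d) (ρ + R))
      (s := (c.Γ : Set (Space d))) ?_ Metric.isBounded_closedBall ?_
    · refine Finite.of_finite_image (f := Subtype.val) (h1.subset ?_) Subtype.val_injective.injOn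
      rintro _ ⟨γ, hγ, rfl⟩
      exact ⟨by simpa using hγ, γ.2⟩
    · exact ⟨inferInstanceAs (DiscreteTopology c.Γ)⟩
    · exact AddSubgroup.isClosed_of_discrete (H := c.Γ.toAddSubgroup)
  refine hfin.subset fun γ hγ => ?_
  by_contra hγ'
  refine hγ (Lp.ext ?_)
  filter_upwards [c.coeFn_cellCoeff γ (chi c.ν Ω hΩ ψ),
    ae_restrict_of_ae (c.ae_sub (coeFn_chi c.ν hΩ ψ) γ),
    Lp.coeFn_zero (Internal N) 2 (c.ν.restrict c.fundCell),
    ae_restrict_mem c.measurableSet_fundCell] with y h1 h2 h3 hy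
  rw [h1, h2, h3, indicator_of_notMem, map_zero, Pi.zero_apply]
  intro hy'
  refine hγ' ?_
  have := norm_sub_le y (y - γ)
  rw [sub_sub_cancel] at this
  exact this.trans (add_le_add (hρ y hy) (hR _ hy'))

end Crystal


namespace Crystal

variable {d N : ℕ} {c : Crystal d N}

/-! ## Decomposable operators -/

/-- The bounded operator `T` is the direct integral of the fibres `A k`. -/
def Fibered (T : c.H →L[ℂ] c.H) (A : Space d → (c.Hf →L[ℂ] c.Hf)) : Prop :=
  ∀ ψ φ, c.IsBFZ ψ φ → c.IsBFZ (T ψ) (fun k => A k (φ k))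

/-- A continuous family is bounded on the compact closure of the zone, so Plancherel bounds the
operator; covariance keeps the fields equivariant. -/
lemma exists_fibered {A : Space d → (c.Hf →L[ℂ] c.Hf)} (hA : Continuous A)
    (hcov : ∀ g ∈ c.dual, ∀ k v, A (k + g) (c.rho g v) = c.rho g (A k v)) :
    ∃ T : c.H →L[ℂ] c.H, Fibered T A := by
  have hA' : ∀ ψ φ, c.IsBFZ ψ φ → ∃ χ, c.IsBFZ χ fun k => A k (φ k) := fun ψ φ h =>
    exists_of_memLp (memLp_clm_apply hA h.memLp) fun g hg k => by rw [h.equiv hg, hcov g hg]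
  choose b hb using exists_isBFZ (c := c)
  choose F hF using fun ψ => hA' ψ _ (hb ψ)
  have hall : ∀ ψ φ, c.IsBFZ ψ φ → c.IsBFZ (F ψ) fun k => A k (φ k) := fun ψ φ h => by
    refine (hF ψ).congr_ae ?_ fun g hg k => by rw [h.equiv hg, hcov g hg]
    filter_upwards [(hb ψ).ae_eq h] with k hk
    rw [hk]
  obtain ⟨C, hC⟩ := (c.isCompact_closure_brillouin).exists_bound_of_continuousOn hA.continuousOn
  have hadd : ∀ x y, F (x + y) = F x + F y := fun x y => by
    refine (hall _ _ ((hb x).add (hb y))).unique ((hF x).add (hF y)) (Eventually.of_forall fun k => ?_)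
    exact map_add _ _ _
  have hsmul : ∀ (a : ℂ) x, F (a • x) = a • F x := fun a x => by
    refine (hall _ _ ((hb x).smul a)).unique ((hF x).smul a) (Eventually.of_forall fun k => ?_)
    exact map_smul _ _ _
  refine ⟨LinearMap.mkContinuous ⟨⟨F, hadd⟩, hsmul⟩ C fun ψ => ?_, hall⟩
  have hC0 : 0 ≤ C := by
    obtain ⟨k⟩ : Nonempty (closure c.brillouin) := by
      rw [nonempty_coe_sort, closure_nonempty_iff]
      by_contra h
      rw [not_nonempty_iff_eq_empty] at h
      exact c.volume_brillouin_ne_zero (by rw [h, measure_empty])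
    exact (norm_nonneg _).trans (hC k.1 k.2)
  refine (sq_le_sq₀ (norm_nonneg _) (by positivity)).1 ?_
  change ‖F ψ‖ ^ 2 ≤ _
  rw [mul_pow, (hF ψ).norm_sq, (hb ψ).norm_sq, mul_left_comm (C ^ 2), ← integral_const_mul (C ^ 2)]
  refine mul_le_mul_of_nonneg_left ?_ c.bzNorm_pos.le
  refine setIntegral_mono_on (hF ψ).memLp.integrable_norm_pow'
    ((hb ψ).memLp.integrable_norm_pow'.const_mul _) c.measurableSet_brillouin fun k hk => ?_
  rw [← mul_pow]
  exact pow_le_pow_left₀ (norm_nonneg _) ((A k).le_of_opNorm_le (hC k (subset_closure hk)) _) 2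

namespace Fibered

variable {T T' : c.H →L[ℂ] c.H} {A A' : Space d → (c.Hf →L[ℂ] c.Hf)}

lemma mul (h : Fibered T A) (h' : Fibered T' A') : Fibered (T * T') (fun k => A k * A' k) :=
  fun _ _ hψ => h _ _ (h' _ _ hψ)

lemma add (h : Fibered T A) (h' : Fibered T' A') : Fibered (T + T') (fun k => A k + A' k) :=
  fun _ _ hψ => (h _ _ hψ).add (h' _ _ hψ)

/-- Covariance holds at every k because `IsBFZ` demands pointwise equivariance; the test vector is
chosen so that its transform takes the value v at k. -/
lemma cov (h : Fibered T A) {g : Space d} (hg : g ∈ c.dual) (k : Space d) (v : c.Hf) :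
    A (k + g) (c.rho g v) = c.rho g (A k v) := by
  have h1 := (h _ _ (isBFZ_cellEmb 0 (c.wave k v))).equiv hg k
  have h2 := (isBFZ_cellEmb 0 (c.wave k v)).equiv hg k
  rw [h2, neg_zero, char_zero, one_smul, wave_neg_apply] at h1
  exact h1

lemma unique (h : Fibered T A) (h' : Fibered T' A) : T = T' := by
  ext1 ψ
  obtain ⟨φ, hφ⟩ := exists_isBFZ ψ
  exact (h _ _ hφ).unique (h' _ _ hφ) (Eventually.of_forall fun _ => rfl)

/-- Testing on a countable dense set of fibre vectors puts all the exceptional null sets into one.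
-/
lemma ae_eq (h : Fibered T A) (h' : Fibered T A') : ∀ᵐ k, A k = A' k := by
  have h1 : ∀ n, ∀ᵐ k, A k (c.wave (-k) (TopologicalSpace.denseSeq c.Hf n)) =
      A' k (c.wave (-k) (TopologicalSpace.denseSeq c.Hf n)) := fun n => by
    filter_upwards [(h _ _ (isBFZ_cellEmb 0 (TopologicalSpace.denseSeq c.Hf n))).ae_eq'
      (h' _ _ (isBFZ_cellEmb 0 (TopologicalSpace.denseSeq c.Hf n)))] with k hk
    simpa only [neg_zero, char_zero, one_smul] using hk
  rw [← ae_all_iff] at h1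
  filter_upwards [h1] with k hk
  have h2 : (fun v => A k (c.wave (-k) v)) = fun v => A' k (c.wave (-k) v) := by
    refine (TopologicalSpace.denseRange_denseSeq c.Hf).equalizer (by fun_prop) (by fun_prop) ?_
    funext n
    exact hk n
  ext1 v
  have h3 := congrFun h2 (c.wave k v)
  simpa only [wave_neg_apply] using h3

lemma eq_of_continuous (h : Fibered T A) (h' : Fibered T A') (hA : Continuous A)
    (hA' : Continuous A') : A = A' :=
  (Continuous.ae_eq_iff_eq volume hA hA').1 (h.ae_eq h')

lemma map_T (h : Fibered T A) (γ : c.Γ) (ψ : c.H) : T (c.T γ ψ) = c.T γ (T ψ) := by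
  obtain ⟨φ, hφ⟩ := exists_isBFZ ψ
  refine (h _ _ (hφ.T γ)).unique ((h _ _ hφ).T γ) (Eventually.of_forall fun k => ?_)
  exact map_smul _ _ _

end Fibered

/-! ## Differentiability along a coordinate direction and the position operators -/

/-- `φ` is continuously differentiable in the direction `j`, with derivative `φ'`.  The difference
quotients are written with the complex structure, so that the notion does not depend on the choice
of a real one. -/
def LineC1 {V : Type*} [NormedAddCommGroup V] [NormedSpace ℂ V] (j : Fin d)
    (φ φ' : Space d → V) : Prop :=
  Continuous φ ∧ Continuous φ' ∧
    ∀ k, Tendsto (fun t : ℝ => ((t⁻¹ : ℝ) : ℂ) • (φ (k + t • EuclideanSpace.single j 1) - φ k))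
      (𝓝[≠] 0) (𝓝 (φ' k))

lemma lineC1_iff_hasDerivAt {V : Type*} [NormedAddCommGroup V] [NormedSpace ℂ V] [NormedSpace ℝ V]
    [IsScalarTower ℝ ℂ V] {j : Fin d} {φ φ' : Space d → V} : LineC1 j φ φ' ↔
      Continuous φ ∧ Continuous φ' ∧
        ∀ k, HasDerivAt (fun t : ℝ => φ (k + t • EuclideanSpace.single j 1)) (φ' k) 0 := by
  refine and_congr_right fun _ => and_congr_right fun _ => forall_congr' fun k => ?_
  rw [hasDerivAt_iff_tendsto_slope_zero]
  simp only [RCLike.real_smul_eq_coe_smul (K := ℂ) (E := V), zero_add, zero_smul, add_zero]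
  rfl

namespace LineC1

variable {V : Type*} [NormedAddCommGroup V] [NormedSpace ℂ V] {j : Fin d} {φ φ' : Space d → V}

lemma hasDerivAt_zero [NormedSpace ℝ V] [IsScalarTower ℝ ℂ V] (h : LineC1 j φ φ') (k : Space d) :
    HasDerivAt (fun t : ℝ => φ (k + t • EuclideanSpace.single j 1)) (φ' k) 0 :=
  (lineC1_iff_hasDerivAt.1 h).2.2 k

lemma hasDerivAt [NormedSpace ℝ V] [IsScalarTower ℝ ℂ V] (h : LineC1 j φ φ') (k : Space d) (t : ℝ) :
    HasDerivAt (fun t : ℝ => φ (k + t • EuclideanSpace.single j 1))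
      (φ' (k + t • EuclideanSpace.single j 1)) t := by
  have h1 := h.hasDerivAt_zero (k + t • EuclideanSpace.single j 1)
  rw [show (0 : ℝ) = t - t by ring] at h1
  have h2 := h1.comp_sub_const t t
  refine h2.congr_of_eventuallyEq (Eventually.of_forall fun s => ?_)
  simp only
  rw [add_assoc, ← add_smul, add_sub_cancel]

lemma of_contDiff [NormedSpace ℝ V] [IsScalarTower ℝ ℂ V] (hφ : ContDiff ℝ ∞ φ) :
    LineC1 j φ (fun k => fderiv ℝ φ k (EuclideanSpace.single j 1)) := by
  refine lineC1_iff_hasDerivAt.2 ⟨hφ.continuous,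
    (hφ.continuous_fderiv (by simp)).clm_apply continuous_const, fun k => ?_⟩
  have h1 : HasFDerivAt φ (fderiv ℝ φ k) (k + (0 : ℝ) • EuclideanSpace.single j 1) := by
    rw [zero_smul, add_zero]
    exact (hφ.differentiable (by simp) k).hasFDerivAt
  have h2 : HasDerivAt (fun t : ℝ => k + t • EuclideanSpace.single j (1 : ℝ))
      (EuclideanSpace.single j 1) 0 := by
    have := ((hasDerivAt_id (0 : ℝ)).smul_const (EuclideanSpace.single j (1 : ℝ))).const_add k
    simpa using this
  exact h1.comp_hasDerivAt (0 : ℝ) h2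

lemma clm_apply {V₁ V₂ : Type*} [NormedAddCommGroup V₁] [NormedSpace ℂ V₁] [NormedAddCommGroup V₂]
    [NormedSpace ℂ V₂] {A A' : Space d → V₁ →L[ℂ] V₂} {φ φ' : Space d → V₁} (hA : LineC1 j A A')
    (hφ : LineC1 j φ φ') : LineC1 j (fun k => A k (φ k)) (fun k => A' k (φ k) + A k (φ' k)) := by
  refine lineC1_iff_hasDerivAt.2 ⟨hA.1.clm_apply hφ.1,
    (hA.2.1.clm_apply hφ.1).add (hA.1.clm_apply hφ.2.1), fun k => ?_⟩
  have h1 := (ContinuousLinearMap.restrictScalarsL ℂ V₁ V₂ ℝ ℝ).hasFDerivAt.comp_hasDerivAt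
    (0 : ℝ) (hA.hasDerivAt_zero k)
  have h2 := h1.clm_apply (hφ.hasDerivAt_zero k)
  have h3 : HasDerivAt (fun t : ℝ => A (k + t • EuclideanSpace.single j 1)
    (φ (k + t • EuclideanSpace.single j 1))) _ 0 := h2
  refine h3.congr_deriv ?_
  simp only [zero_smul, add_zero, Function.comp_apply]
  rfl

lemma smul {a a' : Space d → ℂ} (ha : LineC1 j a a') (hφ : LineC1 j φ φ') :
    LineC1 j (fun k => a k • φ k) (fun k => a k • φ' k + a' k • φ k) := by
  refine lineC1_iff_hasDerivAt.2 ⟨ha.1.smul hφ.1, (ha.1.smul hφ.2.1).add (ha.2.1.smul hφ.1),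
    fun k => ?_⟩
  have h : HasDerivAt (fun t : ℝ => a (k + t • EuclideanSpace.single j 1) •
    φ (k + t • EuclideanSpace.single j 1)) _ 0 := (ha.hasDerivAt_zero k).smul (hφ.hasDerivAt_zero k)
  refine h.congr_deriv ?_
  simp

lemma add {ψ ψ' : Space d → V} (hφ : LineC1 j φ φ') (hψ : LineC1 j ψ ψ') :
    LineC1 j (fun k => φ k + ψ k) (fun k => φ' k + ψ' k) :=
  lineC1_iff_hasDerivAt.2 ⟨hφ.1.add hψ.1, hφ.2.1.add hψ.2.1, fun k =>
    (hφ.hasDerivAt_zero k).add (hψ.hasDerivAt_zero k)⟩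

lemma sub_const (h : LineC1 j φ φ') (v : V) : LineC1 j (fun k => φ k - v) φ' := by
  refine ⟨h.1.sub continuous_const, h.2.1, fun k => ?_⟩
  simpa only [sub_sub_sub_cancel_right] using h.2.2 k

lemma clm_comp {V₂ : Type*} [NormedAddCommGroup V₂] [NormedSpace ℂ V₂] (L : V →L[ℂ] V₂)
    (h : LineC1 j φ φ') : LineC1 j (fun k => L (φ k)) (fun k => L (φ' k)) := by
  refine ⟨L.continuous.comp h.1, L.continuous.comp h.2.1, fun k => ?_⟩
  refine ((L.continuous.tendsto _).comp (h.2.2 k)).congr fun t => ?_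
  rw [Function.comp_apply, map_smul, map_sub]

lemma unique {φ'' : Space d → V} (h : LineC1 j φ φ') (h' : LineC1 j φ φ'') : φ' = φ'' :=
  funext fun k => tendsto_nhds_unique (h.2.2 k) (h'.2.2 k)

lemma comp_add (h : LineC1 j φ φ') (g : Space d) :
    LineC1 j (fun k => φ (k + g)) (fun k => φ' (k + g)) := by
  refine ⟨h.1.comp (by fun_prop), h.2.1.comp (by fun_prop), fun k => ?_⟩
  simpa only [add_right_comm] using h.2.2 (k + g)

lemma equiv (h : LineC1 j φ φ') {g : Space d} (L : V →L[ℂ] V) (hg : ∀ k, φ (k + g) = L (φ k))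
    (k : Space d) : φ' (k + g) = L (φ' k) := by
  have h1 := h.comp_add g
  simp only [hg] at h1
  exact congrFun (h1.unique (h.clm_comp L)) k

/-- The integral of φ(k + t e_j) over the zone does not depend on t, by periodicity. Differentiating
under the integral at t = 0 gives the claim, which is integration by parts on the torus. -/
lemma integral_eq_zero [NormedSpace ℝ V] [IsScalarTower ℝ ℂ V] [CompleteSpace V]
    (h : LineC1 j φ φ')
    (hg : ∀ g ∈ c.dual, ∀ k, φ (k + g) = φ k) : ∫ k in c.brillouin, φ' k = 0 := by
  set e : Space d := EuclideanSpace.single j 1 with he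
  obtain ⟨ρ, hρ⟩ := c.isBounded_brillouin.exists_norm_le
  obtain ⟨C, hC⟩ := (isCompact_closedBall (0 : Space d) (ρ + 1)).exists_bound_of_continuousOn
    h.2.1.continuousOn
  have hint : ∀ {f : Space d → V}, Continuous f → Integrable f (volume.restrict c.brillouin) :=
    fun hf => (memLp_of_continuous hf).integrable (by norm_num)
  have h1 := hasDerivAt_integral_of_dominated_loc_of_deriv_le (μ := volume.restrict c.brillouin)
    (F := fun (t : ℝ) k => φ (k + t • e)) (F' := fun (t : ℝ) k => φ' (k + t • e)) (x₀ := (0 : ℝ))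
    (s := Metric.ball 0 1) (bound := fun _ => C) (Metric.ball_mem_nhds _ one_pos)
    (Eventually.of_forall fun t => (h.1.comp (by fun_prop)).aestronglyMeasurable)
    (hint (h.1.comp (by fun_prop)))
    (h.2.1.comp (by fun_prop)).aestronglyMeasurable
    (by
      filter_upwards [ae_restrict_mem c.measurableSet_brillouin] with k hk t ht
      refine hC _ ?_
      rw [mem_closedBall_zero_iff]
      refine (norm_add_le _ _).trans (add_le_add (hρ k hk) ?_)
      rw [norm_smul, he, PiLp.norm_single, norm_one, mul_one]
      exact (mem_ball_zero_iff.1 ht).le)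
    (integrable_const C)
    (Eventually.of_forall fun k t _ => h.hasDerivAt k t)
  have h2 := h1.2
  simp only [integral_brillouin_add c hg, zero_smul, add_zero] at h2
  exact h2.unique (hasDerivAt_const _ _)

end LineC1

lemma lineC1_char (γ : c.Γ) (j : Fin d) : LineC1 j (c.char γ)
    (fun k => -(((γ : Space d) j : ℂ) * Complex.I) * c.char γ k) := by
  refine lineC1_iff_hasDerivAt.2 ⟨c.continuous_char γ,
    continuous_const.mul (c.continuous_char γ), fun k => ?_⟩
  have h1 : ∀ t : ℝ, c.char γ (k + t • EuclideanSpace.single j 1) =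
      Complex.exp (t * -(((γ : Space d) j : ℂ) * Complex.I)) * c.char γ k := fun t => by
    rw [char, char, ← Complex.exp_add, inner_add_left, inner_smul_left,
      EuclideanSpace.inner_single_left]
    congr 1
    simp
    ring
  have h2 : HasDerivAt (fun t : ℝ => (t : ℂ) * -(((γ : Space d) j : ℂ) * Complex.I))
      (-(((γ : Space d) j : ℂ) * Complex.I)) 0 := by
    have := (Complex.ofRealCLM.hasDerivAt (x := (0 : ℝ))).mul_const
      (-(((γ : Space d) j : ℂ) * Complex.I))
    simpa using this
  have h3 := h2.cexp.mul_const (c.char γ k)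
  refine (h3.congr_of_eventuallyEq (Eventually.of_forall h1)).congr_deriv ?_
  simp

lemma fderiv_wave_single {ρ : ℝ} (hρ : 0 ≤ ρ) (hb : ∀ᵐ x ∂(c.ν.restrict c.fundCell), ‖x‖ ≤ ρ)
    (j : Fin d) (k : Space d) (v : c.Hf) : fderiv ℝ c.wave k (EuclideanSpace.single j 1) v =
      Complex.I • c.wave k (bddPosition hρ hb j v) := by
  have h3 := (hasFDerivAt_planeWave (N := N) hρ hb k).fderiv
  have h4 : fderiv ℝ c.wave k = fderiv ℝ (planeWave (N := N) (c.ν.restrict c.fundCell)) k := rfl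
  rw [h4, h3, ContinuousLinearMap.comp_apply, waveGen_single]
  exact map_smul (c.wave k) _ _

/-- X_j acts as i ∂_j. Integrating by parts in the Fourier coefficients, the plane wave contributes
the position y_j inside the cell and the character contributes -γ_j, and y_j - γ_j is the coordinate
of the point y - γ. -/
lemma position_of_isBFZ {j : Fin d} {φ φ' : Space d → c.Hf} (hφ : LineC1 j φ φ') {ψ : c.H}
    (hψ : c.IsBFZ ψ φ) : ∃ h : ψ ∈ (position c.ν j).domain,
      c.IsBFZ (position c.ν j ⟨ψ, h⟩) (fun k => Complex.I • φ' k) := by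
  obtain ⟨ρ, hρ, hb⟩ := c.exists_bound_fundCell
  set Y : c.Hf →L[ℂ] c.Hf := bddPosition hρ hb j with hY
  have hYW : ∀ k v, Y (c.wave k v) = c.wave k (Y v) := fun k v => by
    refine Lp.ext ?_
    filter_upwards [coeFn_bddPosition hρ hb j (c.wave k v), coeFn_bddPosition hρ hb j v,
      coeFn_planeWave (c.ν.restrict c.fundCell) k v,
      coeFn_planeWave (c.ν.restrict c.fundCell) k (Y v)] with x h1 h2 h3 h4
    rw [h1]
    refine Eq.trans ?_ h4.symm
    rw [h2, smul_comm, ← h3]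
    rfl
  -- The product rule for the periodic field: differentiating the plane wave brings down the bounded
  -- position operator Y of the cell.
  have hWφ : LineC1 j (fun k => c.wave k (φ k))
      (fun k => Complex.I • Y (c.wave k (φ k)) + c.wave k (φ' k)) := by
    have h0 := LineC1.of_contDiff (j := j) c.contDiff_wave
    have h1 := h0.clm_apply hφ
    have h2 : ∀ k v, fderiv ℝ c.wave k (EuclideanSpace.single j 1) v =
        Complex.I • Y (c.wave k v) := fun k v => by
      rw [fderiv_wave_single hρ hb, hYW]
    simpa only [h2] using h1
  have hφ'equiv : ∀ g ∈ c.dual, ∀ k, φ' (k + g) = c.rho g (φ' k) := fun g hg k =>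
    hφ.equiv (c.rho g) (fun k => hψ.equiv hg k) k
  have hmφ' : MemLp φ' 2 (volume.restrict c.brillouin) := memLp_of_continuous hφ.2.1
  obtain ⟨χ₀, hχ₀⟩ := exists_of_memLp hmφ' hφ'equiv
  have hχ := hχ₀.smul Complex.I
  set χ := Complex.I • χ₀
  have hper : ∀ g ∈ c.dual, ∀ k, c.wave (k + g) (φ (k + g)) = c.wave k (φ k) := fun g hg k => by
    rw [hψ.equiv hg, rho_eq, ← wave_add_apply, add_neg_cancel_right]
  have hcoeff : ∀ γ, c.cellCoeff γ χ =
      Y (c.cellCoeff γ ψ) - (((γ : Space d) j : ℝ) : ℂ) • c.cellCoeff γ ψ := fun γ => by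
    have h1 := ((lineC1_char γ j).smul hWφ).integral_eq_zero (c := c) fun g hg k => by
      rw [char_add_mem_dual c γ hg, hper g hg]
    have h2 : c.fourierCoeff γ (fun k => (Complex.I • Y (c.wave k (φ k)) + c.wave k (φ' k)) +
        (-(((γ : Space d) j : ℂ) * Complex.I)) • c.wave k (φ k)) = 0 := by
      rw [fourierCoeff, ← smul_zero c.bzNorm, ← h1]
      refine congrArg (c.bzNorm • ·) (integral_congr_ae (Eventually.of_forall fun k => ?_))
      simp only [smul_add, smul_smul]
      rw [mul_comm (c.char γ k) (-_)]
    have hm := memLp_wave hψ.memLp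
    have hm' := memLp_wave hmφ'
    have hmY : MemLp (fun k => Complex.I • Y (c.wave k (φ k))) 2 (volume.restrict c.brillouin) :=
      (memLp_clm_apply (A := fun _ => Y) continuous_const hm).const_smul Complex.I
    rw [fourierCoeff_add γ (u := fun k => Complex.I • Y (c.wave k (φ k)) + c.wave k (φ' k))
      (v := fun k => (-(((γ : Space d) j : ℂ) * Complex.I)) • c.wave k (φ k))
      (hmY.add hm') (hm.const_smul (-(((γ : Space d) j : ℂ) * Complex.I))), fourierCoeff_add γ hmY hm', fourierCoeff_smul, fourierCoeff_smul, fourierCoeff_clm γ Y hm, ← hψ.cellCoeff] at h2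
    rw [hχ.cellCoeff]
    simp only [map_smul]
    rw [fourierCoeff_smul]
    have h3 : c.fourierCoeff γ (fun k => c.wave k (φ' k)) =
        (((γ : Space d) j : ℂ) * Complex.I) • c.cellCoeff γ ψ -
          Complex.I • Y (c.cellCoeff γ ψ) := by
      rw [neg_smul, add_assoc, add_comm, ← sub_eq_add_neg, sub_add, sub_eq_zero] at h2
      rw [h2]
    rw [h3, smul_sub, smul_smul, smul_smul, Complex.I_mul_I, mul_left_comm, Complex.I_mul_I]
    simp only [neg_smul, one_smul, mul_neg, mul_one]
    abel
  -- The identity of coefficients is read back cell by cell; the unitaries M(γ, y) are injective and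
  -- linear, so they drop out.
  have hae : χ =ᵐ[c.ν] fun x => (x j : ℂ) • ψ x := by
    refine c.ae_of_forall_cell fun γ => ?_
    have h1 := hcoeff γ
    have h2 : (c.cellCoeff γ χ : Space d → Internal N) =ᵐ[c.ν.restrict c.fundCell]
        fun y => (y j : ℂ) • c.cellCoeff γ ψ y - (((γ : Space d) j : ℝ) : ℂ) • c.cellCoeff γ ψ y := by
      rw [h1]
      filter_upwards [Lp.coeFn_sub (Y (c.cellCoeff γ ψ))
        ((((γ : Space d) j : ℝ) : ℂ) • c.cellCoeff γ ψ),
        coeFn_bddPosition hρ hb j (c.cellCoeff γ ψ),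
        Lp.coeFn_smul (((γ : Space d) j : ℝ) : ℂ) (c.cellCoeff γ ψ)] with y h3 h4 h5
      rw [h3, Pi.sub_apply, h5, h4]
      rfl
    filter_upwards [h2, c.coeFn_cellCoeff γ χ, c.coeFn_cellCoeff γ ψ] with y h3 h4 h5
    rw [h4, h5, ← sub_smul, ← map_smul] at h3
    rw [(c.M γ y).injective h3]
    simp
  have hmem : ψ ∈ (position c.ν j).domain := (memLp_congr_ae hae).1 (Lp.memLp χ)
  refine ⟨hmem, ?_⟩
  have : position c.ν j ⟨ψ, hmem⟩ = χ := by
    refine Lp.ext ((MemLp.coeFn_toLp (memLp_position c.ν ⟨ψ, hmem⟩)).trans hae.symm)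
  rw [this]
  exact hχ

end Crystal


lemma continuous_sub_smul {V₁ V₂ X : Type*} [TopologicalSpace X] [NormedAddCommGroup V₁]
    [NormedSpace ℂ V₁] [NormedAddCommGroup V₂] [NormedSpace ℂ V₂] {f : X → V₁ →L[ℂ] V₂}
    (hf : Continuous f) (ι : V₁ →L[ℂ] V₂) : Continuous fun p : X × ℂ => f p.1 - p.2 • ι :=
  (hf.comp continuous_fst).sub (continuous_snd.smul continuous_const)

namespace GappedModel

open Crystal

variable {d N : ℕ} {c : Crystal d N} (m : GappedModel c)

/-! ## The fibres of the resolvent -/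

/-- The fibres of the Hamiltonian as bounded operators from `𝓓_f` to `𝓗_f`. -/
noncomputable def fibMap : Space d → (GraphDomain (m.fib 0) →L[ℂ] c.Hf) := m.fib_smooth.choose

lemma contDiff_fibMap : ContDiff ℝ ∞ m.fibMap := m.fib_smooth.choose_spec.1

lemma continuous_fibMap : Continuous m.fibMap := m.contDiff_fibMap.continuous

lemma fibMap_apply (k : Space d) (v : GraphDomain (m.fib 0)) :
    ∃ h : m.inclD v ∈ (m.fib k).domain, m.fibMap k v = m.fib k ⟨m.inclD v, h⟩ :=
  m.fib_smooth.choose_spec.2.1 k v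

lemma fibMap_cov {g : Space d} (hg : g ∈ c.dual) (k : Space d) {v w : GraphDomain (m.fib 0)}
    (h : m.inclD w = c.rho g (m.inclD v)) : m.fibMap (k + g) w = c.rho g (m.fibMap k v) :=
  m.fib_smooth.choose_spec.2.2.1 g hg k v w h

lemma fibMap_isBFZ {ψ : c.H} {φ : Space d → GraphDomain (m.fib 0)}
    (hφ : MemLp φ 2 (volume.restrict c.brillouin)) (h : c.IsBFZ ψ fun k => m.inclD (φ k)) :
    ∃ h : ψ ∈ m.H₀.domain, c.IsBFZ (m.H₀ ⟨ψ, h⟩) fun k => m.fibMap k (φ k) :=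
  m.fib_smooth.choose_spec.2.2.2 ψ φ hφ h

lemma inclD_mem (v : GraphDomain (m.fib 0)) : m.inclD v ∈ (m.fib 0).domain :=
  (m.fibMap_apply 0 v).1

lemma exists_inclD_eq {v : c.Hf} (hv : v ∈ (m.fib 0).domain) :
    ∃ w : GraphDomain (m.fib 0), m.inclD w = v :=
  ⟨⟨(v, m.fib 0 ⟨v, hv⟩), (m.fib 0).mem_graph ⟨v, hv⟩⟩, rfl⟩

lemma inclD_injective : Function.Injective m.inclD := by
  rintro ⟨⟨x, y⟩, h⟩ ⟨⟨x', y'⟩, h'⟩ (rfl : x = x')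
  have : y = y' := by
    obtain ⟨u, hu1, hu2⟩ := (LinearPMap.mem_graph_iff _).1 h
    obtain ⟨u', hu1', hu2'⟩ := (LinearPMap.mem_graph_iff _).1 h'
    have : u = u' := Subtype.ext (hu1.trans hu1'.symm)
    subst this
    exact hu2.symm.trans hu2'
  subst this
  rfl

instance : CompleteSpace (GraphDomain (m.fib 0)) :=
  ((m.fib_selfAdjoint 0).isClosed :
    IsClosed ((m.fib 0).graph : Set (c.Hf × c.Hf))).completeSpace_coe

lemma exists_rho_inclD {g : Space d} (hg : g ∈ c.dual) (v : GraphDomain (m.fib 0)) :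
    ∃ w : GraphDomain (m.fib 0), m.inclD w = c.rho g (m.inclD v) :=
  m.exists_inclD_eq (m.rho_mem g hg _ (m.inclD_mem v))

/-- Test vectors localized in momentum: constant on Q within the zone and extended by equivariance.
Keeping values in 𝓓_f uses its invariance under ϱ. -/
lemma exists_isBFZ_indicator {Q : Set (Space d)} (hQ : MeasurableSet Q) (v : GraphDomain (m.fib 0)) :
    ∃ (φ : Space d → GraphDomain (m.fib 0)) (ψ : c.H), MemLp φ 2 (volume.restrict c.brillouin) ∧
      c.IsBFZ ψ (fun k => m.inclD (φ k)) ∧ ∀ k ∈ c.brillouin, φ k = Q.indicator (fun _ => v) k := by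
  classical
  have hex : ∀ k, ∃ w : GraphDomain (m.fib 0), m.inclD w =
      c.equivExt (fun k => m.inclD (Q.indicator (fun _ => v) k)) k := fun k =>
    m.exists_rho_inclD (c.dualFloor_mem k) _
  choose w hw using hex
  have hwB : ∀ k ∈ c.brillouin, w k = Q.indicator (fun _ => v) k := fun k hk => by
    apply m.inclD_injective
    rw [hw, equivExt_of_mem _ hk]
  have hmem : MemLp w 2 (volume.restrict c.brillouin) := by
    have hm : MemLp (Q.indicator fun _ => v) 2 (volume.restrict c.brillouin) :=
      memLp_indicator_const 2 hQ v (Or.inr (measure_lt_top _ Q).ne)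
    refine (memLp_congr_ae ?_).2 hm
    filter_upwards [ae_restrict_mem c.measurableSet_brillouin] with k hk
    exact hwB k hk
  have hmem' : MemLp (fun k => m.inclD (w k)) 2 (volume.restrict c.brillouin) :=
    m.inclD.comp_memLp' hmem
  obtain ⟨ψ, hψ⟩ := exists_of_memLp hmem' fun g hg k => by
    rw [hw, hw, equivExt_add _ hg]
  exact ⟨w, ψ, hmem, hψ, hwB⟩

/-- The lower bound for H₀ - z on the vectors localized in Q, rewritten by Plancherel, is an
inequality of integrals over every measurable Q, hence of integrands almost everywhere. -/
lemma ae_norm_sq_inclD_le {z : ℂ} (hz : z ∈ resolventSet m.H₀) (v : GraphDomain (m.fib 0)) :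
    ∀ᵐ k ∂volume.restrict c.brillouin,
      ‖m.inclD v‖ ^ 2 ≤ ‖resolvent m.H₀ z‖ ^ 2 * ‖m.fibMap k v - z • m.inclD v‖ ^ 2 := by
  set C := ‖resolvent m.H₀ z‖
  have hcont : Continuous fun k => C ^ 2 * ‖m.fibMap k v - z • m.inclD v‖ ^ 2 := by
    have := m.continuous_fibMap
    fun_prop
  have hint : ∀ {f : Space d → ℝ}, Continuous f → Integrable f (volume.restrict c.brillouin) :=
    fun hf => (memLp_of_continuous hf).integrable (by norm_num)
  refine ae_le_of_forall_setIntegral_le (integrable_const _) (hint hcont) fun Q hQ _ => ?_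
  obtain ⟨φ, ψ, hφ, hψ, hφQ⟩ := m.exists_isBFZ_indicator hQ v
  obtain ⟨hdom, hH⟩ := m.fibMap_isBFZ hφ hψ
  have h2 := (hH.sub (hψ.smul z)).norm_sq
  have h3 := hψ.norm_sq
  have h4 := pow_le_pow_left₀ (norm_nonneg _) (norm_le_of_mem_resolventSet hz ⟨ψ, hdom⟩) 2
  rw [mul_pow, h2, h3, mul_left_comm] at h4
  have h5 := le_of_mul_le_mul_left h4 c.bzNorm_pos
  rw [← integral_const_mul] at h5
  rw [← integral_indicator hQ, ← integral_indicator hQ]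
  refine (Eq.le ?_).trans (h5.trans (Eq.le ?_))
  · refine setIntegral_congr_fun c.measurableSet_brillouin fun k hk => ?_
    by_cases hkQ : k ∈ Q <;> simp [hkQ, hφQ k hk]
  · refine setIntegral_congr_fun c.measurableSet_brillouin fun k hk => ?_
    by_cases hkQ : k ∈ Q <;> simp [hkQ, hφQ k hk, C]

lemma ae_norm_inclD_le {z : ℂ} (hz : z ∈ resolventSet m.H₀) :
    ∀ᵐ k ∂volume.restrict c.brillouin, ∀ v,
      ‖m.inclD v‖ ≤ ‖resolvent m.H₀ z‖ * ‖m.fibMap k v - z • m.inclD v‖ := by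
  set C := ‖resolvent m.H₀ z‖
  have h3 := ae_all_iff.2 fun n => m.ae_norm_sq_inclD_le hz (TopologicalSpace.denseSeq (GraphDomain (m.fib 0)) n)
  filter_upwards [h3] with k hk
  have h4 : IsClosed {v | ‖m.inclD v‖ ≤ C * ‖m.fibMap k v - z • m.inclD v‖} :=
    isClosed_le (by fun_prop) (by fun_prop)
  have h5 : closure (range (TopologicalSpace.denseSeq (GraphDomain (m.fib 0)))) ⊆
      {v | ‖m.inclD v‖ ≤ C * ‖m.fibMap k v - z • m.inclD v‖} := h4.closure_subset_iff.2 (by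
    rintro _ ⟨n, rfl⟩
    have h6 := hk n
    rw [← mul_pow] at h6
    exact (sq_le_sq₀ (norm_nonneg _) (by positivity)).1 h6)
  rw [(TopologicalSpace.denseRange_denseSeq _).closure_range] at h5
  exact fun v => h5 (mem_univ v)

lemma norm_sub_cov {z : ℂ} {g : Space d} (hg : g ∈ c.dual) (k : Space d)
    (v : GraphDomain (m.fib 0)) : ∃ w, ‖m.inclD v‖ = ‖m.inclD w‖ ∧
      ‖m.fibMap (k + g) v - z • m.inclD v‖ = ‖m.fibMap k w - z • m.inclD w‖ := by
  obtain ⟨w, hw⟩ := m.exists_rho_inclD (c.neg_mem_dual hg) v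
  have hw' : m.inclD v = c.rho g (m.inclD w) := by
    rw [hw, rho_eq, rho_eq, neg_neg, wave_neg_apply]
  refine ⟨w, ?_, ?_⟩
  · rw [hw', rho_eq, norm_wave_apply]
  · rw [m.fibMap_cov hg k hw', hw', ← map_smul, ← map_sub, rho_eq, norm_wave_apply]

/-- Vectors of the resolvent set of `H₀` satisfy a lower bound in all fibres. -/
lemma norm_inclD_le {z : ℂ} (hz : z ∈ resolventSet m.H₀) (k : Space d) (v : GraphDomain (m.fib 0)) :
    ‖m.inclD v‖ ≤ ‖resolvent m.H₀ z‖ * ‖m.fibMap k v - z • m.inclD v‖ := by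
  have h2 := m.ae_norm_inclD_le hz
  have h3 : ∀ᵐ k, ∀ v, ‖m.inclD v‖ ≤ ‖resolvent m.H₀ z‖ * ‖m.fibMap k v - z • m.inclD v‖ := by
    refine c.ae_of_forall_brillouin fun g hg => ?_
    filter_upwards [h2] with k hk v
    obtain ⟨w, h1, h2⟩ := m.norm_sub_cov (z := z) hg k v
    rw [h1, h2]
    exact hk w
  have h4 := isClosed_le (f := fun _ : Space d => ‖m.inclD v‖)
    (g := fun k => ‖resolvent m.H₀ z‖ * ‖m.fibMap k v - z • m.inclD v‖) continuous_const
    (by have := m.continuous_fibMap; fun_prop)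
  -- A set of full measure is dense and the set where the bound holds is closed, by continuity of
  -- the fibres. The bound thus holds at every momentum.
  have h5 : Dense {k | ‖m.inclD v‖ ≤ ‖resolvent m.H₀ z‖ * ‖m.fibMap k v - z • m.inclD v‖} :=
    Measure.dense_of_ae (h3.mono fun k hk => hk v)
  have h6 := h4.closure_eq.symm.trans h5.closure_eq
  exact (Set.ext_iff.1 h6 k).2 trivial

/-- The fibres of `H₀ - z`. -/
noncomputable def fibSub (k : Space d) (z : ℂ) : GraphDomain (m.fib 0) →L[ℂ] c.Hf :=
  m.fibMap k - z • m.inclD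

/-- The fibres of `(H₀ - z)⁻¹`, with values in `𝓓_f`. -/
noncomputable def fibRes (k : Space d) (z : ℂ) : c.Hf →L[ℂ] GraphDomain (m.fib 0) :=
  (m.fibSub k z).inverse

/-- The uniform lower bound gives injectivity. For the self-adjoint fibre it also puts z in the
resolvent set, by `mem_resolventSet_of_bound`, which gives surjectivity. -/
lemma isInvertible_fibSub {z : ℂ} (hz : z ∈ resolventSet m.H₀) (k : Space d) :
    (m.fibSub k z).IsInvertible := by
  have hdom : ∀ v : (m.fib k).domain, ∃ w : GraphDomain (m.fib 0), m.inclD w = v ∧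
      m.fibMap k w = m.fib k v := fun v => by
    obtain ⟨w, hw⟩ := m.exists_inclD_eq (v := v) (by rw [← m.fib_domain k]; exact v.2)
    obtain ⟨h, h'⟩ := m.fibMap_apply k w
    refine ⟨w, hw, h'.trans (congrArg _ (Subtype.ext hw))⟩
  have hk : z ∈ resolventSet (m.fib k) := by
    refine mem_resolventSet_of_bound (m.fib_selfAdjoint k) (C := ‖resolvent m.H₀ z‖) fun v => ?_
    obtain ⟨w, hw1, hw2⟩ := hdom v
    rw [← hw1, ← hw2]
    exact m.norm_inclD_le hz k w
  have hR := isResolventAt_resolvent hk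
  have hinj : (m.fibSub k z : GraphDomain (m.fib 0) →ₗ[ℂ] c.Hf).ker = ⊥ := by
    refine LinearMap.ker_eq_bot'.2 fun v hv => ?_
    have h1 := m.norm_inclD_le hz k v
    rw [show m.fibMap k v - z • m.inclD v = 0 from hv, norm_zero, mul_zero, norm_le_zero_iff] at h1
    exact m.inclD_injective (h1.trans (map_zero _).symm)
  have hsurj : (m.fibSub k z : GraphDomain (m.fib 0) →ₗ[ℂ] c.Hf).range = ⊤ := by
    refine LinearMap.range_eq_top.2 fun v => ?_
    obtain ⟨w, hw1, hw2⟩ := hdom ⟨_, hR.mem_domain v⟩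
    refine ⟨w, ?_⟩
    change m.fibMap k w - z • m.inclD w = v
    rw [hw1, hw2, hR.apply, add_sub_cancel_right]
  exact ⟨ContinuousLinearEquiv.ofBijective _ hinj hsurj, rfl⟩

variable {m} in
lemma fibSub_fibRes {z : ℂ} (hz : z ∈ resolventSet m.H₀) (k : Space d) (v : c.Hf) :
    m.fibSub k z (m.fibRes k z v) = v := by
  obtain ⟨e, he⟩ := m.isInvertible_fibSub hz k
  rw [fibRes, ← he, ContinuousLinearMap.inverse_equiv]
  exact e.apply_symm_apply v

variable {m} in
lemma fibRes_fibSub {z : ℂ} (hz : z ∈ resolventSet m.H₀) (k : Space d) (v : GraphDomain (m.fib 0)) :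
    m.fibRes k z (m.fibSub k z v) = v := by
  obtain ⟨e, he⟩ := m.isInvertible_fibSub hz k
  rw [fibRes, ← he, ContinuousLinearMap.inverse_equiv]
  exact e.symm_apply_apply v

variable {m} in
-- Inversion is continuous at invertible operators. Joint continuity in momentum and spectral
-- parameter is needed for the contour integrals.
lemma continuousAt_fibRes {z : ℂ} (hz : z ∈ resolventSet m.H₀) (k : Space d) :
    ContinuousAt (fun p : Space d × ℂ => m.fibRes p.1 p.2) (k, z) := by
  have h1 : ContinuousAt ContinuousLinearMap.inverse (m.fibSub k z) :=
    ((m.isInvertible_fibSub hz k).contDiffAt_map_inverse (n := 0)).continuousAt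
  have h2 : Continuous fun p : Space d × ℂ => m.fibSub p.1 p.2 :=
    continuous_sub_smul m.continuous_fibMap m.inclD
  exact ContinuousAt.comp (f := fun p : Space d × ℂ => m.fibSub p.1 p.2) h1 h2.continuousAt

variable {m} in
lemma continuous_fibRes {z : ℂ} (hz : z ∈ resolventSet m.H₀) : Continuous fun k => m.fibRes k z :=
  continuous_iff_continuousAt.2 fun k =>
    ContinuousAt.comp (f := fun k : Space d => (k, z)) (continuousAt_fibRes hz k) (by fun_prop)

variable {m} in
lemma inclD_fibRes_cov {z : ℂ} (hz : z ∈ resolventSet m.H₀) {g : Space d} (hg : g ∈ c.dual)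
    (k : Space d) (v : c.Hf) :
    m.inclD (m.fibRes (k + g) z (c.rho g v)) = c.rho g (m.inclD (m.fibRes k z v)) := by
  obtain ⟨w, hw⟩ := m.exists_rho_inclD hg (m.fibRes k z v)
  have h1 : m.fibSub (k + g) z w = c.rho g v := by
    change m.fibMap (k + g) w - z • m.inclD w = _
    rw [m.fibMap_cov hg k hw, hw, ← map_smul, ← map_sub]
    exact congrArg _ (fibSub_fibRes hz k v)
  rw [← h1, fibRes_fibSub hz, hw]

variable {m} in
-- Inverting fibrewise produces a field with values in 𝓓_f, whose inverse transform χ lies in the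
-- domain and solves (H₀ - z) χ = ψ. Uniqueness of the solution identifies χ with the resolvent.
lemma fibered_resolvent {z : ℂ} (hz : z ∈ resolventSet m.H₀) :
    Fibered (resolvent m.H₀ z) fun k => m.inclD ∘L m.fibRes k z := by
  intro ψ φ h
  have hc := continuous_fibRes hz
  have hm : MemLp (fun k => m.fibRes k z (φ k)) 2 (volume.restrict c.brillouin) :=
    memLp_clm_apply hc h.memLp
  obtain ⟨χ, hχ⟩ := exists_of_memLp (m.inclD.comp_memLp' hm) fun g hg k => by
    simp only [Function.comp_apply]
    rw [h.equiv hg, inclD_fibRes_cov hz hg]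
  obtain ⟨hdom, hH⟩ := m.fibMap_isBFZ hm hχ
  have h1 := (hH.sub (hχ.smul z)).unique h (Eventually.of_forall fun k => fibSub_fibRes hz k (φ k))
  rw [(isResolventAt_resolvent hz).eq_of_sub_smul hdom h1]
  exact hχ

end GappedModel


namespace Crystal

/-! ## Parametric integrals and inverses -/

variable {d N : ℕ} {j : Fin d}

lemma LineC1.intervalIntegral {E : Type*} [NormedAddCommGroup E] [NormedSpace ℂ E] [NormedSpace ℝ E]
    [IsScalarTower ℝ ℂ E] [CompleteSpace E]
    {F F' : Space d → ℝ → E} (hF : Continuous F.uncurry) (hF' : Continuous F'.uncurry)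
    (h : ∀ θ, LineC1 j (fun k => F k θ) (fun k => F' k θ)) (a b : ℝ) :
    LineC1 j (fun k => ∫ θ in a..b, F k θ) (fun k => ∫ θ in a..b, F' k θ) := by
  refine lineC1_iff_hasDerivAt.2
    ⟨intervalIntegral.continuous_parametric_intervalIntegral_of_continuous' hF a b,
    intervalIntegral.continuous_parametric_intervalIntegral_of_continuous' hF' a b, fun k => ?_⟩
  have hline : Continuous fun p : ℝ × ℝ => (k + p.1 • EuclideanSpace.single j (1 : ℝ), p.2) := by
    fun_prop
  obtain ⟨C, hC⟩ := ((isCompact_closedBall (0 : ℝ) 1).prod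
    (isCompact_uIcc (a := a) (b := b))).exists_bound_of_continuousOn (hF'.comp hline).continuousOn
  have hF1 : ∀ t : ℝ, Continuous fun θ => F (k + t • EuclideanSpace.single j 1) θ := fun t =>
    hF.comp (Continuous.prodMk continuous_const continuous_id)
  have hF2 : ∀ t : ℝ, Continuous fun θ => F' (k + t • EuclideanSpace.single j 1) θ := fun t =>
    hF'.comp (Continuous.prodMk continuous_const continuous_id)
  have h1 := (intervalIntegral.hasDerivAt_integral_of_dominated_loc_of_deriv_le (𝕜 := ℝ)
    (μ := volume) (a := a) (b := b) (x₀ := (0 : ℝ)) (s := Metric.ball 0 1) (bound := fun _ => C)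
    (F := fun t θ => F (k + t • EuclideanSpace.single j 1) θ)
    (F' := fun t θ => F' (k + t • EuclideanSpace.single j 1) θ)
    (Metric.ball_mem_nhds _ one_pos)
    (Eventually.of_forall fun t => (hF1 t).aestronglyMeasurable)
    ((hF1 0).intervalIntegrable _ _) (hF2 0).aestronglyMeasurable
    (Eventually.of_forall fun θ hθ t ht =>
      hC (t, θ) ⟨Metric.ball_subset_closedBall ht, uIoc_subset_uIcc hθ⟩)
    (continuous_const.intervalIntegrable _ _)
    (Eventually.of_forall fun θ _ t _ => (h θ).hasDerivAt k t)).2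
  simpa only [zero_smul, add_zero] using h1

lemma LineC1.smul_comp {V₁ V₂ V₃ : Type*} [NormedAddCommGroup V₁] [NormedSpace ℂ V₁]
    [NormedAddCommGroup V₂] [NormedSpace ℂ V₂] [NormedAddCommGroup V₃] [NormedSpace ℂ V₃]
    {f f' : Space d → V₁ →L[ℂ] V₂} (hf : LineC1 j f f') (a : ℂ) (L : V₂ →L[ℂ] V₃) :
    LineC1 j (fun k => a • (L ∘L f k)) (fun k => a • (L ∘L f' k)) :=
  hf.clm_comp (a • ContinuousLinearMap.compL ℂ V₁ V₂ V₃ L)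

/-- The difference quotient of G = f⁻¹ is -G(k + t e_j) times that of f times G(k). Only continuity
of G is needed to pass to the limit. -/
lemma LineC1.inverse {V₁ V₂ : Type*} [NormedAddCommGroup V₁] [NormedSpace ℂ V₁]
    [NormedAddCommGroup V₂] [NormedSpace ℂ V₂] {f f' : Space d → V₁ →L[ℂ] V₂}
    {G : Space d → V₂ →L[ℂ] V₁} (hf : LineC1 j f f') (hG : Continuous G)
    (h1 : ∀ k v, G k (f k v) = v) (h2 : ∀ k v, f k (G k v) = v) :
    LineC1 j G (fun k => -(G k ∘L f' k ∘L G k)) := by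
  refine ⟨hG, (hG.clm_comp (hf.2.1.clm_comp hG)).neg, fun k => ?_⟩
  have h3 := hf.2.2 k
  have h4 : Tendsto (fun t : ℝ => G (k + t • EuclideanSpace.single j 1)) (𝓝[≠] 0) (𝓝 (G k)) := by
    have : Continuous fun t : ℝ => G (k + t • EuclideanSpace.single j 1) := hG.comp (by fun_prop)
    have h5 := (this.tendsto 0).mono_left (nhdsWithin_le_nhds (s := {0}ᶜ))
    simpa using h5
  have hcomp : Continuous fun p : (V₂ →L[ℂ] V₁) × (V₁ →L[ℂ] V₂) => -(p.1 ∘L p.2 ∘L G k) :=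
    (continuous_fst.clm_comp (continuous_snd.clm_comp continuous_const)).neg
  have h5 := (hcomp.tendsto (G k, f' k)).comp (h4.prodMk_nhds h3)
  refine h5.congr fun t => ?_
  ext1 v
  simp only [Function.comp_apply, neg_apply, ContinuousLinearMap.comp_apply, smul_apply, sub_apply,
    h2, map_smul, map_sub, h1]
  rw [← smul_neg, neg_sub]

end Crystal

namespace GappedModel

open Crystal

variable {d N : ℕ} {c : Crystal d N} {m : GappedModel c} {z₀ : ℂ} {r : ℝ}

/-! ## The fibres of the Fermi projection -/

lemma circleMap_mem (hC : EnclosesBelow m.H₀ m.μ z₀ r) (θ : ℝ) :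
    circleMap z₀ r θ ∈ resolventSet m.H₀ :=
  hC.sphere_subset m.selfAdjoint m.gap (circleMap_mem_sphere z₀ hC.1.le θ)

variable (m z₀ r) in
/-- The integrand of the Riesz formula, in the fibres. -/
noncomputable def contourRes (k : Space d) (θ : ℝ) : c.Hf →L[ℂ] c.Hf :=
  deriv (circleMap z₀ r) θ • (m.inclD ∘L m.fibRes k (circleMap z₀ r θ))

lemma continuous_fibRes_circleMap (hC : EnclosesBelow m.H₀ m.μ z₀ r) :
    Continuous fun p : Space d × ℝ => m.fibRes p.1 (circleMap z₀ r p.2) :=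
  continuous_iff_continuousAt.2 fun p =>
    ContinuousAt.comp (f := fun p : Space d × ℝ => (p.1, circleMap z₀ r p.2))
      (continuousAt_fibRes (circleMap_mem hC p.2) p.1)
      (by have := continuous_circleMap z₀ r; fun_prop)

lemma continuous_deriv_circleMap : Continuous (deriv (circleMap z₀ r)) := by
  have : deriv (circleMap z₀ r) = fun θ => circleMap 0 r θ * Complex.I := by
    funext θ
    exact deriv_circleMap _ _ _
  rw [this]
  exact (continuous_circleMap 0 r).mul continuous_const

lemma continuous_contourRes (hC : EnclosesBelow m.H₀ m.μ z₀ r) :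
    Continuous (m.contourRes z₀ r).uncurry :=
  (continuous_deriv_circleMap.comp continuous_snd).smul
    (continuous_const.clm_comp (continuous_fibRes_circleMap hC))

variable (m) in
/-- The derivative of the fibres of the Hamiltonian in the direction `j`. -/
noncomputable def fibMap' (j : Fin d) (k : Space d) : GraphDomain (m.fib 0) →L[ℂ] c.Hf :=
  fderiv ℝ m.fibMap k (EuclideanSpace.single j 1)

lemma lineC1_fibMap (j : Fin d) : LineC1 j m.fibMap (m.fibMap' j) :=
  LineC1.of_contDiff m.contDiff_fibMap

variable (m z₀ r) in
/-- The derivative of `contourRes`. -/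
noncomputable def contourRes' (j : Fin d) (k : Space d) (θ : ℝ) : c.Hf →L[ℂ] c.Hf :=
  deriv (circleMap z₀ r) θ • (m.inclD ∘L (-(m.fibRes k (circleMap z₀ r θ) ∘L
    m.fibMap' j k ∘L m.fibRes k (circleMap z₀ r θ))))

lemma continuous_contourRes' (hC : EnclosesBelow m.H₀ m.μ z₀ r) (j : Fin d) :
    Continuous (m.contourRes' z₀ r j).uncurry := by
  have h1 := continuous_fibRes_circleMap hC
  have h2 := (lineC1_fibMap (m := m) j).2.1.comp
    (continuous_fst (X := Space d) (Y := ℝ))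
  exact (continuous_deriv_circleMap.comp continuous_snd).smul
    (continuous_const.clm_comp (h1.clm_comp (h2.clm_comp h1)).neg)

lemma lineC1_fibSub (z : ℂ) (j : Fin d) : LineC1 j (fun k => m.fibSub k z)
    (m.fibMap' j) :=
  (lineC1_fibMap j).sub_const (z • m.inclD)

lemma lineC1_fibRes (hC : EnclosesBelow m.H₀ m.μ z₀ r) (j : Fin d) (θ : ℝ) :
    LineC1 j (fun k => m.fibRes k (circleMap z₀ r θ))
      (fun k => -(m.fibRes k (circleMap z₀ r θ) ∘L
        m.fibMap' j k ∘L m.fibRes k (circleMap z₀ r θ))) := by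
  exact (lineC1_fibSub (circleMap z₀ r θ) j).inverse (continuous_fibRes (circleMap_mem hC θ))
    (fibRes_fibSub (circleMap_mem hC θ)) (fibSub_fibRes (circleMap_mem hC θ))

lemma lineC1_contourRes (hC : EnclosesBelow m.H₀ m.μ z₀ r) (j : Fin d) (θ : ℝ) :
    LineC1 j (fun k => m.contourRes z₀ r k θ) (fun k => m.contourRes' z₀ r j k θ) :=
  (lineC1_fibRes hC j θ).smul_comp _ _

variable (m z₀ r) in
/-- The fibres of the Fermi projection. -/
noncomputable def fibFermi (k : Space d) : c.Hf →L[ℂ] c.Hf :=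
  -(2 * Real.pi * Complex.I : ℂ)⁻¹ • ∫ θ in (0 : ℝ)..(2 * Real.pi), m.contourRes z₀ r k θ

variable (m z₀ r) in
/-- The derivatives of the fibres of the Fermi projection. -/
noncomputable def fibFermi' (j : Fin d) (k : Space d) : c.Hf →L[ℂ] c.Hf :=
  -(2 * Real.pi * Complex.I : ℂ)⁻¹ • ∫ θ in (0 : ℝ)..(2 * Real.pi), m.contourRes' z₀ r j k θ

lemma lineC1_fibFermi (hC : EnclosesBelow m.H₀ m.μ z₀ r) (j : Fin d) :
    LineC1 j (m.fibFermi z₀ r) (m.fibFermi' z₀ r j) := by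
  have h := LineC1.intervalIntegral (continuous_contourRes hC) (continuous_contourRes' hC j)
    (lineC1_contourRes hC j) 0 (2 * Real.pi)
  exact h.clm_comp (-(2 * Real.pi * Complex.I : ℂ)⁻¹ • ContinuousLinearMap.id ℂ _)

lemma continuous_fibFermi (hC : EnclosesBelow m.H₀ m.μ z₀ r) (j : Fin d) : Continuous (m.fibFermi z₀ r) :=
  (lineC1_fibFermi hC j).1

lemma fibFermi_apply (hC : EnclosesBelow m.H₀ m.μ z₀ r) (k : Space d) (v : c.Hf) :
    m.fibFermi z₀ r k v = -(2 * Real.pi * Complex.I : ℂ)⁻¹ •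
      ∫ θ in (0 : ℝ)..(2 * Real.pi), m.contourRes z₀ r k θ v := by
  have h : IntervalIntegrable (m.contourRes z₀ r k) volume 0 (2 * Real.pi) :=
    ((continuous_contourRes hC).comp
      (Continuous.prodMk continuous_const continuous_id)).intervalIntegrable _ _
  rw [fibFermi, smul_apply, ContinuousLinearMap.intervalIntegral_apply h]

lemma fibFermi_cov (hC : EnclosesBelow m.H₀ m.μ z₀ r) {g : Space d} (hg : g ∈ c.dual)
    (k : Space d) (v : c.Hf) :
    m.fibFermi z₀ r (k + g) (c.rho g v) = c.rho g (m.fibFermi z₀ r k v) := by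
  have h : Continuous fun θ => m.contourRes z₀ r k θ v :=
    ((continuous_contourRes hC).comp
      (Continuous.prodMk continuous_const continuous_id)).clm_apply continuous_const
  rw [fibFermi_apply hC, fibFermi_apply hC, map_smul,
    ← ContinuousLinearMap.intervalIntegral_comp_comm _ (h.intervalIntegrable _ _)]
  congr 2
  funext θ
  simp only [contourRes, smul_apply, ContinuousLinearMap.comp_apply, map_smul]
  rw [inclD_fibRes_cov (circleMap_mem hC θ) hg]

end GappedModel


/-! ## Graphs of products and commutators -/

section Graph

variable {F : Type} [NormedAddCommGroup F] [InnerProductSpace ℂ F] {A B : F →ₗ.[ℂ] F} {ψ χ η : F}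

lemma mem_graph_iff_exists : (ψ, χ) ∈ A.graph ↔ ∃ h : ψ ∈ A.domain, A ⟨ψ, h⟩ = χ := by
  rw [LinearPMap.mem_graph_iff]
  constructor
  · rintro ⟨y, rfl, rfl⟩
    exact ⟨y.2, rfl⟩
  · rintro ⟨h, rfl⟩
    exact ⟨⟨ψ, h⟩, rfl, rfl⟩

lemma mem_graph_unique (h : (ψ, χ) ∈ A.graph) (h' : (ψ, η) ∈ A.graph) : χ = η := by
  obtain ⟨_, rfl⟩ := mem_graph_iff_exists.1 h
  obtain ⟨_, rfl⟩ := mem_graph_iff_exists.1 h'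
  rfl

lemma mem_graph_ofBdd {T : F →L[ℂ] F} : (ψ, χ) ∈ (ofBdd T).graph ↔ χ = T ψ := by
  rw [mem_graph_iff_exists]
  constructor
  · rintro ⟨_, rfl⟩
    rfl
  · rintro rfl
    exact ⟨trivial, rfl⟩

lemma mem_graph_pmul : (ψ, χ) ∈ (pmul A B).graph ↔ ∃ η, (ψ, η) ∈ B.graph ∧ (η, χ) ∈ A.graph := by
  simp only [mem_graph_iff_exists]
  constructor
  · rintro ⟨h, rfl⟩
    obtain ⟨h1, h2⟩ := mem_of_mem_pmul h
    exact ⟨_, ⟨h1, rfl⟩, h2, rfl⟩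
  · rintro ⟨_, ⟨h1, rfl⟩, h2, rfl⟩
    exact ⟨⟨⟨ψ, h1⟩, h2, rfl⟩, rfl⟩

lemma mem_graph_comm : (ψ, χ) ∈ (comm A B).graph ↔
    ∃ η₁ η₂, (∃ η, (ψ, η) ∈ B.graph ∧ (η, η₁) ∈ A.graph) ∧
      (∃ η, (ψ, η) ∈ A.graph ∧ (η, η₂) ∈ B.graph) ∧ χ = η₁ - η₂ := by
  simp only [← mem_graph_pmul]
  rw [mem_graph_iff_exists]
  constructor
  · rintro ⟨h, rfl⟩
    exact ⟨_, _, (pmul A B).mem_graph ⟨ψ, h.1⟩, (pmul B A).mem_graph ⟨ψ, h.2⟩,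
      LinearPMap.sub_apply _ _ _⟩
  · rintro ⟨η₁, η₂, h1, h2, rfl⟩
    obtain ⟨h3, rfl⟩ := mem_graph_iff_exists.1 h1
    obtain ⟨h4, rfl⟩ := mem_graph_iff_exists.1 h2
    exact ⟨⟨h3, h4⟩, LinearPMap.sub_apply _ _ _⟩

lemma mem_graph_smul (a : ℂ) (h : (ψ, χ) ∈ A.graph) : (ψ, a • χ) ∈ (a • A).graph := by
  obtain ⟨h', rfl⟩ := mem_graph_iff_exists.1 h
  exact mem_graph_iff_exists.2 ⟨h', rfl⟩

end Graph

namespace Crystal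

variable {d N : ℕ} {c : Crystal d N} {j : Fin d}

lemma mem_graph_position {φ φ' : Space d → c.Hf} (hφ : LineC1 j φ φ') {ψ : c.H}
    (hψ : c.IsBFZ ψ φ) : ∃ χ, (ψ, χ) ∈ (position c.ν j).graph ∧
      c.IsBFZ χ (fun k => Complex.I • φ' k) := by
  obtain ⟨h, h'⟩ := position_of_isBFZ hφ hψ
  exact ⟨_, (position c.ν j).mem_graph ⟨ψ, h⟩, h'⟩

variable (c j) in
/-- The vectors with a Bloch-Floquet-Zak transform that is continuously differentiable in the
direction `j`. -/
def IsLineC1 (ψ : c.H) : Prop := ∃ φ φ' : Space d → c.Hf, LineC1 j φ φ' ∧ c.IsBFZ ψ φ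

lemma IsSmoothBF.isLineC1 {ψ : c.H} (h : c.IsSmoothBF ψ) : c.IsLineC1 j ψ := by
  obtain ⟨φ, hφ, hψ⟩ := h
  exact ⟨φ, _, LineC1.of_contDiff hφ, hψ⟩

lemma IsLineC1.sub {ψ ψ' : c.H} (h : c.IsLineC1 j ψ) (h' : c.IsLineC1 j ψ') :
    c.IsLineC1 j (ψ - ψ') := by
  obtain ⟨φ, φ', h1, h2⟩ := h
  obtain ⟨ξ, ξ', h3, h4⟩ := h'
  have h5 := h1.add (h3.clm_comp (-ContinuousLinearMap.id ℂ c.Hf))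
  refine ⟨_, _, h5, ?_⟩
  simpa [sub_eq_add_neg] using h2.sub h4

/-- The commutator of a position operator with a decomposable operator. -/
lemma Fibered.comm_position {T D : c.H →L[ℂ] c.H} {A A' : Space d → c.Hf →L[ℂ] c.Hf}
    (hT : Fibered T A) (hA : LineC1 j A A') (hD : Fibered D fun k => Complex.I • A' k) {ψ : c.H}
    (hψ : c.IsLineC1 j ψ) :
    c.IsLineC1 j (T ψ) ∧ (ψ, D ψ) ∈ (comm (position c.ν j) (ofBdd T)).graph := by
  obtain ⟨φ, φ', hφ, hψ⟩ := hψ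
  have h1 := hA.clm_apply hφ
  have h2 := hT _ _ hψ
  refine ⟨⟨_, _, h1, h2⟩, ?_⟩
  obtain ⟨χ₁, h3, h4⟩ := mem_graph_position hφ hψ
  obtain ⟨χ₂, h5, h6⟩ := mem_graph_position h1 h2
  refine mem_graph_comm.2 ⟨χ₂, T χ₁, ⟨T ψ, mem_graph_ofBdd.2 rfl, h5⟩,
    ⟨χ₁, h3, mem_graph_ofBdd.2 rfl⟩, ?_⟩
  refine (hD _ _ hψ).unique (h6.sub (hT _ _ h4)) (Eventually.of_forall fun k => ?_)
  simp

/-- Conjugation by ϱ does not depend on k, so covariance A(k + g) = ϱ(g) A(k) ϱ(g)⁻¹ passes to the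
derivative. It is the fibration of the commutator with X_j. -/
lemma exists_fibered_deriv {T : c.H →L[ℂ] c.H} {A A' : Space d → c.Hf →L[ℂ] c.Hf}
    (hT : Fibered T A) (hA : LineC1 j A A') :
    ∃ D : c.H →L[ℂ] c.H, Fibered D fun k => Complex.I • A' k := by
  refine exists_fibered (hA.2.1.const_smul Complex.I) fun g hg k v => ?_
  have h1 : ∀ k, A (k + g) = c.rho g ∘L A k ∘L c.wave g := fun k => by
    ext1 w
    have := hT.cov hg k (c.wave g w)
    rw [rho_eq, wave_neg_apply] at this
    exact this
  have h2 := hA.equiv (((ContinuousLinearMap.compL ℂ c.Hf c.Hf c.Hf).flip (c.wave g)).comp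
    (ContinuousLinearMap.compL ℂ c.Hf c.Hf c.Hf (c.rho g))) h1 k
  rw [h2]
  change Complex.I • c.rho g (A' k (c.wave g (c.rho g v))) = c.rho g (Complex.I • A' k v)
  rw [rho_eq, wave_apply_neg, map_smul]

lemma integrable_prod_of_continuous {E : Type*} [NormedAddCommGroup E] {K : ℝ × Space d → E}
    (hK : Continuous K) (a b : ℝ) :
    Integrable K ((volume.restrict (uIoc a b)).prod (volume.restrict c.brillouin)) := by
  rw [Measure.prod_restrict]
  have h1 : IsCompact (uIcc a b ×ˢ closure c.brillouin) :=
    isCompact_uIcc.prod c.isCompact_closure_brillouin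
  exact (hK.continuousOn.integrableOn_compact h1).mono_set
    (prod_mono uIoc_subset_uIcc subset_closure)

end Crystal

/-! ### Fibre decomposition of the Fermi projection. -/

namespace GappedModel

open Crystal

variable {d N : ℕ} {c : Crystal d N} {m : GappedModel c} {z₀ : ℂ} {r : ℝ}

lemma cellCoeff_fermi (hC : EnclosesBelow m.H₀ m.μ z₀ r) (γ : c.Γ) (ψ : c.H) :
    c.cellCoeff γ (m.fermi ψ) = -(2 * Real.pi * Complex.I : ℂ)⁻¹ • ∫ θ in (0 : ℝ)..(2 * Real.pi),
      deriv (circleMap z₀ r) θ • c.cellCoeff γ (resolvent m.H₀ (circleMap z₀ r θ) ψ) := by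
  have h1 : m.fermi = -(2 * Real.pi * Complex.I : ℂ)⁻¹ • ∮ z in C(z₀, r), resolvent m.H₀ z := by
    rw [circleIntegral_resolvent hC m.selfAdjoint m.gap, smul_smul, neg_mul_neg,
      inv_mul_cancel₀ Complex.two_pi_I_ne_zero, one_smul]
    rfl
  set L : (c.H →L[ℂ] c.H) →L[ℂ] c.Hf :=
    (c.cellCoeff γ).comp (ContinuousLinearMap.apply ℂ c.H ψ) with hL
  have h3 := circleIntegral_clm L ((hC.continuousOn_sphere m.selfAdjoint m.gap).circleIntegrable hC.1.le)
  have h4 : c.cellCoeff γ (m.fermi ψ) = L m.fermi := rfl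
  rw [h4, h1, map_smul, ← h3]
  rfl

lemma continuous_contourRes_swap (hC : EnclosesBelow m.H₀ m.μ z₀ r) :
    Continuous fun p : ℝ × Space d => m.contourRes z₀ r p.2 p.1 :=
  Continuous.comp (g := (m.contourRes z₀ r).uncurry) (f := Prod.swap) (continuous_contourRes hC)
    continuous_swap

/-- Fubini between the contour in Riesz' formula and the Brillouin zone. Continuity of φ makes the
integrand jointly continuous, hence integrable on the product. -/
lemma fermi_cellCoeff_of_continuous (hC : EnclosesBelow m.H₀ m.μ z₀ r) {ψ : c.H}
    {φ : Space d → c.Hf} (hφ : Continuous φ) (h : c.IsBFZ ψ φ) (γ : c.Γ) :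
    c.cellCoeff γ (m.fermi ψ) = c.fourierCoeff γ fun k => c.wave k (m.fibFermi z₀ r k (φ k)) := by
  set K : ℝ × Space d → c.Hf := fun p => c.char γ p.2 • c.wave p.2
    (m.contourRes z₀ r p.2 p.1 (φ p.2)) with hK
  have hKc : Continuous K := by
    have h1 := continuous_contourRes_swap hC
    have h2 := c.continuous_wave.comp (continuous_snd (X := ℝ) (Y := Space d))
    have h3 := (c.continuous_char γ).comp (continuous_snd (X := ℝ) (Y := Space d))
    have h4 := hφ.comp (continuous_snd (X := ℝ) (Y := Space d))
    exact h3.smul (h2.clm_apply (h1.clm_apply h4))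
  have h1 : ∀ θ, deriv (circleMap z₀ r) θ •
      c.cellCoeff γ (resolvent m.H₀ (circleMap z₀ r θ) ψ) =
      c.bzNorm • ∫ k in c.brillouin, K (θ, k) := fun θ => by
    rw [(fibered_resolvent (circleMap_mem hC θ) _ _ h).cellCoeff, ← fourierCoeff_smul]
    refine congrArg (c.bzNorm • ·) (integral_congr_ae (Eventually.of_forall fun k => ?_))
    simp only [K, contourRes, smul_apply, map_smul]
  rw [cellCoeff_fermi hC, Crystal.fourierCoeff]
  simp only [h1]
  rw [intervalIntegral.integral_smul, intervalIntegral_integral_swap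
    (f := fun θ k => K (θ, k)) (integrable_prod_of_continuous hKc _ _), smul_comm, ← integral_smul]
  refine congrArg (c.bzNorm • ·) (integral_congr_ae (Eventually.of_forall fun k => ?_))
  simp only
  rw [fibFermi_apply hC, map_smul, smul_comm (c.char γ k)]
  congr 1
  have h2 : Continuous fun θ => m.contourRes z₀ r k θ (φ k) :=
    ((continuous_contourRes hC).comp
      (Continuous.prodMk continuous_const continuous_id)).clm_apply continuous_const
  have h3 := (c.char γ k • c.wave k).intervalIntegral_comp_comm (μ := volume)
    (h2.intervalIntegrable 0 (2 * Real.pi))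
  exact h3

/-- The operator built from the fibres agrees with P on vectors supported in one cell, whose
transforms are continuous. These span a dense subspace. -/
lemma fibered_fermi (hC : EnclosesBelow m.H₀ m.μ z₀ r) (j : Fin d) :
    Fibered m.fermi (m.fibFermi z₀ r) := by
  obtain ⟨T, hT⟩ := exists_fibered (continuous_fibFermi hC j) fun g hg k v => fibFermi_cov hC hg k v
  have h1 : T = m.fermi := by
    ext1 ψ
    have h2 : ∀ γ v, T (c.cellEmb γ v) = m.fermi (c.cellEmb γ v) := fun γ v => by
      have hψ := isBFZ_cellEmb γ v
      refine c.ext_cellCoeff fun γ' => ?_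
      rw [(hT _ _ hψ).cellCoeff, fermi_cellCoeff_of_continuous hC ?_ hψ]
      exact (c.continuous_char _).smul
        ((c.continuous_wave.comp continuous_neg).clm_apply continuous_const)
    have h3 := (c.hasSum_cellEmb ψ).mapL T
    have h4 := (c.hasSum_cellEmb ψ).mapL m.fermi
    simp only [h2] at h3
    exact h3.unique h4
  exact h1 ▸ hT

end GappedModel


/-! ## Hilbert-Schmidt bounds for finite rank operators -/

section FiniteRank

variable {F G : Type} [NormedAddCommGroup F] [InnerProductSpace ℂ F] [CompleteSpace F]
  [NormedAddCommGroup G] [InnerProductSpace ℂ G] [CompleteSpace G]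

lemma hsSq_lt_top_of_finiteDimensional (A : F →L[ℂ] G)
    [FiniteDimensional ℂ (LinearMap.range (A : F →ₗ[ℂ] G))] : hsSq A < ⊤ := by
  set A' : F →L[ℂ] LinearMap.range (A : F →ₗ[ℂ] G) := A.codRestrict _ fun x => ⟨x, rfl⟩
  have h1 : A = (LinearMap.range (A : F →ₗ[ℂ] G)).subtypeL ∘L A' := rfl
  rw [h1, hsSq_comp_of_norm_map _ _ fun _ => rfl, ← hsSq_adjoint,
    hsSq_eq (stdOrthonormalBasis ℂ (LinearMap.range (A : F →ₗ[ℂ] G))).toHilbertBasis, tsum_fintype]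
  exact ENNReal.sum_lt_top.2 fun _ _ => by simp [← ofReal_norm]

/-- Since P (1 - (P - Q)) = P Q and the factor is invertible with inverse R, ‖R‖ ≤ 2, one has P = P
Q R. Thus the Hilbert-Schmidt bound of Q is inherited by every idempotent near it, with constant 4 =
2². -/
lemma hsSq_le_of_idempotent {P Q : F →L[ℂ] F} (hP : P * P = P) (h : ‖P - Q‖ ≤ 1 / 2) :
    hsSq P ≤ 4 * (‖P‖ₑ ^ 2 * hsSq Q) := by
  obtain ⟨u, hu⟩ := isUnit_one_sub_of_norm_lt_one (x := P - Q) (by linarith)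
  set R : F →L[ℂ] F := ↑u⁻¹ with hR
  have h1 : (1 - (P - Q)) * R = 1 := by rw [← hu, hR, Units.mul_inv]
  have h2 : ‖R‖ ≤ 2 := by
    have h3 : R = 1 + (P - Q) * R := by
      rw [← h1, sub_mul, one_mul]
      abel
    have h4 : ‖R‖ ≤ 1 + 1 / 2 * ‖R‖ := by
      conv_lhs => rw [h3]
      refine (norm_add_le _ _).trans (add_le_add ContinuousLinearMap.norm_id_le ?_)
      exact (norm_mul_le _ _).trans (by gcongr)
    linarith
  have h3 : P = (P ∘L Q) ∘L R := by
    change P = P * Q * R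
    have h5 : P * Q = P * (1 - (P - Q)) := by
      rw [mul_sub, mul_sub, mul_one, hP]
      abel
    rw [h5, mul_assoc, h1, mul_one]
  calc hsSq P = hsSq ((P ∘L Q) ∘L R) := congrArg hsSq h3
    _ ≤ ‖R‖ₑ ^ 2 * hsSq (P ∘L Q) := hsSq_comp_le_right _ _
    _ ≤ 4 * (‖P‖ₑ ^ 2 * hsSq Q) := by
      gcongr
      · have : ‖R‖ₑ ≤ 2 := by
          rw [← ofReal_norm]
          exact ENNReal.ofReal_le_of_le_toReal (by simpa using h2)
        calc ‖R‖ₑ ^ 2 ≤ 2 ^ 2 := by gcongr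
          _ = 4 := by norm_num
      · exact hsSq_comp_le_left _ _

end FiniteRank

/-! ### The Fermi projection is Hilbert-Schmidt on the cell. -/

namespace GappedModel

open Crystal

variable {d N : ℕ} {c : Crystal d N} {m : GappedModel c} {z₀ : ℂ} {r : ℝ}

lemma fermi_mul_fermi (hC : EnclosesBelow m.H₀ m.μ z₀ r) : m.fermi * m.fermi = m.fermi :=
  hC.specProj_mul_self m.selfAdjoint m.gap

lemma fibFermi_mul_fibFermi (hC : EnclosesBelow m.H₀ m.μ z₀ r) (j : Fin d) (k : Space d) :
    m.fibFermi z₀ r k * m.fibFermi z₀ r k = m.fibFermi z₀ r k := by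
  have h := fibered_fermi hC j
  have hc := continuous_fibFermi hC j
  have h2 := h.mul h
  rw [fermi_mul_fermi hC] at h2
  exact congrFun (h2.eq_of_continuous h (hc.mul hc) hc) k

lemma fibered_of_isFibration {T : c.H →L[ℂ] c.H} {A : Space d → c.Hf →L[ℂ] c.Hf}
    (h : c.IsFibration (ofBdd T) (ContinuousLinearMap.id ℂ c.Hf) (ContinuousLinearMap.id ℂ c.Hf) A) :
    Fibered T A := fun ψ φ hψ => (h.2 ψ φ hψ.memLp hψ).2

/-- The finite rank fibration agrees with the continuous one only almost everywhere, so finite rank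
is known on a set of full measure, which is dense. -/
lemma dense_finiteDimensional (hC : EnclosesBelow m.H₀ m.μ z₀ r) (j : Fin d) :
    Dense {k | FiniteDimensional ℂ (LinearMap.range (m.fibFermi z₀ r k : c.Hf →ₗ[ℂ] c.Hf))} := by
  obtain ⟨P, hP, hfin⟩ := m.finiteRank
  refine Measure.dense_of_ae (μ := volume) ?_
  filter_upwards [(fibered_fermi hC j).ae_eq (fibered_of_isFibration hP)] with k hk
  rw [hk]
  exact hfin k

/-- Near any momentum there is one where the fibre has finite rank. `hsSq_le_of_idempotent` spreads
its finite Hilbert-Schmidt norm to a neighbourhood, and compactness makes the bound uniform. -/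
lemma exists_bound_hsSq_fibFermi (hC : EnclosesBelow m.H₀ m.μ z₀ r) (j : Fin d) :
    ∃ M < ⊤, ∀ k ∈ closure c.brillouin, hsSq (m.fibFermi z₀ r k) ≤ M := by
  refine c.isCompact_closure_brillouin.induction_on
    (p := fun s => ∃ M < ⊤, ∀ k ∈ s, hsSq (m.fibFermi z₀ r k) ≤ M) ?_ ?_ ?_ ?_
  · exact ⟨0, ENNReal.zero_lt_top, by simp⟩
  · rintro s t hst ⟨M, hM, h⟩
    exact ⟨M, hM, fun k hk => h k (hst hk)⟩
  · rintro s t ⟨M, hM, h⟩ ⟨M', hM', h'⟩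
    refine ⟨max M M', max_lt hM hM', fun k hk => ?_⟩
    rcases hk with hk | hk
    · exact (h k hk).trans (le_max_left _ _)
    · exact (h' k hk).trans (le_max_right _ _)
  · intro k₀ _
    have hc := continuous_fibFermi hC j
    -- Radius 1/4 keeps any two fibres over U within 1/2 of each other, as `hsSq_le_of_idempotent`
    -- requires.
    set U := {k | ‖m.fibFermi z₀ r k - m.fibFermi z₀ r k₀‖ < 1 / 4} with hU
    have hUo : IsOpen U := isOpen_lt (by fun_prop) continuous_const
    have hk₀ : k₀ ∈ U := by simp [hU]
    obtain ⟨k₁, hk₁, hfin⟩ := (dense_finiteDimensional hC j).inter_open_nonempty U hUo ⟨k₀, hk₀⟩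
    have hfin : FiniteDimensional ℂ (LinearMap.range (m.fibFermi z₀ r k₁ : c.Hf →ₗ[ℂ] c.Hf)) := hfin
    refine ⟨U, mem_nhdsWithin_of_mem_nhds (hUo.mem_nhds hk₀),
      4 * (ENNReal.ofReal (‖m.fibFermi z₀ r k₀‖ + 1 / 4) ^ 2 * hsSq (m.fibFermi z₀ r k₁)), ?_, ?_⟩
    · have := hsSq_lt_top_of_finiteDimensional (m.fibFermi z₀ r k₁)
      exact ENNReal.mul_lt_top (by simp) (ENNReal.mul_lt_top (by simp) this)
    · intro k hk
      have h1 : ‖m.fibFermi z₀ r k - m.fibFermi z₀ r k₁‖ ≤ 1 / 2 := by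
        have := norm_sub_le_norm_sub_add_norm_sub (m.fibFermi z₀ r k) (m.fibFermi z₀ r k₀)
          (m.fibFermi z₀ r k₁)
        rw [norm_sub_rev (m.fibFermi z₀ r k₀)] at this
        have h2 : ‖m.fibFermi z₀ r k - m.fibFermi z₀ r k₀‖ < 1 / 4 := hk
        have h3 : ‖m.fibFermi z₀ r k₁ - m.fibFermi z₀ r k₀‖ < 1 / 4 := hk₁
        linarith
      refine (hsSq_le_of_idempotent (fibFermi_mul_fibFermi hC j k) h1).trans ?_
      gcongr
      rw [← ofReal_norm]
      refine ENNReal.ofReal_le_ofReal ?_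
      have h2 : ‖m.fibFermi z₀ r k - m.fibFermi z₀ r k₀‖ < 1 / 4 := hk
      have h3 := norm_le_insert' (m.fibFermi z₀ r k) (m.fibFermi z₀ r k₀)
      linarith

/-- The Fermi projection is Hilbert-Schmidt on the fundamental cell. -/
lemma hsSq_fermi_cellEmb_lt_top (hC : EnclosesBelow m.H₀ m.μ z₀ r) (j : Fin d) :
    hsSq (m.fermi ∘L (c.cellEmb 0).toContinuousLinearMap) < ⊤ := by
  obtain ⟨M, hM, hb⟩ := exists_bound_hsSq_fibFermi hC j
  obtain ⟨w, e, -⟩ := exists_hilbertBasis ℂ c.Hf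
  have := e.countable
  have hc : ∀ i, Continuous fun k => m.fibFermi z₀ r k (c.wave (-k) (e i)) := fun i =>
    (continuous_fibFermi hC j).clm_apply
      ((c.continuous_wave.comp continuous_neg).clm_apply continuous_const)
  have h1 : ∀ i, ‖(m.fermi ∘L (c.cellEmb 0).toContinuousLinearMap) (e i)‖ₑ ^ 2 =
      ENNReal.ofReal c.bzNorm *
        ∫⁻ k in c.brillouin, ‖m.fibFermi z₀ r k (c.wave (-k) (e i))‖ₑ ^ 2 := fun i => by
    have h2 := (fibered_fermi hC j _ _ (isBFZ_cellEmb 0 (e i))).enorm_sq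
    simp only [neg_zero, char_zero, one_smul] at h2
    exact h2
  rw [hsSq_eq e]
  simp only [h1]
  rw [ENNReal.tsum_mul_left, ← lintegral_tsum fun i => ((hc i).aestronglyMeasurable.enorm.pow_const 2)]
  refine ENNReal.mul_lt_top ENNReal.ofReal_lt_top ?_
  -- After Plancherel and Tonelli, the sum over the basis is the Hilbert-Schmidt norm of one fibre,
  -- up to a unitary plane wave.
  have h3 : ∫⁻ k in c.brillouin, ∑' i, ‖m.fibFermi z₀ r k (c.wave (-k) (e i))‖ₑ ^ 2 ≤
      ∫⁻ _ in c.brillouin, M := by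
    refine setLIntegral_mono' c.measurableSet_brillouin fun k hk => ?_
    have h4 := hsSq_eq e (m.fibFermi z₀ r k ∘L c.wave (-k))
    simp only [ContinuousLinearMap.comp_apply] at h4
    rw [← h4]
    refine (hsSq_comp_le_right _ _).trans ?_
    have h5 : ‖c.wave (-k)‖ₑ ≤ 1 := by
      rw [← ofReal_norm]
      refine ENNReal.ofReal_le_one.2 (ContinuousLinearMap.opNorm_le_bound _ zero_le_one fun v => ?_)
      rw [norm_wave_apply, one_mul]
    calc ‖c.wave (-k)‖ₑ ^ 2 * hsSq (m.fibFermi z₀ r k) ≤ 1 ^ 2 * M := by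
          gcongr
          exact hb k (subset_closure hk)
      _ = M := by rw [one_pow, one_mul]
  refine h3.trans_lt ?_
  rw [lintegral_const, Measure.restrict_apply_univ]
  exact ENNReal.mul_lt_top hM c.volume_brillouin_ne_top.lt_top

/-! ## The commutator with the position operator -/

/-- The closure of `[X_j, Π₀]` is a bounded periodic operator that is off-diagonal with respect to
the Fermi projection. -/
lemma exists_comm_position_fermi (hC : EnclosesBelow m.H₀ m.μ z₀ r) (j : Fin d) :
    ∃ D : c.H →L[ℂ] c.H, m.IsClosureOfComm j D ∧
      (∀ ψ, c.IsLineC1 j ψ → (ψ, D ψ) ∈ (comm (position c.ν j) (ofBdd m.fermi)).graph) ∧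
      (∀ γ ψ, D (c.T γ ψ) = c.T γ (D ψ)) ∧ D = m.fermi * D + D * m.fermi := by
  have hP := fibered_fermi hC j
  have hP' := lineC1_fibFermi hC j
  obtain ⟨D, hD⟩ := exists_fibered_deriv hP hP'
  have hg : ∀ ψ, c.IsLineC1 j ψ → (ψ, D ψ) ∈ (comm (position c.ν j) (ofBdd m.fermi)).graph :=
    fun ψ hψ => (hP.comm_position hP' hD hψ).2
  refine ⟨D, ⟨fun ψ hψ => (mem_graph_iff_exists.1 (hg ψ hψ.isLineC1)).1, ?_⟩, hg, hD.map_T, ?_⟩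
  · have h1 : {p : c.H × c.H | c.IsSmoothBF p.1 ∧
        p ∈ (comm (position c.ν j) (ofBdd m.fermi)).graph} =
        (fun ψ => (ψ, D ψ)) '' {ψ | c.IsSmoothBF ψ} := by
      ext ⟨ψ, χ⟩
      constructor
      · rintro ⟨h1, h2⟩
        exact ⟨ψ, h1, Prod.ext rfl (mem_graph_unique (hg ψ (IsSmoothBF.isLineC1 h1)) h2)⟩
      · rintro ⟨ψ', h1, h2⟩
        obtain ⟨rfl, rfl⟩ := Prod.ext_iff.1 h2
        exact ⟨h1, hg _ (IsSmoothBF.isLineC1 h1)⟩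
    have hcont : Continuous fun ψ => (ψ, D ψ) := by fun_prop
    rw [h1]
    refine Subset.antisymm ?_ ?_
    · refine closure_minimal ?_ (isClosed_eq continuous_snd (D.continuous.comp continuous_fst))
      rintro _ ⟨ψ, -, rfl⟩
      rfl
    · rintro ⟨ψ, χ⟩ (rfl : χ = D ψ)
      exact image_closure_subset_closure_image hcont ⟨ψ, dense_isSmoothBF ψ, rfl⟩
  · refine hD.unique (A := fun k => Complex.I • m.fibFermi' z₀ r j k) ?_
    have h1 : (fun k => Complex.I • m.fibFermi' z₀ r j k) = fun k =>
        m.fibFermi z₀ r k * (Complex.I • m.fibFermi' z₀ r j k) +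
          (Complex.I • m.fibFermi' z₀ r j k) * m.fibFermi z₀ r k := by
      funext k
      ext1 v
      -- Differentiating P(k) P(k) v = P(k) v by the product rule gives P'(k) = P(k) P'(k) + P'(k)
      -- P(k).
      have h2 := hP'.clm_comp (ContinuousLinearMap.apply ℂ c.Hf v)
      have h3 := hP'.clm_apply h2
      have h4 : (fun k => m.fibFermi z₀ r k (ContinuousLinearMap.apply ℂ c.Hf v
          (m.fibFermi z₀ r k))) = fun k => ContinuousLinearMap.apply ℂ c.Hf v (m.fibFermi z₀ r k) := by
        funext k
        exact congrArg (fun A : c.Hf →L[ℂ] c.Hf => A v) (fibFermi_mul_fibFermi hC j k)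
      rw [h4] at h3
      have h5 := congrFun (h2.unique h3) k
      change Complex.I • m.fibFermi' z₀ r j k v = m.fibFermi z₀ r k (Complex.I • m.fibFermi' z₀ r j k v)
        + Complex.I • m.fibFermi' z₀ r j k (m.fibFermi z₀ r k v)
      rw [map_smul, ← smul_add, add_comm]
      exact congrArg _ h5
    rw [h1]
    exact (hP.mul hD).add (hD.mul hP)

/-! ## Periodic observables -/

lemma InPP.exists_fibered {B : c.H →L[ℂ] c.H} (hB : m.InPP B) (j : Fin d) :
    ∃ b b' : Space d → c.Hf →L[ℂ] c.Hf, LineC1 j b b' ∧ Fibered B b := by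
  obtain ⟨⟨-, b, hb, hBb⟩, -⟩ := hB
  exact ⟨b, _, LineC1.of_contDiff hb, fibered_of_isFibration hBb⟩

/-- The domain of H₀ consists of the vectors whose transform is square integrable with values in
𝓓_f, and the fibres of B act continuously on 𝓓_f. -/
lemma InPP.mem_domain {B : c.H →L[ℂ] c.H} (hB : m.InPP B) {ψ : c.H} (hψ : ψ ∈ m.H₀.domain) :
    B ψ ∈ m.H₀.domain := by
  obtain ⟨-, -, b, hb, -, hBb⟩ := hB
  obtain ⟨φ, hφ, h⟩ := m.mem_domain ψ hψ
  obtain ⟨_, h2⟩ := hBb ψ φ hφ h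
  exact (m.fibMap_isBFZ (memLp_clm_apply hb.continuous hφ) h2).1

end GappedModel


namespace Crystal

variable {d N : ℕ} {c : Crystal d N}

/-! ## Counting cells -/

/-- Union of the translates of the fundamental cell indexed by a finite set. -/
def boxUnion (c : Crystal d N) (s : Finset (Fin d → ℤ)) : Set (Space d) :=
  ⋃ n ∈ s, {x | x - (c.lattice n : Space d) ∈ c.fundCell}

lemma mem_boxUnion {s : Finset (Fin d → ℤ)} {x : Space d} :
    x ∈ c.boxUnion s ↔ (fun j => ⌊c.a.repr x j + 1 / 2⌋) ∈ s := by
  simp only [boxUnion, mem_iUnion, mem_ofPred_eq, sub_lattice_mem_fundCell_iff, exists_prop]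
  constructor
  · rintro ⟨n, hn, h⟩
    rwa [← funext h]
  · exact fun h => ⟨_, h, fun _ => rfl⟩

lemma measurableSet_transl (n : Fin d → ℤ) :
    MeasurableSet {x | x - (c.lattice n : Space d) ∈ c.fundCell} :=
  c.measurableSet_fundCell.preimage (by fun_prop)

/-- Lattice invariance of a measure. -/
def IsInvariant (c : Crystal d N) (ρ : Measure (Space d)) : Prop :=
  ∀ (γ : c.Γ) (s : Set (Space d)), MeasurableSet s → ρ {x | x - (γ : Space d) ∈ s} = ρ s

lemma IsInvariant.measure_boxUnion {ρ : Measure (Space d)} (h : c.IsInvariant ρ)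
    (s : Finset (Fin d → ℤ)) : ρ (c.boxUnion s) = s.card * ρ c.fundCell := by
  rw [boxUnion, measure_biUnion_finset]
  · simp only [h _ _ c.measurableSet_fundCell, Finset.sum_const, nsmul_eq_mul]
  · intro n _ n' _ hnn'
    rw [Function.onFun, Set.disjoint_left]
    intro x h1 h2
    simp only [mem_ofPred_eq, sub_lattice_mem_fundCell_iff] at h1 h2
    exact hnn' (funext fun j => (h1 j).trans (h2 j).symm)
  · exact fun n _ => measurableSet_transl n

lemma boxUnion_subset_cell (m : ℕ) :
    c.boxUnion (Finset.Icc (fun _ => -(m : ℤ)) (fun _ => (m : ℤ))) ⊆ c.cell (2 * m + 1) := by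
  intro x hx j
  rw [mem_boxUnion, Finset.mem_Icc] at hx
  have h1 := hx.1 j
  have h2 := hx.2 j
  simp only at h1 h2
  rw [Int.le_floor] at h1
  have h3 := Int.lt_floor_add_one (c.a.repr x j + 1 / 2)
  have h4 : ((⌊c.a.repr x j + 1 / 2⌋ : ℤ) : ℝ) ≤ m := by exact_mod_cast h2
  push_cast at h1 ⊢
  rw [abs_le]
  constructor <;> linarith

/-- The cell is closed, so its upper faces have index m + 1 in the half-open tiling. The resulting
upper count (2m + 2)^d and the lower count (2m + 1)^d have ratio tending to 1. -/
lemma cell_subset_boxUnion (m : ℕ) :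
    c.cell (2 * m + 1) ⊆ c.boxUnion (Finset.Icc (fun _ => -(m : ℤ)) (fun _ => (m : ℤ) + 1)) := by
  intro x hx
  rw [mem_boxUnion, Finset.mem_Icc]
  have h := fun j => abs_le.1 (hx j)
  push_cast at h
  refine ⟨fun j => ?_, fun j => ?_⟩
  · simp only
    rw [Int.le_floor]
    push_cast
    linarith [(h j).1]
  · simp only
    rw [← Int.lt_add_one_iff, Int.floor_lt]
    push_cast
    linarith [(h j).2]

lemma IsInvariant.measure_cell_le {ρ : Measure (Space d)} (h : c.IsInvariant ρ) (m : ℕ) :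
    ρ (c.cell (2 * m + 1)) ≤ (2 * m + 2 : ℕ) ^ d * ρ c.fundCell := by
  refine (measure_mono (cell_subset_boxUnion m)).trans_eq ?_
  rw [h.measure_boxUnion, Pi.card_Icc]
  simp only [Int.card_Icc, Finset.prod_const, Finset.card_univ, Fintype.card_fin]
  rw [show ((m : ℤ) + 1 + 1 - -(m : ℤ)).toNat = 2 * m + 2 by omega]
  push_cast
  rfl

lemma IsInvariant.le_measure_cell {ρ : Measure (Space d)} (h : c.IsInvariant ρ) (m : ℕ) :
    (2 * m + 1 : ℕ) ^ d * ρ c.fundCell ≤ ρ (c.cell (2 * m + 1)) := by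
  refine Eq.trans_le ?_ (measure_mono (boxUnion_subset_cell m))
  rw [h.measure_boxUnion, Pi.card_Icc]
  simp only [Int.card_Icc, Finset.prod_const, Finset.card_univ, Fintype.card_fin]
  rw [show ((m : ℤ) + 1 - -(m : ℤ)).toNat = 2 * m + 1 by omega]
  push_cast
  rfl

lemma IsInvariant.measure_cell_lt_top {ρ : Measure (Space d)} (h : c.IsInvariant ρ)
    (hρ : ρ c.fundCell < ⊤) (m : ℕ) : ρ (c.cell (2 * m + 1)) < ⊤ :=
  (h.measure_cell_le m).trans_lt
    (ENNReal.mul_lt_top (ENNReal.pow_lt_top (ENNReal.natCast_lt_top _)) hρ)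

/-- A squeeze between the two cell counts. Points of a discrete 𝒳 on the faces are a boundary effect
that disappears in the limit. -/
lemma IsInvariant.tendsto_real {ρ : Measure (Space d)} (h : c.IsInvariant ρ)
    (hρ : ρ c.fundCell < ⊤) :
    Tendsto (fun m : ℕ => ρ.real (c.cell (2 * m + 1)) / ((2 * m + 1 : ℕ) : ℝ) ^ d) atTop
      (𝓝 (ρ.real c.fundCell)) := by
  have h1 : Tendsto (fun m : ℕ => (1 + 1 / ((2 * m + 1 : ℕ) : ℝ)) ^ d * ρ.real c.fundCell) atTop
      (𝓝 ((1 + 0) ^ d * ρ.real c.fundCell)) := by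
    refine ((tendsto_const_nhds.add ?_).pow d).mul_const _
    exact tendsto_one_div_atTop_nhds_zero_nat.comp
      (tendsto_atTop_mono (fun m : ℕ => (by omega : m ≤ 2 * m + 1)) tendsto_id)
  rw [add_zero, one_pow, one_mul] at h1
  refine tendsto_of_tendsto_of_tendsto_of_le_of_le tendsto_const_nhds h1 (fun m => ?_) fun m => ?_
  · have h2 := ENNReal.toReal_mono (h.measure_cell_lt_top hρ m).ne (h.le_measure_cell m)
    rw [ENNReal.toReal_mul, ENNReal.toReal_pow, ENNReal.toReal_natCast] at h2
    simp only [Measure.real]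
    rw [le_div_iff₀ (by positivity), mul_comm]
    exact h2
  · have h2 := ENNReal.toReal_mono (ENNReal.mul_lt_top (ENNReal.pow_lt_top
      (ENNReal.natCast_lt_top _)) hρ).ne (h.measure_cell_le m)
    rw [ENNReal.toReal_mul, ENNReal.toReal_pow, ENNReal.toReal_natCast] at h2
    simp only [Measure.real]
    rw [div_le_iff₀ (by positivity)]
    refine h2.trans_eq ?_
    rw [show (1 : ℝ) + 1 / ((2 * m + 1 : ℕ) : ℝ) = ((2 * m + 2 : ℕ) : ℝ) / ((2 * m + 1 : ℕ) : ℝ) by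
      field_simp; push_cast; ring, div_pow]
    field_simp

lemma isInvariant_ν : c.IsInvariant c.ν := fun γ _ hs =>
  (c.measurePreserving_sub γ).measure_preimage hs.nullMeasurableSet

/-- The density of an invariant measure on large boxes. -/
lemma IsInvariant.tendsto_density {ρ : Measure (Space d)} (h : c.IsInvariant ρ)
    (hρ : ρ c.fundCell < ⊤) :
    Tendsto (fun m : ℕ => ρ.real (c.cell (2 * m + 1)) / c.ν.real (c.cell (2 * m + 1))) atTop
      (𝓝 (ρ.real c.fundCell / c.ν.real c.fundCell)) := by
  have hν : c.ν c.fundCell < ⊤ := c.measure_lt_top_of_isBounded c.isBounded_fundCell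
  -- If the cell is null, so is every box, and both quotients take the default value 0 of division
  -- by zero.
  by_cases h0 : c.ν.real c.fundCell = 0
  · have h1 : c.ν c.fundCell = 0 := (ENNReal.toReal_eq_zero_iff _).1 h0 |>.resolve_right hν.ne
    have h2 : ∀ m : ℕ, c.ν.real (c.cell (2 * m + 1)) = 0 := fun m => by
      have := c.isInvariant_ν.measure_cell_le m
      rw [h1, mul_zero] at this
      rw [Measure.real, le_zero_iff.1 this, ENNReal.toReal_zero]
    simp only [h2, h0, div_zero]
    exact tendsto_const_nhds
  · refine ((h.tendsto_real hρ).div (c.isInvariant_ν.tendsto_real hν) h0).congr fun m => ?_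
    exact div_div_div_cancel_right₀ (by positivity) _ _

/-! ## Hilbert–Schmidt densities of periodic operators -/

/-- The density `Ω ↦ ‖S χ_Ω‖²` of an operator, for the Hilbert-Schmidt norm. -/
noncomputable def hsMeasure (S : c.H →L[ℂ] c.H) : Measure (Space d) :=
  Measure.sum fun i => c.ν.withDensity
    fun x => ‖S.adjoint ((exists_hilbertBasis ℂ c.H).choose_spec.choose i) x‖ₑ ^ 2

lemma enorm_sq_chi {Ω : Set (Space d)} (hΩ : MeasurableSet Ω) (ψ : c.H) :
    ‖chi c.ν Ω hΩ ψ‖ₑ ^ 2 = ∫⁻ x in Ω, ‖ψ x‖ₑ ^ 2 ∂c.ν := by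
  rw [← lintegral_indicator hΩ, Lp.enorm_def, eLpNorm_congr_ae (coeFn_chi c.ν hΩ ψ),
    eLpNorm_eq_lintegral_rpow_enorm_toReal (by norm_num) (by norm_num)]
  simp only [ENNReal.toReal_ofNat, ENNReal.rpow_ofNat]
  rw [← ENNReal.rpow_natCast, ← ENNReal.rpow_mul]
  norm_num
  refine lintegral_congr fun x => ?_
  by_cases hx : x ∈ Ω <;> simp [hx]

/-- ‖S χ_Ω‖ = ‖χ_Ω S*‖ in Hilbert-Schmidt norm, and the latter squared is the sum over a basis of
the integrals of |S* eᵢ|² over Ω, visibly a measure in Ω. -/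
lemma hsMeasure_apply (S : c.H →L[ℂ] c.H) {Ω : Set (Space d)} (hΩ : MeasurableSet Ω) :
    hsMeasure S Ω = hsSq (S * chi c.ν Ω hΩ) := by
  have h1 : hsSq (S * chi c.ν Ω hΩ) = hsSq (chi c.ν Ω hΩ ∘L S.adjoint) := by
    rw [← hsSq_adjoint]
    congr 1
    change star (S * chi c.ν Ω hΩ) = chi c.ν Ω hΩ * star S
    rw [star_mul, (isSelfAdjoint_chi c.ν hΩ).star_eq]
  rw [h1, hsMeasure, Measure.sum_apply _ hΩ, hsSq]
  refine tsum_congr fun i => ?_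
  rw [withDensity_apply _ hΩ, ContinuousLinearMap.comp_apply, enorm_sq_chi]

/-- Bounded periodic operators. -/
def Periodic (S : c.H →L[ℂ] c.H) : Prop := ∀ γ, Commute (c.TL γ) S

lemma Periodic.mul {S R : c.H →L[ℂ] c.H} (hS : Periodic S) (hR : Periodic R) : Periodic (S * R) :=
  fun γ => (hS γ).mul_right (hR γ)

lemma Periodic.add {S R : c.H →L[ℂ] c.H} (hS : Periodic S) (hR : Periodic R) : Periodic (S + R) :=
  fun γ => (hS γ).add_right (hR γ)

lemma Periodic.sub {S R : c.H →L[ℂ] c.H} (hS : Periodic S) (hR : Periodic R) : Periodic (S - R) :=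
  fun γ => (hS γ).sub_right (hR γ)

lemma Periodic.smul {S : c.H →L[ℂ] c.H} (hS : Periodic S) (a : ℂ) : Periodic (a • S) :=
  fun γ => (hS γ).smul_right a

lemma Periodic.adjoint {S : c.H →L[ℂ] c.H} (hS : Periodic S) : Periodic S.adjoint := fun γ => by
  have h := (hS (-γ)).star_star
  change Commute (c.TL (-γ)).adjoint S.adjoint at h
  rwa [adjoint_TL, neg_neg] at h

/-- S commutes with T_γ, which carries χ_Ω to the characteristic function of the translated set, and
unitary factors do not change the Hilbert-Schmidt norm. -/
lemma Periodic.isInvariant_hsMeasure {S : c.H →L[ℂ] c.H} (hS : Periodic S) :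
    c.IsInvariant (hsMeasure S) := by
  intro γ Ω hΩ
  have hΩ' : MeasurableSet {x | x - (γ : Space d) ∈ Ω} := hΩ.preimage (by fun_prop)
  have hn : ∀ (γ : c.Γ) (x : c.H), ‖c.TL γ x‖ = ‖x‖ := fun γ x => c.norm_T γ x
  have h1 : hsSq (c.TL γ * (S * chi c.ν Ω hΩ)) = hsSq (S * chi c.ν Ω hΩ) :=
    hsSq_comp_of_norm_map _ _ (hn γ)
  have h2 : hsSq ((S * chi c.ν _ hΩ') * c.TL γ) = hsSq (S * chi c.ν _ hΩ') := by
    rw [← hsSq_adjoint, ← hsSq_adjoint (S * chi c.ν _ hΩ')]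
    change hsSq ((S * chi c.ν _ hΩ') ∘L c.TL γ).adjoint = _
    rw [ContinuousLinearMap.adjoint_comp, adjoint_TL]
    exact hsSq_comp_of_norm_map _ _ (hn _)
  rw [hsMeasure_apply _ hΩ, hsMeasure_apply _ hΩ', ← h1, ← h2, ← mul_assoc (c.TL γ) S,
    (hS γ).eq, mul_assoc S (c.TL γ), c.T_chi γ hΩ hΩ' fun x => Iff.rfl, mul_assoc]

lemma chi_fundCell : chi c.ν c.fundCell c.measurableSet_fundCell =
    (c.cellEmb 0).toContinuousLinearMap ∘L c.cellCoeff 0 := by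
  ext1 ψ
  refine Lp.ext ?_
  have h : c.cellEmb 0 (c.cellCoeff 0 ψ) = c.extend (c.restrictCell ψ) := by
    rw [cellEmb_apply, cellCoeff_apply, neg_zero, c.T_zero, c.T_zero]
  rw [ContinuousLinearMap.comp_apply, LinearIsometry.coe_toContinuousLinearMap, h]
  filter_upwards [coeFn_chi c.ν c.measurableSet_fundCell ψ, c.coeFn_extend (c.restrictCell ψ),
    (ae_restrict_iff' c.measurableSet_fundCell).1 (c.coeFn_restrictCell ψ)] with x h1 h2 h3
  rw [h1, h2]
  by_cases hx : x ∈ c.fundCell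
  · simp [hx, h3 hx]
  · simp [hx]

/-- The inclusion of the functions supported in the fundamental cell. -/
noncomputable abbrev emb (c : Crystal d N) : c.Hf →L[ℂ] c.H := (c.cellEmb 0).toContinuousLinearMap

lemma hsMeasure_fundCell (S : c.H →L[ℂ] c.H) : hsMeasure S c.fundCell = hsSq (S ∘L c.emb) := by
  rw [hsMeasure_apply _ c.measurableSet_fundCell, chi_fundCell, ← hsSq_adjoint,
    ← hsSq_adjoint (S ∘L c.emb)]
  change hsSq ((S ∘L c.emb) ∘L c.cellCoeff 0).adjoint = _
  rw [ContinuousLinearMap.adjoint_comp, cellCoeff, ContinuousLinearMap.adjoint_adjoint]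
  exact hsSq_comp_of_norm_map _ _ fun x => (c.cellEmb 0).norm_map x

lemma Periodic.hsSq_chi_lt_top {S : c.H →L[ℂ] c.H} (hS : Periodic S) (h : hsSq (S ∘L c.emb) < ⊤)
    {Ω : Set (Space d)} (hΩ : MeasurableSet Ω) (hb : Bornology.IsBounded Ω) :
    hsSq (S * chi c.ν Ω hΩ) < ⊤ := by
  rw [← hsMeasure_apply]
  have h1 : ∃ m : ℕ, Ω ⊆ c.cell (2 * m + 1) := by
    have hc : ∀ j, Continuous fun x => c.a.repr x j := fun j =>
      (c.a.coord j).continuous_of_finiteDimensional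
    have h2 : ∀ j, ∃ M : ℝ, ∀ x ∈ Ω, |c.a.repr x j| ≤ M := fun j => by
      obtain ⟨M, hM⟩ := hb.isCompact_closure.exists_bound_of_continuousOn (hc j).continuousOn
      exact ⟨M, fun x hx => hM x (subset_closure hx)⟩
    choose M hM using h2
    obtain ⟨n, hn⟩ := exists_nat_ge (∑ j, |M j|)
    refine ⟨n, fun x hx j => (hM j x hx).trans ?_⟩
    have h3 : |M j| ≤ ∑ j, |M j| :=
      Finset.single_le_sum (f := fun j => |M j|) (fun _ _ => abs_nonneg _) (Finset.mem_univ j)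
    have := le_abs_self (M j)
    push_cast
    linarith
  obtain ⟨m, hm⟩ := h1
  refine (measure_mono hm).trans_lt (hS.isInvariant_hsMeasure.measure_cell_lt_top ?_ m)
  rwa [hsMeasure_fundCell]

/-- The trace property of the Hilbert-Schmidt density. -/
lemma Periodic.hsSq_adjoint_emb {S : c.H →L[ℂ] c.H} (hS : Periodic S) :
    hsSq (S.adjoint ∘L c.emb) = hsSq (S ∘L c.emb) := by
  have key : ∀ R : c.H →L[ℂ] c.H, hsSq (R ∘L c.emb) = ∑' γ, hsSq (c.cellCoeff γ ∘L R ∘L c.emb) := by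
    intro R
    obtain ⟨w, e, -⟩ := exists_hilbertBasis ℂ c.Hf
    simp only [hsSq_eq e]
    rw [ENNReal.tsum_comm]
    refine tsum_congr fun i => ?_
    have h := c.hasSum_norm_cellCoeff_sq ((R ∘L c.emb) (e i))
    have h3 : ∀ {V : Type} [NormedAddCommGroup V] (w : V), ‖w‖ₑ ^ 2 = ENNReal.ofReal (‖w‖ ^ 2) :=
      fun w => by rw [ENNReal.ofReal_pow (norm_nonneg _), ofReal_norm]
    rw [h3, ← h.tsum_eq, ENNReal.ofReal_tsum_of_nonneg (fun _ => by positivity) h.summable]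
    refine tsum_congr fun γ => ?_
    rw [h3]
    rfl
  have hE : ∀ γ : c.Γ, (c.cellEmb γ).toContinuousLinearMap = c.TL (-γ) ∘L c.emb := fun γ => by
    ext1 v
    change c.cellEmb γ v = c.T (-γ) (c.cellEmb 0 v)
    rw [cellEmb_apply, cellEmb_apply, neg_zero, c.T_zero]
  have hCc : ∀ γ : c.Γ, c.cellCoeff γ = c.cellCoeff 0 ∘L c.TL γ := fun γ => by
    rw [cellCoeff, hE, ContinuousLinearMap.adjoint_comp, adjoint_TL, neg_neg]
    rfl
  -- By periodicity, the block of S* from the cell 0 to the cell γ is the adjoint of the block of S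
  -- from 0 to -γ. Summing over all cells, with γ replaced by -γ, gives equal norms.
  rw [key, key, ← (Equiv.neg c.Γ).tsum_eq]
  refine tsum_congr fun γ => ?_
  rw [← hsSq_adjoint (c.cellCoeff γ ∘L S ∘L c.emb)]
  congr 1
  have hγ : (c.cellCoeff γ).adjoint = (c.cellEmb γ).toContinuousLinearMap :=
    ContinuousLinearMap.adjoint_adjoint _
  rw [ContinuousLinearMap.adjoint_comp, ContinuousLinearMap.adjoint_comp, hγ, hE γ,
    Equiv.neg_apply, hCc (-γ)]
  ext1 v
  have := congrArg (fun R : c.H →L[ℂ] c.H => R (c.emb v)) (hS.adjoint (-γ)).eq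
  exact congrArg (c.cellCoeff 0) this

end Crystal


namespace Crystal

variable {d N : ℕ} {c : Crystal d N}

/-! ## Trace per unit volume of bounded periodic operators -/

/-- `A` has finite trace on bounded sets, trace `w` on the fundamental cell, and the trace per unit
volume is `w` divided by the volume of the fundamental cell. -/
def HasCellTrace (A : c.H →L[ℂ] c.H) (w : ℂ) : Prop :=
  (∀ (Ω : Set (Space d)) (hΩ : MeasurableSet Ω), Bornology.IsBounded Ω →
    IsTraceClass (chi c.ν Ω hΩ * A * chi c.ν Ω hΩ)) ∧
  HasTrace (c.emb.adjoint ∘L A ∘L c.emb) w ∧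
  ∃ s : ℕ → ℂ, (∀ m, HasTrace (chi c.ν (c.cell (2 * m + 1)) (c.measurableSet_cell _) * A *
      chi c.ν (c.cell (2 * m + 1)) (c.measurableSet_cell _)) (s m)) ∧
    Tendsto (fun m => s m / (c.ν.real (c.cell (2 * m + 1)) : ℂ)) atTop
      (𝓝 (w / (c.ν.real c.fundCell : ℂ)))

lemma HasCellTrace.add {A B : c.H →L[ℂ] c.H} {w v : ℂ} (hA : HasCellTrace A w)
    (hB : HasCellTrace B v) : HasCellTrace (A + B) (w + v) := by
  obtain ⟨h1, h2, s, h3, h4⟩ := hA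
  obtain ⟨k1, k2, t, k3, k4⟩ := hB
  refine ⟨fun Ω hΩ hb => ?_, ?_, fun m => s m + t m, fun m => ?_, ?_⟩
  · rw [mul_add, add_mul]
    exact (h1 Ω hΩ hb).add (k1 Ω hΩ hb)
  · rw [ContinuousLinearMap.add_comp, ContinuousLinearMap.comp_add]
    exact h2.add k2
  · rw [mul_add, add_mul]
    exact (h3 m).add (k3 m)
  · simp only [add_div]
    exact h4.add k4

lemma HasCellTrace.smul {A : c.H →L[ℂ] c.H} {w : ℂ} (hA : HasCellTrace A w) (a : ℂ) :
    HasCellTrace (a • A) (a * w) := by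
  obtain ⟨h1, h2, s, h3, h4⟩ := hA
  refine ⟨fun Ω hΩ hb => ?_, ?_, fun m => a * s m, fun m => ?_, ?_⟩
  · rw [mul_smul_comm, smul_mul_assoc]
    exact (h1 Ω hΩ hb).smul a
  · rw [ContinuousLinearMap.smul_comp, ContinuousLinearMap.comp_smul]
    exact h2.smul a
  · rw [mul_smul_comm, smul_mul_assoc]
    exact (h3 m).smul a
  · simp only [mul_div_assoc]
    exact h4.const_mul a

lemma HasCellTrace.sub {A B : c.H →L[ℂ] c.H} {w v : ℂ} (hA : HasCellTrace A w)
    (hB : HasCellTrace B v) : HasCellTrace (A - B) (w - v) := by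
  have := hA.add (hB.smul (-1))
  rwa [neg_one_smul, ← sub_eq_add_neg, neg_one_mul, ← sub_eq_add_neg] at this

lemma hsSq_mul_emb_lt_top {S R : c.H →L[ℂ] c.H} (h : hsSq (R ∘L c.emb) < ⊤) :
    hsSq ((S * R) ∘L c.emb) < ⊤ :=
  (hsSq_comp_le_left S (R ∘L c.emb)).trans_lt
    (ENNReal.mul_lt_top (ENNReal.pow_lt_top enorm_lt_top) h)

lemma tendsto_hsSq_density {S : c.H →L[ℂ] c.H} (hS : Periodic S) (h : hsSq (S ∘L c.emb) < ⊤) :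
    Tendsto (fun m : ℕ => (((hsSq (S * chi c.ν (c.cell (2 * m + 1))
      (c.measurableSet_cell _))).toReal : ℂ) / (c.ν.real (c.cell (2 * m + 1)) : ℂ))) atTop
      (𝓝 ((hsSq (S ∘L c.emb)).toReal / (c.ν.real c.fundCell : ℂ))) := by
  have h1 := hS.isInvariant_hsMeasure.tendsto_density (by rwa [hsMeasure_fundCell])
  have h2 := (Complex.continuous_ofReal.tendsto _).comp h1
  simp only [Function.comp_def, Measure.real, hsMeasure_fundCell,
    hsMeasure_apply _ (c.measurableSet_cell _), Complex.ofReal_div] at h2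
  exact h2

/-- Because `hsInner` is defined by polarization, it is a combination of four Hilbert-Schmidt norms
of periodic operators, each with a density as an invariant measure. -/
lemma tendsto_hsInner_density {S R : c.H →L[ℂ] c.H} (hS : Periodic S) (hR : Periodic R)
    (hS' : hsSq (S ∘L c.emb) < ⊤) (hR' : hsSq (R ∘L c.emb) < ⊤) :
    Tendsto (fun m : ℕ => hsInner (S * chi c.ν (c.cell (2 * m + 1)) (c.measurableSet_cell _))
      (R * chi c.ν (c.cell (2 * m + 1)) (c.measurableSet_cell _)) /
        (c.ν.real (c.cell (2 * m + 1)) : ℂ)) atTop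
      (𝓝 (hsInner (S ∘L c.emb) (R ∘L c.emb) / (c.ν.real c.fundCell : ℂ))) := by
  have hI : hsSq ((Complex.I • R) ∘L c.emb) < ⊤ := by
    rw [ContinuousLinearMap.smul_comp]
    exact hsSq_smul_lt_top hR' _
  have h1 := tendsto_hsSq_density (hS.add hR) (by
    rw [ContinuousLinearMap.add_comp]; exact hsSq_add_lt_top hS' hR')
  have h2 := tendsto_hsSq_density (hS.sub hR) (by
    rw [ContinuousLinearMap.sub_comp]; exact hsSq_sub_lt_top hS' hR')
  have h3 := tendsto_hsSq_density (hS.sub (hR.smul Complex.I)) (by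
    rw [ContinuousLinearMap.sub_comp]; exact hsSq_sub_lt_top hS' hI)
  have h4 := tendsto_hsSq_density (hS.add (hR.smul Complex.I)) (by
    rw [ContinuousLinearMap.add_comp]; exact hsSq_add_lt_top hS' hI)
  rw [ContinuousLinearMap.add_comp] at h1
  rw [ContinuousLinearMap.sub_comp] at h2
  rw [ContinuousLinearMap.sub_comp, ContinuousLinearMap.smul_comp] at h3
  rw [ContinuousLinearMap.add_comp, ContinuousLinearMap.smul_comp] at h4
  simp only [add_mul] at h1 h4
  simp only [sub_mul] at h2 h3
  simp only [smul_mul_assoc] at h3 h4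
  have h5 := ((h1.sub h2).add ((h3.sub h4).mul_const Complex.I)).div_const 4
  rw [← sub_div, ← sub_div, div_mul_eq_mul_div, ← add_div, div_right_comm] at h5
  refine h5.congr fun m => ?_
  rw [← sub_div, ← sub_div, div_mul_eq_mul_div, ← add_div, div_right_comm, hsInner]

/-- The trace of a product of periodic operators on the fundamental cell. -/
lemma hasCellTrace_adjoint_mul {S R : c.H →L[ℂ] c.H} (hS : Periodic S) (hR : Periodic R)
    (hS' : hsSq (S ∘L c.emb) < ⊤) (hR' : hsSq (R ∘L c.emb) < ⊤) :
    HasCellTrace (S.adjoint * R) (hsInner (S ∘L c.emb) (R ∘L c.emb)) := by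
  have key : ∀ (Ω : Set (Space d)) (hΩ : MeasurableSet Ω), Bornology.IsBounded Ω →
      HasTrace (chi c.ν Ω hΩ * (S.adjoint * R) * chi c.ν Ω hΩ)
        (hsInner (S * chi c.ν Ω hΩ) (R * chi c.ν Ω hΩ)) := fun Ω hΩ hb => by
    have h := hasTrace_adjoint_comp (hS.hsSq_chi_lt_top hS' hΩ hb) (hR.hsSq_chi_lt_top hR' hΩ hb)
    have h2 : (S * chi c.ν Ω hΩ).adjoint = chi c.ν Ω hΩ * S.adjoint := by
      change star (S * chi c.ν Ω hΩ) = _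
      rw [star_mul, (isSelfAdjoint_chi c.ν hΩ).star_eq]
      rfl
    rw [h2] at h
    convert! h using 1
  refine ⟨fun Ω hΩ hb => (key Ω hΩ hb).1, ?_, _,
    fun m => key _ (c.measurableSet_cell _) (c.isBounded_cell _), ?_⟩
  · have h := hasTrace_adjoint_comp hS' hR'
    rw [ContinuousLinearMap.adjoint_comp] at h
    exact h
  · exact tendsto_hsInner_density hS hR hS' hR'

/-- Polarization of `Periodic.hsSq_adjoint_emb`. The adjoint is antilinear, so after factoring out a
unit scalar each of the four norms becomes the corresponding one with S* and R* exchanged. -/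
lemma hsInner_adjoint_emb {S R : c.H →L[ℂ] c.H} (hS : Periodic S) (hR : Periodic R) :
    hsInner (S ∘L c.emb) (R ∘L c.emb) = hsInner (R.adjoint ∘L c.emb) (S.adjoint ∘L c.emb) := by
  have h1 := (hS.add hR).hsSq_adjoint_emb
  have h2 := (hS.sub hR).hsSq_adjoint_emb
  have h3 := (hS.sub (hR.smul Complex.I)).hsSq_adjoint_emb
  have h4 := (hS.add (hR.smul Complex.I)).hsSq_adjoint_emb
  have hneg : ∀ A : c.Hf →L[ℂ] c.H, hsSq (-A) = hsSq A := fun A => by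
    have := hsSq_smul_unit A (c := -1) (by simp)
    rwa [neg_one_smul] at this
  have e2 : (S - R).adjoint ∘L c.emb = -(R.adjoint ∘L c.emb - S.adjoint ∘L c.emb) := by
    rw [map_sub, ContinuousLinearMap.sub_comp, neg_sub]
  have e3 : (S - Complex.I • R).adjoint ∘L c.emb =
      Complex.I • (R.adjoint ∘L c.emb - Complex.I • (S.adjoint ∘L c.emb)) := by
    rw [map_sub, map_smulₛₗ, smul_sub, smul_smul, Complex.I_mul_I]
    ext1 v
    simp
    abel
  have e4 : (S + Complex.I • R).adjoint ∘L c.emb =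
      (-Complex.I) • (R.adjoint ∘L c.emb + Complex.I • (S.adjoint ∘L c.emb)) := by
    rw [map_add, map_smulₛₗ, smul_add, smul_smul, neg_mul, Complex.I_mul_I]
    ext1 v
    simp
    abel
  rw [map_add, add_comm, ContinuousLinearMap.add_comp] at h1
  rw [e2, hneg] at h2
  rw [e3, hsSq_smul_unit _ (by simp)] at h3
  rw [e4, hsSq_smul_unit _ (by simp)] at h4
  rw [hsInner, hsInner, h1, h2, h3, h4]
  simp only [ContinuousLinearMap.add_comp, ContinuousLinearMap.sub_comp,
    ContinuousLinearMap.smul_comp]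

/-! ### Cyclicity of the trace on the cell in the presence of a projection. -/

section Projection

variable {P : c.H →L[ℂ] c.H}

/-- The trace of `P Z P` on the fundamental cell. -/
noncomputable def cellTrace (P Z : c.H →L[ℂ] c.H) : ℂ := hsInner (P ∘L c.emb) ((Z * P) ∘L c.emb)

variable (hsa : IsSelfAdjoint P) (hP : Periodic P) (hfin : hsSq (P ∘L c.emb) < ⊤)
include hsa hP hfin

lemma hasTrace_cellTrace (Z : c.H →L[ℂ] c.H) :
    HasTrace (c.emb.adjoint ∘L (P * Z * P) ∘L c.emb) (cellTrace P Z) := by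
  have h := hasTrace_adjoint_comp hfin (hsSq_mul_emb_lt_top (S := Z) hfin)
  rw [ContinuousLinearMap.adjoint_comp, show P.adjoint = P from hsa] at h
  exact h

lemma cellTrace_add (Z W : c.H →L[ℂ] c.H) :
    cellTrace P (Z + W) = cellTrace P Z + cellTrace P W := by
  refine (hasTrace_cellTrace hsa hP hfin _).unique ?_
  have := (hasTrace_cellTrace hsa hP hfin Z).add (hasTrace_cellTrace hsa hP hfin W)
  rw [mul_add, add_mul, ContinuousLinearMap.add_comp, ContinuousLinearMap.comp_add]
  exact this

lemma cellTrace_smul (a : ℂ) (Z : c.H →L[ℂ] c.H) : cellTrace P (a • Z) = a * cellTrace P Z := by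
  refine (hasTrace_cellTrace hsa hP hfin _).unique ?_
  have := (hasTrace_cellTrace hsa hP hfin Z).smul a
  rw [mul_smul_comm, smul_mul_assoc, ContinuousLinearMap.smul_comp, ContinuousLinearMap.comp_smul]
  exact this

lemma cellTrace_congr {Z W : c.H →L[ℂ] c.H} (h : P * Z * P = P * W * P) :
    cellTrace P Z = cellTrace P W := by
  have h1 := hasTrace_cellTrace hsa hP hfin Z
  rw [h] at h1
  exact h1.unique (hasTrace_cellTrace hsa hP hfin W)

/-- The cyclicity of the trace on the fundamental cell. -/
lemma hasCellTrace_mul_mul (hPP : P * P = P) {X Y : c.H →L[ℂ] c.H} (hX : Periodic X)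
    (hY : Periodic Y) : HasCellTrace (X * P * Y) (cellTrace P (Y * X)) := by
  -- Only right multiples of P are a priori Hilbert-Schmidt on the cell. Passing to the adjoint
  -- handles P Z, since its adjoint Z* P ends in P.
  have hf : ∀ {Z : c.H →L[ℂ] c.H}, Periodic Z → hsSq ((P * Z) ∘L c.emb) < ⊤ := fun {Z} hZ => by
    rw [← (hP.mul hZ).hsSq_adjoint_emb]
    change hsSq (star (P * Z) ∘L c.emb) < ⊤
    rw [star_mul, hsa.star_eq]
    exact hsSq_mul_emb_lt_top hfin
  -- X P Y = (P X*)* (P Y) is a product of two operators that are Hilbert-Schmidt on the cell.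
  -- Exchanging adjoints then moves the inner product to Y* P and X P, that is, to the trace of P Y
  -- X P.
  have h := hasCellTrace_adjoint_mul (hP.mul hX.adjoint) (hP.mul hY) (hf hX.adjoint) (hf hY)
  have h1 : (P * X.adjoint).adjoint = X * P := by
    change star (P * star X) = X * P
    rw [star_mul, star_star, hsa.star_eq]
  have h2 : (P * Y).adjoint = Y.adjoint * P := by
    change star (P * Y) = star Y * P
    rw [star_mul, hsa.star_eq]
  have h3 : X * P * (P * Y) = X * P * Y := by rw [← mul_assoc, mul_assoc X P P, hPP]
  have h4 := hasTrace_adjoint_comp (hsSq_mul_emb_lt_top (S := Y.adjoint) hfin)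
    (hsSq_mul_emb_lt_top (S := X) hfin)
  rw [hsInner_adjoint_emb (hP.mul hX.adjoint) (hP.mul hY), h1, h2, h3] at h
  have h5 : hsInner ((Y.adjoint * P) ∘L c.emb) ((X * P) ∘L c.emb) = cellTrace P (Y * X) := by
    refine h4.unique ?_
    have h6 := hasTrace_cellTrace hsa hP hfin (Y * X)
    have h7 : (Y.adjoint * P).adjoint = P * Y := by
      change star (star Y * P) = P * Y
      rw [star_mul, star_star, hsa.star_eq]
    rw [ContinuousLinearMap.adjoint_comp, h7]
    exact h6
  rwa [h5] at h

/-- The cyclicity of `cellTrace` for operators that are supported on one side by `P`. -/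
lemma cellTrace_mul_comm (hPP : P * P = P) {X Z : c.H →L[ℂ] c.H} (hX : Periodic X)
    (hZ : Periodic Z) (hXP : X * P = X) (hPX : P * X = X) :
    cellTrace P (X * Z) = cellTrace P (Z * X) := by
  have h := (hasCellTrace_mul_mul hsa hP hfin hPP hX (hZ.mul hP)).2.1
  have h1 := hasTrace_cellTrace hsa hP hfin (X * Z)
  have h2 : P * (X * Z) * P = X * P * (Z * P) := by rw [← mul_assoc, hPX, hXP, mul_assoc]
  have h3 : Z * P * X = Z * X := by rw [mul_assoc, hPX]
  rw [h3] at h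
  rw [h2] at h1
  exact h1.unique h

end Projection

/-- A partially defined operator that agrees with a bounded one on compactly supported vectors has
the same trace per unit volume. -/
lemma HasCellTrace.hasTau {A : c.H →L[ℂ] c.H} {w : ℂ} (h : HasCellTrace A w) {T : c.H →ₗ.[ℂ] c.H}
    (hT : ∀ (Ω : Set (Space d)) (hΩ : MeasurableSet Ω), Bornology.IsBounded Ω → ∀ ψ,
      (chi c.ν Ω hΩ ψ, A (chi c.ν Ω hΩ ψ)) ∈ T.graph) :
    c.HasTau T (w / (c.ν.real c.fundCell : ℂ)) := by
  have key : ∀ (Ω : Set (Space d)) (hΩ : MeasurableSet Ω), Bornology.IsBounded Ω →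
      c.IsCompression T Ω hΩ (chi c.ν Ω hΩ * A * chi c.ν Ω hΩ) := fun Ω hΩ hb ψ => by
    obtain ⟨h1, h2⟩ := mem_graph_iff_exists.1 (hT Ω hΩ hb ψ)
    refine ⟨h1, ?_⟩
    rw [h2]
    rfl
  obtain ⟨h1, -, s, h3, h4⟩ := h
  exact ⟨fun K hK => ⟨_, key K hK.measurableSet hK.isBounded, h1 K hK.measurableSet hK.isBounded⟩,
    _, s, fun m => ⟨key _ _ (c.isBounded_cell _), h3 m⟩, h4⟩

end Crystal


/-! ### Domains, commuting operators and spectral projections. -/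

section Domain

variable {F : Type} [NormedAddCommGroup F] [InnerProductSpace ℂ F] [CompleteSpace F]
  {A : F →ₗ.[ℂ] F} {μ : ℝ} {c : ℂ} {r : ℝ}

/-- A bounded operator that commutes with the resolvent preserves the domain, and commutes with the
operator. -/
lemma map_eq_of_commute_resolvent {z : ℂ} (hz : z ∈ resolventSet A) {S : F →L[ℂ] F}
    (hS : Commute S (resolvent A z)) (φ : A.domain) :
    ∃ h : S φ ∈ A.domain, A ⟨S φ, h⟩ = S (A φ) := by
  have hR := isResolventAt_resolvent hz
  have h1 : S φ = resolvent A z (S (A φ - z • (φ : F))) := by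
    conv_lhs => rw [← hR.2 φ]
    exact congrArg (fun T : F →L[ℂ] F => T (A φ - z • (φ : F))) hS.eq
  have h2 := hR.apply (S (A φ - z • (φ : F)))
  have h3 : S φ ∈ A.domain := h1 ▸ hR.mem_domain _
  refine ⟨h3, ?_⟩
  have h4 : A ⟨S φ, h3⟩ = A ⟨_, hR.mem_domain (S (A φ - z • (φ : F)))⟩ :=
    congrArg A (Subtype.ext h1)
  rw [h4, h2, ← h1, map_sub, map_smul, sub_add_cancel]

/-- The spectral projection below a gap maps into the domain. -/
lemma EnclosesBelow.specProj_mem_domain (hC : EnclosesBelow A μ c r) (hA : IsSelfAdjoint A)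
    (hμ : (μ : ℂ) ∈ resolventSet A) (ψ : F) : specProj A μ ψ ∈ A.domain := by
  have h1 := circleIntegral_resolvent hC hA hμ
  have hcont : ContinuousOn (fun z : ℂ => 1 + (z - μ) • resolvent A z) (Metric.sphere c r) :=
    continuousOn_const.add ((by fun_prop : ContinuousOn (fun z : ℂ => z - μ) _).smul
      (hC.continuousOn_sphere hA hμ))
  have h2 := circleIntegral_clm (ContinuousLinearMap.mul ℂ (F →L[ℂ] F) (resolvent A μ))
    (hcont.circleIntegrable hC.1.le)
  -- Pulling out one resolvent displays the range of the projection inside the range of (A - μ)⁻¹,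
  -- hence inside the domain.
  have h3 : (∮ z in C(c, r), resolvent A z) =
      resolvent A μ * ∮ z in C(c, r), (1 + (z - μ) • resolvent A z) := by
    simp only [ContinuousLinearMap.mul_apply'] at h2
    rw [← h2]
    exact circleIntegral.integral_congr hC.1.le fun z hz =>
      resolvent_eq_mul' (hC.sphere_subset hA hμ hz) hμ
  rw [h3] at h1
  have h4 := congrArg (fun T : F →L[ℂ] F => T ψ) h1
  have h5 : resolvent A μ ((∮ z in C(c, r), (1 + (z - μ) • resolvent A z)) ψ) =
      -(2 * Real.pi * Complex.I) • specProj A μ ψ := h4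
  have h6 := (isResolventAt_resolvent hμ).mem_domain
    ((∮ z in C(c, r), (1 + (z - μ) • resolvent A z)) ψ)
  rw [h5] at h6
  refine (A.domain.smul_mem_iff ?_).1 h6
  rw [neg_ne_zero]
  exact Complex.two_pi_I_ne_zero

end Domain

namespace Crystal

variable {d N : ℕ} {c : Crystal d N}

lemma periodic_one : Periodic (1 : c.H →L[ℂ] c.H) := fun _ => Commute.one_right _

/-! ### Trace identities for commutators and off-diagonal operators. -/

section Projection

variable {P : c.H →L[ℂ] c.H}

variable (hsa : IsSelfAdjoint P) (hP : Periodic P) (hfin : hsSq (P ∘L c.emb) < ⊤) (hPP : P * P = P)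
include hsa hP hfin hPP

lemma hasCellTrace_mul_right {X : c.H →L[ℂ] c.H} (hX : Periodic X) :
    HasCellTrace (X * P) (cellTrace P X) := by
  simpa only [mul_one, one_mul] using
    hasCellTrace_mul_mul hsa hP hfin hPP hX periodic_one

lemma hasCellTrace_mul_left {X : c.H →L[ℂ] c.H} (hX : Periodic X) :
    HasCellTrace (P * X) (cellTrace P X) := by
  simpa only [mul_one, one_mul] using
    hasCellTrace_mul_mul hsa hP hfin hPP periodic_one hX

/-- The cyclicity argument for `[H, B] Π₁`.  Here `h`, `K`, `M`, `L` stand for the bounded operators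
`H P`, `H B P`, `H B Q` and `H Q`. -/
lemma hasCellTrace_commutator_mul {B D Q h K M L : c.H →L[ℂ] c.H} (hB : Periodic B)
    (hQ : Periodic Q) (hh : Periodic h) (hK : Periodic K) (hM : Periodic M)
    (hL : Periodic L) (hhP : h * P = h) (hPh : P * h = h) (hKP : K * P = K)
    (hMeq : M = K * Q + M * P) (hLeq : L = h * Q + L * P) (hLP : L * P = Q * h + D * P)
    (hPL : P * L = h * Q) (hPM : P * M = h * (B * Q)) (hQK : Q * K = L * (B * P) - D * (B * P)) :
    HasCellTrace (M - B * L) (-cellTrace P (D * B) - cellTrace P (B * D)) := by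
  -- Inserting Q = P Q + Q P in H B Q - B H Q leaves four terms, each with a factor P, to which the
  -- cyclicity of the cell trace applies.
  have h1 : M - B * L = K * P * Q + M * P - (B * h * P * Q + B * L * P) := by
    rw [hKP, mul_assoc B h P, hhP, mul_assoc B h Q, mul_assoc B L P, ← mul_add, ← hLeq, ← hMeq]
  have h2 := ((hasCellTrace_mul_mul hsa hP hfin hPP hK hQ).add
    (hasCellTrace_mul_right hsa hP hfin hPP hM)).sub
    ((hasCellTrace_mul_mul hsa hP hfin hPP (hB.mul hh) hQ).add
      (hasCellTrace_mul_right hsa hP hfin hPP (hB.mul hL)))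
  rw [← h1] at h2
  have e1 : cellTrace P M = cellTrace P (B * Q * h) := by
    rw [← cellTrace_mul_comm hsa hP hfin hPP hh (hB.mul hQ) hhP hPh]
    exact cellTrace_congr hsa hP hfin (by rw [hPM, ← mul_assoc P h, hPh])
  -- Here H Q P = Q H P + D P, the commutation relation [H, Q] = D. The terms with h cancel against
  -- those of `e1` and `e3`, so only D B and B D survive.
  have e2 : cellTrace P (B * L) = cellTrace P (B * Q * h) + cellTrace P (B * D) := by
    rw [← cellTrace_add hsa hP hfin]
    refine cellTrace_congr hsa hP hfin ?_
    rw [mul_assoc P (B * L) P, mul_assoc B L P, hLP, mul_assoc P (_ + _) P, add_mul, mul_assoc _ h P,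
      hhP, mul_assoc B D P, mul_assoc B Q h, ← mul_add]
  have e3 : cellTrace P (Q * K) = cellTrace P (Q * (B * h)) + (-1) * cellTrace P (D * B) := by
    rw [← mul_assoc Q B h, ← cellTrace_mul_comm hsa hP hfin hPP hh (hQ.mul hB) hhP hPh,
      ← cellTrace_smul hsa hP hfin, ← cellTrace_add hsa hP hfin]
    refine cellTrace_congr hsa hP hfin ?_
    have hPhP : P * (h * (Q * B)) * P = P * (L * (B * P)) * P := by
      rw [← mul_assoc P h, hPh, ← mul_assoc h Q B, ← hPL, mul_assoc _ _ P, ← mul_assoc P L,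
        mul_assoc (P * L) _ P, mul_assoc B P P, hPP]
    rw [hQK, mul_add, add_mul, hPhP, mul_sub, sub_mul, neg_one_smul, mul_neg, neg_mul,
      ← sub_eq_add_neg, ← mul_assoc D B P, ← mul_assoc P (D * B) P, mul_assoc (P * (D * B)) P P, hPP]
  rw [e1, e2, e3] at h2
  convert! h2 using 1
  ring

/-- The cyclicity argument for `P [[B, P], D]` with an off-diagonal `D`. -/
lemma hasCellTrace_double_commutator {B D : c.H →L[ℂ] c.H} (hB : Periodic B) (hD : Periodic D)
    (hPDP : P * D * P = 0) :
    HasCellTrace (P * ((B * P - P * B) * D - D * (B * P - P * B)))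
      (-cellTrace P (D * B) - cellTrace P (B * D)) := by
  have h1 : P * ((B * P - P * B) * D - D * (B * P - P * B)) =
      P * B * P * D - P * (B * D) - P * (D * B * P) := by
    have h2 : P * (D * (P * B)) = 0 := by rw [← mul_assoc D P B, ← mul_assoc P, ← mul_assoc P D P,
      hPDP, zero_mul]
    have h3 : P * (P * B * D) = P * (B * D) := by rw [mul_assoc P B D, ← mul_assoc P P, hPP]
    rw [mul_sub, sub_mul, mul_sub, h3, mul_sub D, mul_sub P (D * _), h2, sub_zero, mul_assoc B P D,
      mul_assoc (P * B) P D, mul_assoc P B (P * D), mul_assoc D B P]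
  -- This is the trace obtained by moving P B P in front of D to the other side; it contains P D P =
  -- 0.
  have h4 : cellTrace P (D * (P * B)) = 0 := by
    have h5 : P * (D * (P * B)) * P = P * ((0 : ℂ) • (D * (P * B))) * P := by
      rw [← mul_assoc D P B, ← mul_assoc P, ← mul_assoc P D P, hPDP, zero_smul, zero_mul, zero_mul,
        mul_zero, zero_mul]
    rw [cellTrace_congr hsa hP hfin h5, cellTrace_smul hsa hP hfin, zero_mul]
  have h6 : cellTrace P (D * B * P) = cellTrace P (D * B) :=
    cellTrace_congr hsa hP hfin (by
      rw [mul_assoc P (D * B * P) P, mul_assoc (D * B) P P, hPP, ← mul_assoc P (D * B) P])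
  have h7 := ((hasCellTrace_mul_mul hsa hP hfin hPP (hP.mul hB) hD).sub
    (hasCellTrace_mul_left hsa hP hfin hPP (hB.mul hD))).sub
    (hasCellTrace_mul_left hsa hP hfin hPP ((hD.mul hB).mul hP))
  rw [h1]
  rw [h4, h6] at h7
  convert! h7 using 1
  ring

/-- The trace of `B D` on the fundamental cell, for an off-diagonal `D`. -/
lemma hasCellTrace_mul_offDiagonal {B D : c.H →L[ℂ] c.H} (hB : Periodic B) (hD : Periodic D)
    (hPD : D = P * D + D * P) :
    HasCellTrace (B * D) (cellTrace P (D * B) + cellTrace P (B * D)) := by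
  have h := (hasCellTrace_mul_mul hsa hP hfin hPP hB hD).add
    (hasCellTrace_mul_right hsa hP hfin hPP (hB.mul hD))
  rwa [mul_assoc, mul_assoc, ← mul_add, ← hPD] at h

end Projection

end Crystal


lemma Crystal.IsLineC1.map {d N : ℕ} {c : Crystal d N} {j : Fin d} {ψ : c.H}
    (hψ : c.IsLineC1 j ψ) {T : c.H →L[ℂ] c.H} {A A' : Space d → c.Hf →L[ℂ] c.Hf}
    (hT : Fibered T A) (hA : LineC1 j A A') : c.IsLineC1 j (T ψ) := by
  obtain ⟨D, hD⟩ := exists_fibered_deriv hT hA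
  exact (hT.comm_position hA hD hψ).1

/-! ### The torque operator and the double commutator. -/

namespace GappedModel

open Crystal

variable {d N : ℕ} {c : Crystal d N} {m : GappedModel c} {z₀ : ℂ} {r : ℝ} {j : Fin d}

lemma periodic_of_isPeriodic {B : c.H →L[ℂ] c.H} (h : c.IsPeriodic (ofBdd B)) : Periodic B :=
  fun γ => ContinuousLinearMap.ext fun ψ => ((h γ ⟨ψ, trivial⟩).2).symm

lemma commute_TL_resolvent {z : ℂ} (hz : z ∈ resolventSet m.H₀) :
    Periodic (resolvent m.H₀ z) := fun γ =>
  ContinuousLinearMap.ext fun ψ => ((fibered_resolvent hz).map_T γ ψ).symm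

lemma periodic_fermi (hC : EnclosesBelow m.H₀ m.μ z₀ r) (j : Fin d) : Periodic m.fermi := fun γ =>
  ContinuousLinearMap.ext fun ψ => ((fibered_fermi hC j).map_T γ ψ).symm

lemma periodic_Pi1 (hC : EnclosesBelow m.H₀ m.μ z₀ r) {D : c.H →L[ℂ] c.H} (hD : Periodic D) :
    Periodic (m.Pi1 z₀ r D) := fun γ =>
  hC.commute_invLiouvillian m.selfAdjoint m.gap (hD γ) fun _ hz => commute_TL_resolvent hz γ

/-- The product of `H₀` with a bounded periodic operator that maps into its domain. -/
lemma exists_periodic_comp {S : c.H →L[ℂ] c.H} (hS : Periodic S) (h : ∀ ψ, S ψ ∈ m.H₀.domain) :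
    ∃ M : c.H →L[ℂ] c.H, Periodic M ∧ ∀ ψ, M ψ = m.H₀ ⟨S ψ, h ψ⟩ := by
  obtain ⟨M, hM⟩ := exists_bounded_comp m.selfAdjoint.isClosed S h
  refine ⟨M, fun γ => ContinuousLinearMap.ext fun ψ => ?_, hM⟩
  obtain ⟨h1, h2⟩ := m.periodic γ ⟨S ψ, h ψ⟩
  have h3 : S (c.T γ ψ) = c.T γ (S ψ) :=
    (congrArg (fun R : c.H →L[ℂ] c.H => R ψ) (hS γ).eq).symm
  change c.T γ (M ψ) = M (c.T γ ψ)
  rw [hM, hM, ← h2]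
  exact congrArg m.H₀ (Subtype.ext h3.symm)

/-- The trace of `[H₀, B] Π₁` on the fundamental cell, in terms of the off-diagonal `D`. -/
lemma exists_hasCellTrace_torque (hC : EnclosesBelow m.H₀ m.μ z₀ r) (j : Fin d) {B D : c.H →L[ℂ] c.H}
    (hB : m.InPP B) (hD : Periodic D) (hPD : D = m.fermi * D + D * m.fermi) :
    ∃ A : c.H →L[ℂ] c.H,
      HasCellTrace A (-cellTrace m.fermi (D * B) - cellTrace m.fermi (B * D)) ∧
      ∀ ψ, (ψ, A ψ) ∈ (pmul (comm m.H₀ (ofBdd B)) (ofBdd (m.Pi1 z₀ r D))).graph := by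
  set P := m.fermi with hPdef
  set Q := m.Pi1 z₀ r D with hQdef
  have hP : Periodic P := periodic_fermi hC j
  have hPP : P * P = P := fermi_mul_fermi hC
  have hQ : Periodic Q := periodic_Pi1 hC hD
  have hBp : Periodic B := periodic_of_isPeriodic hB.1.1
  have hBdom : ∀ {ψ}, ψ ∈ m.H₀.domain → B ψ ∈ m.H₀.domain := hB.mem_domain
  have hPdom : ∀ ψ, P ψ ∈ m.H₀.domain := hC.specProj_mem_domain m.selfAdjoint m.gap
  obtain ⟨hQdom, hcomm⟩ := hC.commutator_invLiouvillian m.selfAdjoint m.gap hPD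
  have hQeq : Q = P * Q + Q * P := hC.invLiouvillian_eq_add m.selfAdjoint m.gap hPD
  have hPH : ∀ φ : m.H₀.domain, m.H₀ ⟨P φ, hPdom φ⟩ = P (m.H₀ φ) := fun φ =>
    (map_eq_of_commute_resolvent m.gap (commute_specProj_resolvent m.gap m.gap) φ).2
  have ap : ∀ {S R : c.H →L[ℂ] c.H}, S = R → ∀ ψ, S ψ = R ψ := fun h ψ => by rw [h]
  have hH : ∀ {x y : c.H} (hx : x ∈ m.H₀.domain) (hy : y ∈ m.H₀.domain), x = y →
      m.H₀ ⟨x, hx⟩ = m.H₀ ⟨y, hy⟩ := fun _ _ h => congrArg m.H₀ (Subtype.ext h)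
  have hHadd : ∀ {x y z : c.H} (hx : x ∈ m.H₀.domain) (hy : y ∈ m.H₀.domain)
      (hz : z ∈ m.H₀.domain), z = x + y → m.H₀ ⟨z, hz⟩ = m.H₀ ⟨x, hx⟩ + m.H₀ ⟨y, hy⟩ :=
    fun {x y z} hx hy hz h => by
      rw [← m.H₀.map_add]
      exact hH _ _ h
  -- The products H P, H Q, H B P and H B Q are bounded by the closed graph theorem, since P and Q
  -- map into the domain and B preserves it. From here on only bounded operators appear.
  obtain ⟨h, hhp, hh⟩ := exists_periodic_comp hP hPdom
  obtain ⟨L, hLp, hL⟩ := exists_periodic_comp hQ hQdom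
  obtain ⟨K, hKp, hK⟩ := exists_periodic_comp (hBp.mul hP) fun ψ => hBdom (hPdom ψ)
  obtain ⟨M, hMp, hM⟩ := exists_periodic_comp (hBp.mul hQ) fun ψ => hBdom (hQdom ψ)
  have hfin := hsSq_fermi_cellEmb_lt_top hC j
  refine ⟨M - B * L, hasCellTrace_commutator_mul (isSelfAdjoint_specProj _ _) hP hfin hPP hBp hQ
    hhp hKp hMp hLp ?_ ?_ ?_ ?_ ?_ ?_ ?_ ?_ ?_, fun ψ => ?_⟩
  · ext1 ψ
    exact (hh _).trans ((hH _ _ (ap hPP ψ)).trans (hh ψ).symm)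
  · ext1 ψ
    change P (h ψ) = h ψ
    rw [hh, ← hPH ⟨P ψ, hPdom ψ⟩]
    exact hH _ _ (ap hPP ψ)
  · ext1 ψ
    exact (hK _).trans ((hH _ _ (congrArg B (ap hPP ψ))).trans (hK ψ).symm)
  · ext1 ψ
    change M ψ = K (Q ψ) + M (P ψ)
    rw [hM, hM, hK]
    refine hHadd _ _ _ ?_
    change B (Q ψ) = B (P (Q ψ)) + B (Q (P ψ))
    rw [← map_add]
    exact congrArg B (ap hQeq ψ)
  · ext1 ψ
    change L ψ = h (Q ψ) + L (P ψ)
    rw [hL, hL, hh]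
    exact hHadd _ _ _ (ap hQeq ψ)
  · ext1 ψ
    change L (P ψ) = Q (h ψ) + D (P ψ)
    rw [hL, hh, ← hcomm ⟨P ψ, hPdom ψ⟩]
    exact (add_sub_cancel _ _).symm
  · ext1 ψ
    change P (L ψ) = h (Q ψ)
    rw [hL, hh]
    exact (hPH ⟨Q ψ, hQdom ψ⟩).symm
  · ext1 ψ
    change P (M ψ) = h (B (Q ψ))
    rw [hM, hh]
    exact (hPH ⟨B (Q ψ), hBdom (hQdom ψ)⟩).symm
  · ext1 ψ
    change Q (K ψ) = L (B (P ψ)) - D (B (P ψ))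
    rw [hK, hL, ← hcomm ⟨B (P ψ), hBdom (hPdom ψ)⟩]
    exact (sub_sub_cancel _ _).symm
  · refine mem_graph_pmul.2 ⟨Q ψ, mem_graph_ofBdd.2 rfl, mem_graph_comm.2 ⟨M ψ, B (L ψ),
      ⟨B (Q ψ), mem_graph_ofBdd.2 rfl, ?_⟩, ⟨L ψ, ?_, mem_graph_ofBdd.2 rfl⟩, rfl⟩⟩
    · exact mem_graph_iff_exists.2 ⟨hBdom (hQdom ψ), (hM ψ).symm⟩
    · exact mem_graph_iff_exists.2 ⟨hQdom ψ, (hL ψ).symm⟩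

/-- On vectors that are differentiable in the direction `j`, the double commutator of the torque
response is bounded. -/
lemma mem_graph_double_commutator (hC : EnclosesBelow m.H₀ m.μ z₀ r) {B D : c.H →L[ℂ] c.H}
    (hB : m.InPP B)
    (hD : ∀ ψ, c.IsLineC1 j ψ → (ψ, D ψ) ∈ (comm (position c.ν j) (ofBdd m.fermi)).graph) {ψ : c.H}
    (hψ : c.IsLineC1 j ψ) :
    (ψ, (m.fermi * ((B * m.fermi - m.fermi * B) * D - D * (B * m.fermi - m.fermi * B))) ψ) ∈
      (pmul (ofBdd m.fermi) (comm (comm (ofBdd B) (ofBdd m.fermi))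
        (comm (position c.ν j) (ofBdd m.fermi)))).graph := by
  obtain ⟨b, b', hb, hBb⟩ := hB.exists_fibered j
  -- P and B have fibres differentiable in the direction j, so they preserve the vectors on which
  -- [X_j, P] acts as D. Every inner product in the double commutator is thus defined.
  have hP : ∀ {φ}, c.IsLineC1 j φ → c.IsLineC1 j (m.fermi φ) :=
    fun hφ => hφ.map (fibered_fermi hC j) (lineC1_fibFermi hC j)
  have hBp : ∀ {φ}, c.IsLineC1 j φ → c.IsLineC1 j (B φ) := fun hφ => hφ.map hBb hb
  have hE : ∀ φ, (φ, B (m.fermi φ) - m.fermi (B φ)) ∈ (comm (ofBdd B) (ofBdd m.fermi)).graph :=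
    fun φ => mem_graph_comm.2 ⟨_, _, ⟨_, mem_graph_ofBdd.2 rfl, mem_graph_ofBdd.2 rfl⟩,
      ⟨_, mem_graph_ofBdd.2 rfl, mem_graph_ofBdd.2 rfl⟩, rfl⟩
  refine mem_graph_pmul.2 ⟨_, mem_graph_comm.2 ⟨_, _, ⟨_, hD ψ hψ, hE _⟩,
    ⟨_, hE ψ, hD _ ((hBp (hP hψ)).sub (hP (hBp hψ)))⟩, rfl⟩, mem_graph_ofBdd.2 rfl⟩

end GappedModel


namespace Crystal

variable {d N : ℕ} {c : Crystal d N} {j : Fin d}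

lemma mem_graph_position_iff {ψ χ : c.H} :
    (ψ, χ) ∈ (position c.ν j).graph ↔ χ =ᵐ[c.ν] fun x => (x j : ℂ) • ψ x := by
  rw [mem_graph_iff_exists]
  constructor
  · rintro ⟨h, rfl⟩
    exact MemLp.coeFn_toLp (memLp_position c.ν ⟨ψ, h⟩)
  · intro h
    have h1 : MemLp (fun x => (x j : ℂ) • ψ x) 2 c.ν := (memLp_congr_ae h).1 (Lp.memLp χ)
    exact ⟨h1, Lp.ext ((MemLp.coeFn_toLp h1).trans h.symm)⟩

lemma coeFn_cellCoeff_zero (ψ : c.H) : c.cellCoeff 0 ψ =ᵐ[c.ν.restrict c.fundCell] ψ := by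
  rw [cellCoeff_apply, T_zero]
  exact c.coeFn_restrictCell ψ

lemma coeFn_emb (v : c.Hf) : c.emb v =ᵐ[c.ν] c.fundCell.indicator v := by
  change c.cellEmb 0 v =ᵐ[c.ν] _
  rw [cellEmb_apply, neg_zero, T_zero]
  exact c.coeFn_extend v

lemma chi_emb (v : c.Hf) : chi c.ν c.fundCell c.measurableSet_fundCell (c.emb v) = c.emb v := by
  rw [chi_fundCell]
  exact congrArg (c.cellEmb 0) (c.cellCoeff_cellEmb_self 0 v)

/-- The position operator in the fundamental cell. -/
lemma exists_cellPosition (c : Crystal d N) (j : Fin d) : ∃ Y : c.Hf →L[ℂ] c.Hf,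
    (∀ ψ χ, (ψ, χ) ∈ (position c.ν j).graph → c.cellCoeff 0 χ = Y (c.cellCoeff 0 ψ)) ∧
    ∀ v, (c.emb v, c.emb (Y v)) ∈ (position c.ν j).graph := by
  obtain ⟨ρ, hρ, hb⟩ := c.exists_bound_fundCell
  refine ⟨bddPosition hρ hb j, fun ψ χ h => Lp.ext ?_, fun v => mem_graph_position_iff.2 ?_⟩
  · filter_upwards [coeFn_cellCoeff_zero χ, coeFn_cellCoeff_zero ψ,
      coeFn_bddPosition hρ hb j (c.cellCoeff 0 ψ),
      ae_restrict_of_ae (mem_graph_position_iff.1 h)] with x h1 h2 h3 h4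
    rw [h1, h3, h2, h4]
  · filter_upwards [coeFn_emb v, coeFn_emb (bddPosition hρ hb j v),
      (ae_restrict_iff' c.measurableSet_fundCell).1 (coeFn_bddPosition hρ hb j v)] with x h1 h2 h3
    rw [h1, h2]
    by_cases hx : x ∈ c.fundCell
    · simp [hx, h3 hx]
    · simp [hx]

/-! ## Operators acting on the internal degrees of freedom -/

variable (s : Internal N →L[ℂ] Internal N)

lemma compLpL_planeWave (ν : Measure (Space d)) (k : Space d) (ψ : Lp (Internal N) 2 ν) :
    s.compLpL 2 ν (planeWave ν k ψ) = planeWave ν k (s.compLpL 2 ν ψ) := by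
  refine Lp.ext ?_
  filter_upwards [s.coeFn_compLpL (planeWave ν k ψ), coeFn_planeWave ν k ψ,
    coeFn_planeWave ν k (s.compLpL 2 ν ψ), s.coeFn_compLpL ψ] with x h1 h2 h3 h4
  rw [h1, h2, h3, h4, map_smul]

/-- Periodicity lets s pass through the magnetic translation; restriction to the cell is pointwise
and commutes with s anyway. -/
lemma cellCoeff_compLpL (hs : c.IsPeriodic (ofBdd (s.compLpL 2 c.ν))) (γ : c.Γ) (ψ : c.H) :
    c.cellCoeff γ (s.compLpL 2 c.ν ψ) =
      s.compLpL 2 (c.ν.restrict c.fundCell) (c.cellCoeff γ ψ) := by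
  obtain ⟨_, h⟩ := hs γ ⟨ψ, trivial⟩
  have h' : s.compLpL 2 c.ν (c.T γ ψ) = c.T γ (s.compLpL 2 c.ν ψ) := h
  rw [cellCoeff_apply, ← h', cellCoeff_apply]
  refine Lp.ext ?_
  filter_upwards [c.coeFn_restrictCell (s.compLpL 2 c.ν (c.T γ ψ)),
    c.coeFn_restrictCell (c.T γ ψ), ae_restrict_of_ae (s.coeFn_compLpL (c.T γ ψ)),
    s.coeFn_compLpL (c.restrictCell (c.T γ ψ))] with x h1 h2 h3 h4
  rw [h1, h3, h4, h2]

lemma isBFZ_compLpL (hs : c.IsPeriodic (ofBdd (s.compLpL 2 c.ν))) {ψ : c.H} {φ : Space d → c.Hf}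
    (h : c.IsBFZ ψ φ) :
    c.IsBFZ (s.compLpL 2 c.ν ψ) fun k => s.compLpL 2 (c.ν.restrict c.fundCell) (φ k) := by
  set S := s.compLpL 2 (c.ν.restrict c.fundCell) with hS
  refine isBFZ_iff.2 ⟨S.comp_memLp' h.memLp, fun g hg k => ?_, fun γ => ?_⟩
  · rw [h.equiv hg]
    exact compLpL_planeWave s _ _ _
  · rw [cellCoeff_compLpL s hs, h.cellCoeff, ← hS]
    rw [← fourierCoeff_clm γ S (memLp_wave h.memLp)]
    exact congrArg _ (funext fun k => compLpL_planeWave s _ _ _)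

end Crystal

/-! ### Generalized spin operators and observables commuting with X_j. -/

namespace GappedModel

open Crystal

variable {d N : ℕ} {c : Crystal d N} {m : GappedModel c} {z₀ : ℂ} {r : ℝ} {j : Fin d}

/-- The fibration is constant in k, on 𝓗_f as well as on 𝓓_f, because s commutes with plane waves.
-/
lemma IsSpin.inPP {s : Internal N →L[ℂ] Internal N} (hs : m.IsSpin s) :
    m.InPP (s.compLpL 2 c.ν) := by
  obtain ⟨-, hp, f, hf⟩ := hs
  refine ⟨⟨hp, fun _ => s.compLpL 2 (c.ν.restrict c.fundCell), contDiff_const, ?_, ?_⟩,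
    hp, fun _ => f, contDiff_const, ?_, ?_⟩
  · intro g _ k v w h
    change w = c.rho g v at h
    change s.compLpL 2 (c.ν.restrict c.fundCell) w =
      c.rho g (s.compLpL 2 (c.ν.restrict c.fundCell) v)
    rw [h]
    exact compLpL_planeWave s _ _ _
  · exact fun ψ φ _ h => ⟨trivial, isBFZ_compLpL s hp h⟩
  · intro g _ k v w h
    rw [hf, hf, h]
    exact compLpL_planeWave s _ _ _
  · intro ψ φ _ h
    refine ⟨trivial, ?_⟩
    simp only [hf]
    exact isBFZ_compLpL s hp h

lemma comm_compLpL_position (s : Internal N →L[ℂ] Internal N)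
    (ψ : (comm (ofBdd (s.compLpL 2 c.ν)) (position c.ν j)).domain) :
    comm (ofBdd (s.compLpL 2 c.ν)) (position c.ν j) ψ = 0 := by
  obtain ⟨η₁, η₂, ⟨η, h1, h2⟩, ⟨ξ, h3, h4⟩, h5⟩ := mem_graph_comm.1
    ((comm (ofBdd (s.compLpL 2 c.ν)) (position c.ν j)).mem_graph ψ)
  rw [h5, sub_eq_zero]
  rw [mem_graph_ofBdd] at h2 h3
  rw [mem_graph_position_iff] at h1 h4
  subst h2 h3
  refine Lp.ext ?_
  filter_upwards [s.coeFn_compLpL η, s.coeFn_compLpL (ψ : c.H), h1, h4] with x k1 k2 k3 k4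
  rw [k1, k3, k4, k2, map_smul]

/-- The left side is the trace of B D on the cell. As B commutes with X_j, formally B D = [X_j, B
P]. Compressed to the cell, where X_j is a bounded operator Y, this is the commutator of Y with a
trace class operator and has trace 0. -/
lemma cellTrace_add_eq_zero (hC : EnclosesBelow m.H₀ m.μ z₀ r) {B D : c.H →L[ℂ] c.H}
    (hB : m.InPP B) (hDp : Periodic D) (hPD : D = m.fermi * D + D * m.fermi)
    (hD : ∀ ψ, c.IsLineC1 j ψ → (ψ, D ψ) ∈ (comm (position c.ν j) (ofBdd m.fermi)).graph)
    (hBX : ∀ ψ, comm (ofBdd B) (position c.ν j) ψ = 0) :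
    cellTrace m.fermi (D * B) + cellTrace m.fermi (B * D) = 0 := by
  have hfin := hsSq_fermi_cellEmb_lt_top hC j
  have hP := periodic_fermi hC j
  have hsa : IsSelfAdjoint m.fermi := isSelfAdjoint_specProj _ _
  have hPP := fermi_mul_fermi hC
  have hBp := periodic_of_isPeriodic hB.1.1
  have h1 := (hasCellTrace_mul_offDiagonal hsa hP hfin hPP hBp hDp hPD).2.1
  have h2 := (hasCellTrace_mul_right hsa hP hfin hPP hBp).2.1
  obtain ⟨Y, hY1, hY2⟩ := c.exists_cellPosition j
  obtain ⟨b, b', hb, hBb⟩ := hB.exists_fibered j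
  have h3 := h2.1.hasTrace_commutator Y
  refine h1.unique ?_
  convert! h3 using 1
  ext1 v
  have hv : c.IsLineC1 j (c.emb v) := by
    rw [← chi_emb]
    exact (isSmoothBF_chi _ c.isBounded_fundCell _).isLineC1
  obtain ⟨η₁, η₂, ⟨η, k1, k2⟩, ⟨ξ, k3, k4⟩, k5⟩ := mem_graph_comm.1 (hD _ hv)
  rw [mem_graph_ofBdd] at k1 k4
  have k6 := mem_graph_unique k3 (hY2 v)
  subst k1 k6 k4
  have hPv : c.IsLineC1 j (m.fermi (c.emb v)) :=
    hv.map (fibered_fermi hC j) (lineC1_fibFermi hC j)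
  obtain ⟨φ, φ', hφ, hφ'⟩ := hPv.map hBb hb
  obtain ⟨χ, hχ, -⟩ := mem_graph_position hφ hφ'
  -- The vector P v lies in the domain of [B, X_j], because both P v and B P v have differentiable
  -- transforms. The hypothesis then yields B X_j P v = X_j B P v.
  have k7 : (m.fermi (c.emb v), B η₁ - χ) ∈ (comm (ofBdd B) (position c.ν j)).graph :=
    mem_graph_comm.2 ⟨_, _, ⟨_, k2, mem_graph_ofBdd.2 rfl⟩, ⟨_, mem_graph_ofBdd.2 rfl, hχ⟩, rfl⟩
  obtain ⟨k8, k9⟩ := mem_graph_iff_exists.1 k7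
  rw [hBX, eq_comm, sub_eq_zero] at k9
  change c.cellCoeff 0 (B (D (c.emb v))) = Y (c.cellCoeff 0 (B (m.fermi (c.emb v)))) -
    c.cellCoeff 0 (B (m.fermi (c.emb (Y v))))
  rw [k5, map_sub, map_sub, k9, hY1 _ _ hχ]

end GappedModel

end TorqueResponse

/-! ### The theorem. -/

theorem proposition5p3 {d N : ℕ} (c : TorqueResponse.Crystal d N)
    (m : TorqueResponse.GappedModel c) (j : Fin d) (z₀ : ℂ) (r : ℝ)
    (hC : TorqueResponse.EnclosesBelow m.H₀ m.μ z₀ r) :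
    ∃ D : c.H →L[ℂ] c.H, m.IsClosureOfComm j D ∧
      (∀ B : c.H →L[ℂ] c.H, m.InPP B →
        (∃ t : ℂ, c.HasTau (m.torque B (m.Pi1 z₀ r D)) t ∧ c.HasTau (m.torqueResponse j B) t) ∧
        ((∀ ψ, TorqueResponse.comm (TorqueResponse.ofBdd B)
            (TorqueResponse.position c.ν j) ψ = 0) →
          c.HasTau (m.torque B (m.Pi1 z₀ r D)) 0)) ∧
      (∀ s : TorqueResponse.Internal N →L[ℂ] TorqueResponse.Internal N, m.IsSpin s →
        c.HasTau (m.torque (s.compLpL 2 c.ν) (m.Pi1 z₀ r D)) 0) := by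
  obtain ⟨D, hcl, hgr, hDT, hPD⟩ := TorqueResponse.GappedModel.exists_comm_position_fermi hC j
  have hDp : TorqueResponse.Crystal.Periodic D := fun γ =>
    ContinuousLinearMap.ext fun ψ => (hDT γ ψ).symm
  -- Both sides of the identity are evaluated to this same expression, which is -i times the cell
  -- trace of B D divided by the volume of the cell.
  have key : ∀ B : c.H →L[ℂ] c.H, m.InPP B →
      c.HasTau (m.torque B (m.Pi1 z₀ r D))
        (Complex.I * (-TorqueResponse.Crystal.cellTrace m.fermi (D * B) -
          TorqueResponse.Crystal.cellTrace m.fermi (B * D)) / (c.ν.real c.fundCell : ℂ)) :=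
    fun B hB => by
      obtain ⟨A, hA, hAgr⟩ :=
        TorqueResponse.GappedModel.exists_hasCellTrace_torque hC j hB hDp hPD
      exact (hA.smul Complex.I).hasTau fun Ω hΩ _ ψ => TorqueResponse.mem_graph_smul _ (hAgr _)
  have key2 : ∀ B : c.H →L[ℂ] c.H, m.InPP B →
      (∀ ψ, TorqueResponse.comm (TorqueResponse.ofBdd B)
        (TorqueResponse.position c.ν j) ψ = 0) → c.HasTau (m.torque B (m.Pi1 z₀ r D)) 0 :=
    fun B hB hBX => by
      have h := key B hB
      have h0 := TorqueResponse.GappedModel.cellTrace_add_eq_zero hC hB hDp hPD hgr hBX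
      rwa [← neg_add', h0, neg_zero, mul_zero, zero_div] at h
  refine ⟨D, hcl, fun B hB => ⟨⟨_, key B hB, ?_⟩, key2 B hB⟩, fun s hs => key2 _ hs.inPP
    fun ψ => TorqueResponse.GappedModel.comm_compLpL_position s ψ⟩
  have h := TorqueResponse.Crystal.hasCellTrace_double_commutator
    (TorqueResponse.isSelfAdjoint_specProj m.H₀ m.μ)
    (TorqueResponse.GappedModel.periodic_fermi hC j)
    (TorqueResponse.GappedModel.hsSq_fermi_cellEmb_lt_top hC j)
    (TorqueResponse.GappedModel.fermi_mul_fermi hC)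
    (TorqueResponse.GappedModel.periodic_of_isPeriodic hB.1.1) hDp
    (TorqueResponse.mul_mul_eq_zero_of_offDiagonal
      (TorqueResponse.GappedModel.fermi_mul_fermi hC) hPD)
  exact (h.smul Complex.I).hasTau fun Ω hΩ hb ψ => TorqueResponse.mem_graph_smul _
    (TorqueResponse.GappedModel.mem_graph_double_commutator hC hB hgr
      (TorqueResponse.Crystal.isSmoothBF_chi hΩ hb ψ).isLineC1)
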